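/- **Theorem (gradient estimate).** Let $n\ge 2$ and let $\bar M=M\cup\partial M$ be a compact smooth Riemannian manifold of dimension $n$ with (possibly empty) smooth boundary $\partial M$, interior $M$ and metric $g$. Let $\chi$ be a smooth symmetric $(0,2)$ tensor on $\bar M$. Let $\Gamma\subseteq\mathbb R^{n+1}$ be an open convex cone with vertex at the origin, invariant under permutations of the coordinates and containing $\{\lambda:\lambda_1,\dots,\lambda_{n+1}>0\}$, and let $f:\Gamma\to\mathbb R$ be a smooth symmetric function; write $f_i=\partial f/\partial\lambda_i$. Assume that 1. $f_i>0$ in $\Gamma$ for $1\le i\le n+1$, and $f$ is concave in $\Gamma$; 2. for some constant $\nu_0>0$: $f_j(\lambda)\ge\nu_0\bigl(1+\sum_{i=1}^{n+1}f_i(\lambda)\bigr)$ for every $\lambda\in\Gamma$ and every $j$ with $\lambda_j<0$; 3. for some constant $K_0\ge0$: $\sum_{i=1}^{n+1}f_i(\lambda)\lambda_i\ge-K_0\bigl(1+\sum_{i=1}^{n+1}f_i(\lambda)\bigr)$ for every $\lambda\in\Gamma$. For $0<T\le\infty$ let $J=[0,T]$ if $T<\infty$ and $J=[0,\infty)$ if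 $T=\infty$; put $\overline{M_T}=\bar M\times J$ and $\mathcal PM_T=(\bar M\times\{0\})\cup(\partial M\times J)$. Let $C^k(\overline{M_T})$ be the space of functions on $\overline{M_T}$ whose derivatives $\nabla^\beta D_t^r$ with $|\beta|+2r\le k$ exist and are continuous on $\overline{M_T}$, and put $|u|_{C^0}=\sup_{\overline{M_T}}|u|$ and $|\psi|_{C^1}=\sup_{\overline{M_T}}|\psi|+\sup_{\overline{M_T}}|\nabla\psi|$, where $\nabla$ is the gradient in $x$ only. Then for all $A,B\ge0$ there is a constant $C$, depending only on $(\bar M,g)$, $\chi$, $f$, $\Gamma$, $\nu_0$, $K_0$, $A$ and $B$, such that for every $0<T\le\infty$, every $\psi\in C^1(\overline{M_T})$ with $|\psi|_{C^1}\le A$, and every $u\in C^3(\overline{M_T})$ with $|u|_{C^0}\le B$ which is an admissible solution of $$f(\lambda(\nabla^2u+\chi),-u_t)=\psi,$$ that is, for which $(\lambda(\nabla^2u+\chi),-u_t)\in\Gamma$ and the equation holds at every $(x,t)$ with $x\in M$, $t\in J$, $t>0$, where $\lambda(\nabla^2u+\chi)$ denotes the eigenvalues with respect to $g$ of the spatial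 Hessian of $u$ plus $\chi$, one has $$\sup_{\overline{M_T}}|\nabla u|\le C\Bigl(1+\sup_{\mathcal PM_T}|\nabla u|\Bigr).$$ In particular, no subsolution is assumed to exist. -/

import Mathlib

open Set Bundle Manifold
open scoped ContDiff ENNReal NNReal Topology

noncomputable section

/-! ### Symmetric functions on symmetric cones -/

/-- `Γ ⊆ ℝᵐ` is an open convex cone with vertex at the origin, invariant under permutations of the
coordinates and containing the open positive cone `{λ : all λ_i > 0}`. -/
structure IsSymmetricCone {m : ℕ} (Γ : Set (Fin m → ℝ)) : Prop where
  isOpen : IsOpen Γ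
  convex : Convex ℝ Γ
  smul_mem : ∀ c : ℝ, 0 < c → ∀ lam ∈ Γ, c • lam ∈ Γ
  perm_mem : ∀ σ : Equiv.Perm (Fin m), ∀ lam ∈ Γ, lam ∘ σ ∈ Γ
  pos_mem : ∀ lam : Fin m → ℝ, (∀ i, 0 < lam i) → lam ∈ Γ

/-- `f` is a smooth function on `Γ`, symmetric in its `m` variables. -/
structure IsSmoothSymmetricOn {m : ℕ} (f : (Fin m → ℝ) → ℝ) (Γ : Set (Fin m → ℝ)) : Prop where
  smooth : ContDiffOn ℝ ∞ f Γ
  symm : ∀ σ : Equiv.Perm (Fin m), ∀ lam ∈ Γ, f (lam ∘ σ) = f lam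

/-- The partial derivative `f_i = ∂f/∂λ_i`. -/
def partialDeriv {m : ℕ} (f : (Fin m → ℝ) → ℝ) (i : Fin m) (lam : Fin m → ℝ) : ℝ :=
  fderiv ℝ f lam (Pi.single i 1)

/-! ### Local coordinates, Christoffel symbols and the Hessian on a Riemannian manifold

`M` is a manifold with (possibly empty) boundary modelled on the half space of `ℝⁿ`. The letter `c`
denotes a point whose preferred chart `extChartAt (𝓡∂ n) c` is used as local coordinates (all charts
`chartAt _ c` together cover `M`); `z` denotes a point of the coordinate domain. -/

section Geometry

variable {n : ℕ} [NeZero n]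

/-- The partial derivative `∂h/∂zⁱ` of a function of the coordinates (one-sided at points of the
boundary of the half space). -/
def coordDeriv (i : Fin n) (h : EuclideanSpace ℝ (Fin n) → ℝ) (z : EuclideanSpace ℝ (Fin n)) : ℝ :=
  fderivWithin ℝ h (range (𝓡∂ n)) z (EuclideanSpace.single i 1)

variable {M : Type*} [TopologicalSpace M] [ChartedSpace (EuclideanHalfSpace n) M]

/-- The expression of a function on `M` in the chart at `c`. -/
def inChart (c : M) (h : M → ℝ) (z : EuclideanSpace ℝ (Fin n)) : ℝ :=
  h ((extChartAt (𝓡∂ n) c).symm z)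

/-- The coordinate vector field `∂_i` of the chart at `c`, at the point with coordinates `z`. -/
def coordVector (c : M) (i : Fin n) (z : EuclideanSpace ℝ (Fin n)) :
    TangentSpace (𝓡∂ n) ((extChartAt (𝓡∂ n) c).symm z) :=
  mfderivWithin 𝓘(ℝ, EuclideanSpace ℝ (Fin n)) (𝓡∂ n) (extChartAt (𝓡∂ n) c).symm
    (range (𝓡∂ n)) z (EuclideanSpace.single i (1 : ℝ) : EuclideanSpace ℝ (Fin n))

/-- The `i`-th component in the chart at `c` of a tangent vector at `x`: the number `dzⁱ(v)`. -/
def coordComponent (c x : M) (i : Fin n) (v : TangentSpace (𝓡∂ n) x) : ℝ :=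
  EuclideanSpace.proj (𝕜 := ℝ) i
    (mfderiv (𝓡∂ n) 𝓘(ℝ, EuclideanSpace ℝ (Fin n)) (extChartAt (𝓡∂ n) c) x v)

variable [RiemannianBundle (fun x : M => TangentSpace (𝓡∂ n) x)]

/-- The matrix `g_ij = g(∂_i, ∂_j)` of the metric in the chart at `c`. -/
def metricMatrix (c : M) (z : EuclideanSpace ℝ (Fin n)) : Matrix (Fin n) (Fin n) ℝ :=
  Matrix.of fun i j => inner ℝ (coordVector c i z) (coordVector c j z)

/-- The Christoffel symbols of the Levi-Civita connection in the chart at `c`: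
`Γᵏ_ij = ½ ∑_l gᵏˡ (∂_i g_jl + ∂_j g_il - ∂_l g_ij)`. -/
def christoffel (c : M) (k i j : Fin n) (z : EuclideanSpace ℝ (Fin n)) : ℝ :=
  2⁻¹ * ∑ l, (metricMatrix c z)⁻¹ k l *
    (coordDeriv i (fun y => metricMatrix c y j l) z
      + coordDeriv j (fun y => metricMatrix c y i l) z
      - coordDeriv l (fun y => metricMatrix c y i j) z)

/-- The components `∇_ij h = ∂_i ∂_j h - ∑_k Γᵏ_ij ∂_k h` of the Hessian in the chart at `c`. -/
def hessianMatrix (c : M) (h : M → ℝ) (z : EuclideanSpace ℝ (Fin n)) :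
    Matrix (Fin n) (Fin n) ℝ :=
  Matrix.of fun i j => coordDeriv i (coordDeriv j (inChart c h)) z
    - ∑ k, christoffel c k i j z * coordDeriv k (inChart c h) z

/-- The Hessian `∇²h` at `x` as a bilinear form on the tangent space, computed in the chart at `c`
(for `x` in the domain of this chart, the value is independent of the chart, `∇²h` being a
tensor). -/
def hessian (c : M) (h : M → ℝ) (x : M) (v w : TangentSpace (𝓡∂ n) x) : ℝ :=
  ∑ i, ∑ j, hessianMatrix c h (extChartAt (𝓡∂ n) c x) i j *
    coordComponent c x i v * coordComponent c x j w

/-- `lam` lists the eigenvalues (with multiplicity, in some order) with respect to the metric of the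
bilinear form `U` on the tangent space at `x`: in some orthonormal basis, `U` is diagonal with
diagonal entries `lam i`. -/
def IsEigenvalueTuple (x : M) (U : TangentSpace (𝓡∂ n) x → TangentSpace (𝓡∂ n) x → ℝ)
    (lam : Fin n → ℝ) : Prop :=
  ∃ e : OrthonormalBasis (Fin n) ℝ (TangentSpace (𝓡∂ n) x),
    ∀ i j, U (e i) (e j) = if i = j then lam i else 0

/-- The norm `|∇h|(x)` of the gradient, that is, the norm of the differential of `h` at `x` with
respect to the metric. -/
def gradNorm (h : M → ℝ) (x : M) : ℝ≥0∞ :=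
  ‖mfderiv (𝓡∂ n) 𝓘(ℝ, ℝ) h x‖ₑ

end Geometry

/-! ### Parabolic function spaces and the equation -/

/-- The time interval: `[0, T]` for finite `T` and `[0, ∞)` for `T = ∞`. -/
def timeSet (T : EReal) : Set ℝ := {t | 0 ≤ t ∧ (t : EReal) ≤ T}

/-- The time derivative `D_tʳ u` on `M × timeSet T` (one-sided at the ends of the interval). -/
def timeDeriv {M : Type*} (T : EReal) (r : ℕ) (u : M → ℝ → ℝ) (x : M) (t : ℝ) : ℝ :=
  iteratedDerivWithin r (fun s => u x s) (timeSet T) t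

/-- The supremum over `M × timeSet T` of the absolute value of `u`. -/
def c0Norm {M : Type*} (T : EReal) (u : M → ℝ → ℝ) : ℝ≥0∞ :=
  ⨆ x : M, ⨆ t ∈ timeSet T, ‖u x t‖ₑ

section Parabolic

variable {n : ℕ} [NeZero n] {M : Type*} [TopologicalSpace M]
  [ChartedSpace (EuclideanHalfSpace n) M]

variable (n) in
/-- The space `Cᵏ` on `M × timeSet T`: the derivatives `∇^β D_tʳ u` with `|β| + 2r ≤ k` exist and
are continuous in `(x, t)` (in every chart, up to the boundary). -/
def ParabolicContDiff (k : ℕ) (T : EReal) (u : M → ℝ → ℝ) : Prop :=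
  ∀ r : ℕ, 2 * r ≤ k →
    (∀ x, ContDiffOn ℝ r (fun t => u x t) (timeSet T)) ∧
    (∀ t ∈ timeSet T,
      ContMDiff (𝓡∂ n) 𝓘(ℝ, ℝ) ((k - 2 * r : ℕ) : WithTop ℕ∞) (fun x => timeDeriv T r u x t)) ∧
    ∀ c : M, ∀ j : ℕ, j + 2 * r ≤ k →
      ContinuousOn
        (fun p : EuclideanSpace ℝ (Fin n) × ℝ =>
          iteratedFDerivWithin ℝ j (inChart c (fun x => timeDeriv T r u x p.2))
            (range (𝓡∂ n)) p.1)
        ((extChartAt (𝓡∂ n) c).target ×ˢ timeSet T)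

variable (n M) in
/-- The parabolic boundary: the bottom `M × {0}` together with the side `∂M × timeSet T`. -/
def parabolicBoundary (T : EReal) : Set (M × ℝ) :=
  {p | p.2 ∈ timeSet T ∧ (p.2 = 0 ∨ p.1 ∈ (𝓡∂ n).boundary M)}

variable [RiemannianBundle (fun x : M => TangentSpace (𝓡∂ n) x)]

variable (n) in
/-- The supremum of `|∇u|` over `M × timeSet T`. -/
def gradSup (T : EReal) (u : M → ℝ → ℝ) : ℝ≥0∞ :=
  ⨆ x : M, ⨆ t ∈ timeSet T, gradNorm (n := n) (fun y => u y t) x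

variable (n) in
/-- The supremum of `|∇u|` over the parabolic boundary. -/
def gradSupBoundary (T : EReal) (u : M → ℝ → ℝ) : ℝ≥0∞ :=
  ⨆ p ∈ parabolicBoundary n M T, gradNorm (n := n) (fun y => u y p.2) p.1

variable (n) in
/-- The norm of `C¹` on `M × timeSet T`; in the parabolic scaling it involves no time
derivative. -/
def c1Norm (T : EReal) (u : M → ℝ → ℝ) : ℝ≥0∞ :=
  c0Norm T u + gradSup n T u

/-- `u` is an admissible solution of `f(λ(∇²u + χ), -u_t) = ψ`: at every point of the interior of
`M` and every time `t > 0`, and in every chart around the point, the eigenvalues `lam` of `∇²u + χ`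
with respect to the metric satisfy `(lam, -u_t) ∈ Γ` and `f(lam, -u_t) = ψ`. As `f` and `Γ` are
symmetric, the order of the eigenvalues is immaterial. -/
def IsAdmissibleSolution (f : (Fin (n + 1) → ℝ) → ℝ) (Γ : Set (Fin (n + 1) → ℝ))
    (χ : (x : M) → TangentSpace (𝓡∂ n) x →L[ℝ] TangentSpace (𝓡∂ n) x →L[ℝ] ℝ)
    (ψ : M → ℝ → ℝ) (T : EReal) (u : M → ℝ → ℝ) : Prop :=
  ∀ x ∈ (𝓡∂ n).interior M, ∀ t ∈ timeSet T, 0 < t →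
    ∀ c : M, x ∈ (chartAt (EuclideanHalfSpace n) c).source →
      ∃ lam : Fin n → ℝ,
        IsEigenvalueTuple x (fun v w => hessian c (fun y => u y t) x v w + χ x v w) lam ∧
        (Fin.snoc lam (-timeDeriv T 1 u x t) : Fin (n + 1) → ℝ) ∈ Γ ∧
        f (Fin.snoc lam (-timeDeriv T 1 u x t) : Fin (n + 1) → ℝ) = ψ x t

end Parabolic

end

/-!
The estimate follows from the maximum principle for `|∇u| / ζ(u)` on `M × [0, t₁]`, where the
`barrier` `ζ(s) = (2B + 1)² + 1 - (s + B + 1)²` is decreasing and concave and lies between `1`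
and `(2B + 1)² + 1` on `[-B, B]`. If the maximum `m` is attained on the parabolic boundary, nothing
is left to show. Otherwise the point of maximum has `P = |∇u|` bounded by a constant
(`IsAdmissibleSolution.gradLength_le_of_interior_max`), for the following reason.

In a chart, `Du(y) ≤ m ζ(u) |y|` for all tangent vectors `y`, with equality for the unit vector `y₀`
in the direction of the gradient. Testing this with vectors varying along a line
(`touching_conditions`) gives the first and second order conditions in space. In time it gives
`m ζ'(u) u_t ≤ D u_t(y₀)` (`ParabolicContDiff.time_condition`), once the derivatives in time and
space have been interchanged (`hasDerivWithinAt_of_mixed`). The second order condition is taken in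
the directions `e_a` of an eigenbasis of `∇²u + χ`, weighted with `f_a`, and compared with the
equation differentiated in the direction `y₀`. Eigenvalues need not be differentiable, so the linearised
equation is proved only as the inequality that is needed (`fderiv_le_linearization`): the diagonal
entries of a symmetric matrix in an orthonormal frame are the image of its eigenvalues under a
doubly stochastic matrix, hence by Birkhoff's theorem a convex combination of their permutations,
and a symmetric concave `f` does not decrease under this operation
(`ConcaveOn.le_of_substochastic`, `IsEigenbasis.le_of_frame`). All third derivatives cancel. As
`ζ'' = -2`, what remains is, up to terms from the geometry,
`2 m ∑ f_a (Du(e_a))² ≤ A + m |ζ'| K₀ (1 + ∑ f_i) + C P ∑ f_i`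
(`exists_eigenbasis_weighted_le`), where the lower bound for `∑ f_i λ_i`
has controlled the term `m ζ' ∑ f_i λ_i`.

The first order condition is `∇²u(y₀, ·) = m ζ'(u) Du`, so that `y₀` is an eigenvector of `∇²u` with
the negative eigenvalue `m ζ'(u)`. Some `e_a` carries at least the fraction `1 / n` of the squared
length of `y₀`, and if `P` is large its eigenvalue `λ_a` is then negative also for
`∇²u + χ`, so that `f_a ≥ ν₀ (1 + ∑ f_i)`. The left side is therefore at least
`2 m ν₀ (1 + ∑ f_i) P² / n`, which bounds `P` since `m` is comparable to `P` (`sq_le_interiorBound`).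

The constant is uniform because the coordinate expressions of the metric, the Christoffel symbols
and `χ` are bounded, with their derivatives, over finitely many compact pieces of charts which cover
`M` (`GeometryBound`, `exists_uniform_geometryBound`).
-/

noncomputable section

/-! ### Concave symmetric functions -/

theorem fderiv_apply_eq_sum_partialDeriv {m : ℕ} (f : (Fin m → ℝ) → ℝ) (lam v : Fin m → ℝ) :
    fderiv ℝ f lam v = ∑ i, partialDeriv f i lam * v i := by
  conv_lhs => rw [pi_eq_sum_univ' v]
  rw [map_sum]
  refine Finset.sum_congr rfl fun i _ => ?_
  rw [map_smul, smul_eq_mul, mul_comm]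
  simp only [partialDeriv]

theorem ConcaveOn.le_add_sum_partialDeriv {m : ℕ} {f : (Fin m → ℝ) → ℝ} {Γ : Set (Fin m → ℝ)}
    (hf : ConcaveOn ℝ Γ f) {lam mu : Fin m → ℝ} (hlam : lam ∈ Γ) (hmu : mu ∈ Γ)
    (hd : DifferentiableAt ℝ f lam) :
    f mu ≤ f lam + ∑ i, partialDeriv f i lam * (mu i - lam i) := by
  have hseg : HasDerivAt (fun s : ℝ => f (lam + s • (mu - lam)))
      (fderiv ℝ f lam (mu - lam)) 0 := by
    have h1 : HasDerivAt (fun s : ℝ => lam + s • (mu - lam)) (mu - lam) 0 := by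
      simpa using ((hasDerivAt_id (0 : ℝ)).smul_const (mu - lam)).const_add lam
    have h2 : HasFDerivAt f (fderiv ℝ f lam) (lam + (0 : ℝ) • (mu - lam)) := by
      simpa using hd.hasFDerivAt
    exact h2.comp_hasDerivAt 0 h1
  have hsl := hseg.hasDerivWithinAt (s := Ioi 0)
  rw [hasDerivWithinAt_iff_tendsto_slope, sdiff_singleton_eq_self (by simp)] at hsl
  have hle : f mu - f lam ≤ fderiv ℝ f lam (mu - lam) := by
    refine ge_of_tendsto hsl ?_
    have : ∀ᶠ s : ℝ in 𝓝[>] 0, s ∈ Ioo (0 : ℝ) 1 := Ioo_mem_nhdsGT one_pos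
    filter_upwards [this] with s hs
    have hc := hf.2 hlam hmu (sub_nonneg.2 hs.2.le) hs.1.le (by ring)
    have he : (1 - s) • lam + s • mu = lam + s • (mu - lam) := by
      ext i; simp; ring
    rw [he] at hc
    simp only [smul_eq_mul] at hc
    rw [slope_def_field]
    simp only [zero_smul, add_zero, sub_zero]
    rw [le_div_iff₀ hs.1]
    linarith
  rw [fderiv_apply_eq_sum_partialDeriv] at hle
  simp only [Pi.sub_apply] at hle
  linarith

/-- By Birkhoff's theorem, a doubly stochastic matrix moves a vector into the convex hull of the
permutations of its coordinates; hence it preserves `Γ` and does not decrease a symmetric concave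
function. -/
theorem ConcaveOn.le_mulVec_of_mem_doublyStochastic {m : ℕ} {f : (Fin m → ℝ) → ℝ}
    {Γ : Set (Fin m → ℝ)} (hf : ConcaveOn ℝ Γ f)
    (hΓ : ∀ σ : Equiv.Perm (Fin m), ∀ lam ∈ Γ, lam ∘ σ ∈ Γ)
    (hs : ∀ σ : Equiv.Perm (Fin m), ∀ lam ∈ Γ, f (lam ∘ σ) = f lam)
    {D : Matrix (Fin m) (Fin m) ℝ} (hD : D ∈ doublyStochastic ℝ (Fin m))
    {mu : Fin m → ℝ} (hmu : mu ∈ Γ) :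
    D.mulVec mu ∈ Γ ∧ f mu ≤ f (D.mulVec mu) := by
  obtain ⟨w, hw0, hw1, rfl⟩ := exists_eq_sum_perm_of_mem_doublyStochastic hD
  have he : (∑ σ : Equiv.Perm (Fin m), w σ • σ.permMatrix ℝ).mulVec mu
      = ∑ σ : Equiv.Perm (Fin m), w σ • (mu ∘ σ) := by
    rw [Matrix.sum_mulVec]
    refine Finset.sum_congr rfl fun σ _ => ?_
    rw [Matrix.smul_mulVec, Matrix.permMatrix_mulVec]
  rw [he]
  refine ⟨hf.1.sum_mem (fun σ _ => hw0 σ) hw1 fun σ _ => hΓ σ mu hmu, ?_⟩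
  have := hf.le_map_sum (t := Finset.univ) (w := w) (p := fun σ : Equiv.Perm (Fin m) => mu ∘ σ)
    (fun σ _ => hw0 σ) hw1 fun σ _ => hΓ σ mu hmu
  refine le_trans (le_of_eq ?_) this
  simp only [hs _ _ hmu, smul_eq_mul, ← Finset.sum_mul, hw1, one_mul]

/-- Every doubly substochastic matrix lies entrywise below a doubly stochastic one: the defects `r`
of the rows and `c` of the columns have the same sum `S`, and `r i * c j / S` fills them up. -/
theorem exists_doublyStochastic_ge {m : ℕ} (S : Matrix (Fin m) (Fin m) ℝ)
    (h0 : ∀ i j, 0 ≤ S i j) (hr : ∀ i, ∑ j, S i j ≤ 1) (hc : ∀ j, ∑ i, S i j ≤ 1) :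
    ∃ D ∈ doublyStochastic ℝ (Fin m), ∀ i j, S i j ≤ D i j := by
  set r : Fin m → ℝ := fun i => 1 - ∑ j, S i j with hrdef
  set c : Fin m → ℝ := fun j => 1 - ∑ i, S i j with hcdef
  have hr0 : ∀ i, 0 ≤ r i := fun i => sub_nonneg.2 (hr i)
  have hc0 : ∀ j, 0 ≤ c j := fun j => sub_nonneg.2 (hc j)
  have hrc : ∑ i, r i = ∑ j, c j := by
    simp only [hrdef, hcdef, Finset.sum_sub_distrib]
    rw [Finset.sum_comm]
  set t := ∑ i, r i with ht
  have ht0 : 0 ≤ t := Finset.sum_nonneg fun i _ => hr0 i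
  have hrt : ∀ i, r i * t / t = r i := by
    intro i
    rcases ht0.eq_or_lt with h | h
    · have : r i = 0 := (Finset.sum_eq_zero_iff_of_nonneg fun i _ => hr0 i).1 h.symm i
        (Finset.mem_univ i)
      simp [this]
    · field_simp
  have hct : ∀ j, t * c j / t = c j := by
    intro j
    rcases ht0.eq_or_lt with h | h
    · have : c j = 0 := (Finset.sum_eq_zero_iff_of_nonneg fun i _ => hc0 i).1
        (by rw [← hrc]; exact h.symm) j (Finset.mem_univ j)
      simp [this]
    · field_simp
  refine ⟨Matrix.of fun i j => S i j + r i * c j / t, ?_, fun i j => ?_⟩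
  · rw [mem_doublyStochastic_iff_sum]
    refine ⟨fun i j => ?_, fun i => ?_, fun j => ?_⟩
    · have := h0 i j
      have := hr0 i
      have := hc0 j
      simp only [Matrix.of_apply]
      positivity
    · simp only [Matrix.of_apply, Finset.sum_add_distrib, ← Finset.sum_div, ← Finset.mul_sum,
        ← hrc, hrt]
      simp [hrdef]
    · simp only [Matrix.of_apply, Finset.sum_add_distrib, ← Finset.sum_div, ← Finset.sum_mul,
        ← ht, hct]
      simp [hcdef]
  · have := hr0 i
    have := hc0 j
    simp only [Matrix.of_apply]
    have : 0 ≤ r i * c j / t := by positivity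
    linarith

/-- The tangent plane bound for `f ∘ λ`, `λ` the eigenvalues: if a matrix has eigenvalues `lam`,
then its diagonal entries in an approximately orthonormal frame are `∑ j, S a j * lam j` with a
doubly substochastic `S`, and the bound holds for these up to the defects of the rows of `S`. The
last variable is not rotated. -/
theorem ConcaveOn.le_of_substochastic {n : ℕ} {f : (Fin (n + 1) → ℝ) → ℝ}
    {Γ : Set (Fin (n + 1) → ℝ)} (hf : ConcaveOn ℝ Γ f)
    (hΓ : ∀ σ : Equiv.Perm (Fin (n + 1)), ∀ lam ∈ Γ, lam ∘ σ ∈ Γ)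
    (hs : ∀ σ : Equiv.Perm (Fin (n + 1)), ∀ lam ∈ Γ, f (lam ∘ σ) = f lam)
    {lam₀ lam : Fin n → ℝ} {t₀ t : ℝ} (hlam₀ : (Fin.snoc lam₀ t₀ : Fin (n + 1) → ℝ) ∈ Γ)
    (hd : DifferentiableAt ℝ f (Fin.snoc lam₀ t₀ : Fin (n + 1) → ℝ))
    (hpos : ∀ i, 0 ≤ partialDeriv f i (Fin.snoc lam₀ t₀ : Fin (n + 1) → ℝ))
    (hlam : (Fin.snoc lam t : Fin (n + 1) → ℝ) ∈ Γ) {Λ : ℝ} (hΛ : ∀ j, |lam j| ≤ Λ)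
    (S : Matrix (Fin n) (Fin n) ℝ)
    (h0 : ∀ i j, 0 ≤ S i j) (hr : ∀ i, ∑ j, S i j ≤ 1) (hc : ∀ j, ∑ i, S i j ≤ 1) :
    f (Fin.snoc lam t : Fin (n + 1) → ℝ) ≤ f (Fin.snoc lam₀ t₀ : Fin (n + 1) → ℝ)
      + ∑ a : Fin n, partialDeriv f a.castSucc (Fin.snoc lam₀ t₀ : Fin (n + 1) → ℝ)
          * (∑ j, S a j * lam j - lam₀ a + (1 - ∑ j, S a j) * Λ)
      + partialDeriv f (Fin.last n) (Fin.snoc lam₀ t₀ : Fin (n + 1) → ℝ) * (t - t₀) := by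
  obtain ⟨D, hD, hSD⟩ := exists_doublyStochastic_ge S h0 hr hc
  rw [mem_doublyStochastic_iff_sum] at hD
  -- `D` extended by the identity on the last variable
  let D' : Matrix (Fin (n + 1)) (Fin (n + 1)) ℝ := Matrix.of
    (Fin.snoc (fun a => Fin.snoc (D a) 0) (Fin.snoc (fun _ => 0) 1))
  have hD' : D' ∈ doublyStochastic ℝ (Fin (n + 1)) := by
    rw [mem_doublyStochastic_iff_sum]
    refine ⟨fun i j => ?_, fun i => ?_, fun j => ?_⟩
    · refine Fin.lastCases ?_ (fun a => ?_) i <;> refine Fin.lastCases ?_ (fun b => ?_) j <;>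
        simp [D', hD.1]
    · refine Fin.lastCases ?_ (fun a => ?_) i <;> simp [D', Fin.sum_univ_castSucc, hD.2.1]
    · refine Fin.lastCases ?_ (fun b => ?_) j <;> simp [D', Fin.sum_univ_castSucc, hD.2.2]
  obtain ⟨hmem, hle⟩ := hf.le_mulVec_of_mem_doublyStochastic hΓ hs hD' hlam
  have h2 := hf.le_add_sum_partialDeriv hlam₀ hmem hd
  rw [Fin.sum_univ_castSucc] at h2
  have ha : ∀ a : Fin n, D'.mulVec (Fin.snoc lam t : Fin (n + 1) → ℝ) a.castSucc
      = ∑ j, D a j * lam j := by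
    intro a
    simp [Matrix.mulVec, dotProduct, D', Fin.sum_univ_castSucc]
  have hl : D'.mulVec (Fin.snoc lam t : Fin (n + 1) → ℝ) (Fin.last n) = t := by
    simp [Matrix.mulVec, dotProduct, D', Fin.sum_univ_castSucc]
  simp only [ha, hl, Fin.snoc_castSucc, Fin.snoc_last] at h2
  refine (hle.trans h2).trans ?_
  rw [add_assoc]
  gcongr with a
  · exact hpos _
  · have : ∑ j, D a j * lam j - ∑ j, S a j * lam j ≤ (1 - ∑ j, S a j) * Λ := by
      rw [← hD.2.1 a, ← Finset.sum_sub_distrib, ← Finset.sum_sub_distrib, Finset.sum_mul]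
      refine Finset.sum_le_sum fun j _ => ?_
      rw [← sub_mul]
      exact mul_le_mul_of_nonneg_left ((le_abs_self _).trans (hΛ j)) (sub_nonneg.2 (hSD a j))
    linarith

/-! ### Eigenbases and the linearised equation -/

theorem hasDerivAt_line {E : Type*} [NormedAddCommGroup E] [NormedSpace ℝ E] (z y : E) (s₀ : ℝ) :
    HasDerivAt (fun s : ℝ => z + s • y) y s₀ := by
  simpa using ((hasDerivAt_id s₀).smul_const y).const_add z

theorem DifferentiableAt.hasDerivAt_line {E F : Type*} [NormedAddCommGroup E] [NormedSpace ℝ E]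
    [NormedAddCommGroup F] [NormedSpace ℝ F] {H : E → F} {z y : E} {s₀ : ℝ}
    (hH : DifferentiableAt ℝ H (z + s₀ • y)) :
    HasDerivAt (fun s : ℝ => H (z + s • y)) (fderiv ℝ H (z + s₀ • y) y) s₀ :=
  hH.hasFDerivAt.comp_hasDerivAt_of_eq s₀ (_root_.hasDerivAt_line z y s₀) rfl

theorem ContinuousAt.eventually_norm_sub_lt {X F : Type*} [TopologicalSpace X]
    [SeminormedAddCommGroup F] {H : X → F} {z : X} (hH : ContinuousAt H z) {r : ℝ} (hr : 0 < r) :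
    ∀ᶠ y in 𝓝 z, ‖H y - H z‖ < r :=
  (tendsto_iff_norm_sub_tendsto_zero.1 hH.tendsto).eventually (gt_mem_nhds hr)

theorem ContinuousAt.eventually_norm_lt {X F : Type*} [TopologicalSpace X]
    [SeminormedAddCommGroup F] {H : X → F} {z : X} (hH : ContinuousAt H z) {r : ℝ}
    (hr : ‖H z‖ < r) : ∀ᶠ y in 𝓝 z, ‖H y‖ < r :=
  hH.norm.eventually (gt_mem_nhds hr)

theorem DifferentiableAt.hasDerivAt_line_zero {E F : Type*} [NormedAddCommGroup E]
    [NormedSpace ℝ E] [NormedAddCommGroup F] [NormedSpace ℝ F] {H : E → F} {z : E}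
    (hH : DifferentiableAt ℝ H z) (y : E) :
    HasDerivAt (fun s : ℝ => H (z + s • y)) (fderiv ℝ H z y) 0 :=
  hH.hasFDerivAt.comp_hasDerivAt_of_eq 0 (_root_.hasDerivAt_line z y 0) (by simp)

theorem ContDiffAt.differentiableAt_fderiv_apply {E F : Type*} [NormedAddCommGroup E]
    [NormedSpace ℝ E] [NormedAddCommGroup F] [NormedSpace ℝ F] {H : E → F} {z : E}
    (hH : ContDiffAt ℝ 2 H z) (v : E) : DifferentiableAt ℝ (fun y => fderiv ℝ H y v) z :=
  have h1 : ContDiffAt ℝ 1 (fderiv ℝ H) z := hH.fderiv_right (by norm_num)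
  DifferentiableAt.clm_apply (h1.differentiableAt (by norm_num)) (differentiableAt_const v)

set_option synthInstance.maxHeartbeats 400000 in
theorem hasDerivAt_bilinear_line {E : Type*} [NormedAddCommGroup E] [NormedSpace ℝ E]
    {V : Type*} [NormedAddCommGroup V] [NormedSpace ℝ V]
    {F : E → E →L[ℝ] E →L[ℝ] V} {z y : E} {s₀ : ℝ} (hF : DifferentiableAt ℝ F (z + s₀ • y))
    (v v' w w' : E) :
    HasDerivAt (fun s : ℝ => F (z + s • y) (v + s • v') (w + s • w'))
      (fderiv ℝ F (z + s₀ • y) y (v + s₀ • v') (w + s₀ • w') + F (z + s₀ • y) v' (w + s₀ • w')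
        + F (z + s₀ • y) (v + s₀ • v') w') s₀ := by
  have h1 : HasDerivAt (fun s : ℝ => F (z + s • y)) (fderiv ℝ F (z + s₀ • y) y) s₀ :=
    DifferentiableAt.hasDerivAt_line (F := E →L[ℝ] E →L[ℝ] V) hF
  have h2 : HasDerivAt (fun s : ℝ => F (z + s • y) (v + s • v'))
      (fderiv ℝ F (z + s₀ • y) y (v + s₀ • v') + F (z + s₀ • y) v') s₀ :=
    h1.clm_apply (hasDerivAt_line v v' s₀)
  simpa using h2.clm_apply (hasDerivAt_line w w' s₀)

theorem hasDerivAt_linear_line {E : Type*} [NormedAddCommGroup E] [NormedSpace ℝ E]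
    {F : E → E →L[ℝ] ℝ} {z y : E} {s₀ : ℝ} (hF : DifferentiableAt ℝ F (z + s₀ • y))
    (v v' : E) :
    HasDerivAt (fun s : ℝ => F (z + s • y) (v + s • v'))
      (fderiv ℝ F (z + s₀ • y) y (v + s₀ • v') + F (z + s₀ • y) v') s₀ := by
  have h1 : HasDerivAt (fun s : ℝ => F (z + s • y)) (fderiv ℝ F (z + s₀ • y) y) s₀ :=
    DifferentiableAt.hasDerivAt_line (F := E →L[ℝ] ℝ) hF
  exact h1.clm_apply (hasDerivAt_line v v' s₀)

section Eigenbasis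

variable {E : Type*} [NormedAddCommGroup E] [NormedSpace ℝ E] {n : ℕ}

/-- `e` is an orthonormal basis for the inner product `G`, and the bilinear form `U` is diagonal in
this basis with diagonal entries `lam`. -/
structure IsEigenbasis (G U : E →L[ℝ] E →L[ℝ] ℝ) (e : Fin n → E) (lam : Fin n → ℝ) : Prop where
  orthonormal : ∀ a b, G (e a) (e b) = if a = b then 1 else 0
  expand : ∀ v, v = ∑ a, G v (e a) • e a
  diag : ∀ a b, U (e a) (e b) = if a = b then lam a else 0

variable {G U : E →L[ℝ] E →L[ℝ] ℝ} {e : Fin n → E} {lam : Fin n → ℝ}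

theorem IsEigenbasis.apply_left (h : IsEigenbasis G U e lam) (v : E) (a : Fin n) :
    U v (e a) = lam a * G v (e a) := by
  conv_lhs => rw [h.expand v]
  simp [h.diag, mul_comm]

theorem IsEigenbasis.apply_right (h : IsEigenbasis G U e lam) (v : E) (a : Fin n) :
    U (e a) v = lam a * G v (e a) := by
  conv_lhs => rw [h.expand v]
  simp [h.diag, mul_comm]

theorem IsEigenbasis.metric_apply (h : IsEigenbasis G U e lam) (v w : E) :
    G v w = ∑ a, G v (e a) * G w (e a) := by
  conv_lhs => rw [h.expand w]
  simp [mul_comm]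

theorem IsEigenbasis.apply (h : IsEigenbasis G U e lam) (v w : E) :
    U v w = ∑ a, lam a * (G v (e a) * G w (e a)) := by
  conv_lhs => rw [h.expand w]
  simp only [map_sum, map_smul, smul_eq_mul, h.apply_left]
  exact Finset.sum_congr rfl fun a _ => by ring

theorem IsEigenbasis.norm_sq_le (h : IsEigenbasis G U e lam) (v : E) :
    ‖v‖ ^ 2 ≤ (∑ a, ‖e a‖ ^ 2) * G v v := by
  have h1 : ‖v‖ ≤ ∑ a, |G v (e a)| * ‖e a‖ := by
    conv_lhs => rw [h.expand v]
    refine (norm_sum_le _ _).trans_eq (Finset.sum_congr rfl fun a _ => ?_)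
    rw [norm_smul, Real.norm_eq_abs]
  calc ‖v‖ ^ 2 ≤ (∑ a, |G v (e a)| * ‖e a‖) ^ 2 := by gcongr
    _ ≤ (∑ a, |G v (e a)| ^ 2) * ∑ a, ‖e a‖ ^ 2 := Finset.sum_mul_sq_le_sq_mul_sq _ _ _
    _ = (∑ a, ‖e a‖ ^ 2) * G v v := by
        rw [h.metric_apply v v, mul_comm]
        simp [sq]

/-- The tangent plane bound of `ConcaveOn.le_of_substochastic` for the diagonal entries of `U` in a
frame `w` whose Gram matrix differs from the identity by `δ`. -/
theorem IsEigenbasis.le_of_frame {f : (Fin (n + 1) → ℝ) → ℝ}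
    {Γ : Set (Fin (n + 1) → ℝ)} (hf : ConcaveOn ℝ Γ f)
    (hΓ : ∀ σ : Equiv.Perm (Fin (n + 1)), ∀ lam ∈ Γ, lam ∘ σ ∈ Γ)
    (hs : ∀ σ : Equiv.Perm (Fin (n + 1)), ∀ lam ∈ Γ, f (lam ∘ σ) = f lam)
    {lam₀ : Fin n → ℝ} {t₀ t : ℝ} (hlam₀ : (Fin.snoc lam₀ t₀ : Fin (n + 1) → ℝ) ∈ Γ)
    (hd : DifferentiableAt ℝ f (Fin.snoc lam₀ t₀ : Fin (n + 1) → ℝ))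
    (hpos : ∀ i, 0 ≤ partialDeriv f i (Fin.snoc lam₀ t₀ : Fin (n + 1) → ℝ))
    (h : IsEigenbasis G U e lam)
    (hlam : (Fin.snoc lam t : Fin (n + 1) → ℝ) ∈ Γ) {Λ : ℝ} (hΛ : ∀ j, |lam j| ≤ Λ) (hΛ0 : 0 ≤ Λ)
    (w : Fin n → E) {δ : ℝ} (hδ : δ = ∑ a, ∑ b, |G (w a) (w b) - if a = b then 1 else 0|) :
    f (Fin.snoc lam t : Fin (n + 1) → ℝ) ≤ f (Fin.snoc lam₀ t₀ : Fin (n + 1) → ℝ)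
      + ∑ a : Fin n, partialDeriv f a.castSucc (Fin.snoc lam₀ t₀ : Fin (n + 1) → ℝ)
          * ((1 + δ)⁻¹ * U (w a) (w a) - lam₀ a + 2 * δ * Λ)
      + partialDeriv f (Fin.last n) (Fin.snoc lam₀ t₀ : Fin (n + 1) → ℝ) * (t - t₀) := by
  have hδ0 : 0 ≤ δ := hδ ▸ Finset.sum_nonneg fun a _ => Finset.sum_nonneg fun b _ => abs_nonneg _
  have hδab : ∀ a b, |G (w a) (w b) - if a = b then 1 else 0| ≤ δ := by
    intro a b
    rw [hδ]
    refine (Finset.single_le_sum (f := fun b => |G (w a) (w b) - if a = b then 1 else 0|)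
      (fun b _ => abs_nonneg _) (Finset.mem_univ b)).trans ?_
    exact Finset.single_le_sum (f := fun a => ∑ b, |G (w a) (w b) - if a = b then 1 else 0|)
      (fun a _ => Finset.sum_nonneg fun b _ => abs_nonneg _) (Finset.mem_univ a)
  have hdiag : ∀ a, |G (w a) (w a) - 1| ≤ δ := fun a => by simpa using hδab a a
  have hθ : 0 < (1 + δ)⁻¹ := by positivity
  -- The squared components of the frame in the eigenbasis; the factor `(1 + δ)⁻¹` compensates for the
  -- defect of orthonormality and makes `S` doubly substochastic.
  let S : Matrix (Fin n) (Fin n) ℝ := Matrix.of fun a j => (1 + δ)⁻¹ * (G (w a) (e j)) ^ 2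
  have hrow : ∀ a, ∑ j, S a j = (1 + δ)⁻¹ * G (w a) (w a) := by
    intro a
    rw [h.metric_apply (w a) (w a), Finset.mul_sum]
    simp [S, sq]
  have hr : ∀ a, ∑ j, S a j ≤ 1 := by
    intro a
    rw [hrow, inv_mul_le_iff₀ (by positivity)]
    linarith [(abs_le.1 (hdiag a)).2]
  have hc : ∀ j, ∑ a, S a j ≤ 1 := by
    intro j
    simp only [S, Matrix.of_apply, ← Finset.mul_sum]
    rw [inv_mul_le_iff₀ (by positivity), mul_one]
    set c : Fin n → ℝ := fun a => G (w a) (e j) with hcdef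
    set X := ∑ a, c a ^ 2 with hX
    have hX0 : 0 ≤ X := Finset.sum_nonneg fun a _ => sq_nonneg _
    -- `X = G (∑ c a • w a) (e j)`, so by Cauchy–Schwarz `X ^ 2 ≤ |∑ c a • w a|² ≤ (1 + δ) * X`.
    have h1 : X = G (∑ a, c a • w a) (e j) := by simp [hX, hcdef, sq]
    have h2 : X ^ 2 ≤ G (∑ a, c a • w a) (∑ a, c a • w a) := by
      rw [h.metric_apply (∑ a, c a • w a) (∑ a, c a • w a), h1, sq]
      exact Finset.single_le_sum
        (f := fun k => G (∑ a, c a • w a) (e k) * G (∑ a, c a • w a) (e k))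
        (fun k _ => mul_self_nonneg _) (Finset.mem_univ j)
    have h3 : G (∑ a, c a • w a) (∑ a, c a • w a)
        = X + ∑ a, ∑ b, c a * c b * (G (w a) (w b) - if a = b then 1 else 0) := by
      simp only [mul_sub, Finset.sum_sub_distrib]
      simp [hX, sq, mul_assoc, Finset.mul_sum]
      rw [Finset.sum_comm]
      exact Finset.sum_congr rfl fun a _ => Finset.sum_congr rfl fun b _ => by ring
    have h4 : ∀ a b, |c a * c b| ≤ X := by
      intro a b
      have ha := Finset.single_le_sum (f := fun a => c a ^ 2) (fun a _ => sq_nonneg _)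
        (Finset.mem_univ a)
      have hb := Finset.single_le_sum (f := fun a => c a ^ 2) (fun a _ => sq_nonneg _)
        (Finset.mem_univ b)
      rw [abs_mul]
      nlinarith [sq_nonneg (|c a| - |c b|), sq_abs (c a), sq_abs (c b)]
    have h5 : ∑ a, ∑ b, c a * c b * (G (w a) (w b) - if a = b then 1 else 0) ≤ X * δ := by
      rw [hδ, Finset.mul_sum]
      refine Finset.sum_le_sum fun a _ => ?_
      rw [Finset.mul_sum]
      refine Finset.sum_le_sum fun b _ => ?_
      refine (le_abs_self _).trans ?_
      rw [abs_mul]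
      exact mul_le_mul_of_nonneg_right (h4 a b) (abs_nonneg _)
    have h6 : X * X ≤ (1 + δ) * X := by nlinarith
    rcases hX0.eq_or_lt with h0 | h0
    · rw [← h0]; positivity
    · exact le_of_mul_le_mul_right h6 h0
  have hmain := hf.le_of_substochastic hΓ hs hlam₀ hd hpos hlam hΛ S
    (fun a j => by simp only [S, Matrix.of_apply]; positivity) hr hc
  refine hmain.trans ?_
  gcongr with a
  · exact hpos _
  · refine le_of_eq ?_
    rw [h.apply (w a) (w a), Finset.mul_sum]
    exact Finset.sum_congr rfl fun j _ => by simp only [S, Matrix.of_apply]; ring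
  · rw [hrow]
    have : (1 + δ)⁻¹ * G (w a) (w a) ≥ (1 + δ)⁻¹ * (1 - δ) := by
      have := (abs_le.1 (hdiag a)).1
      gcongr; linarith
    have h2 : 1 - (1 + δ)⁻¹ * (1 - δ) = 2 * δ * (1 + δ)⁻¹ := by field_simp; ring
    have h3 : (1 + δ)⁻¹ ≤ 1 := inv_le_one_of_one_le₀ (by linarith)
    nlinarith

end Eigenbasis

/-- The linearised equation, as an inequality. It is obtained without differentiating eigenvalues:
along the line `z₀ + s • y₀` the frame `e a + s • d a` is orthonormal up to `o(s)`, so that the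
tangent plane bound for `f` holds up to `o(s)` with equality at `s = 0`. -/
theorem fderiv_le_linearization {E : Type*} [NormedAddCommGroup E] [NormedSpace ℝ E] {n : ℕ}
    {f : (Fin (n + 1) → ℝ) → ℝ}
    {Γ : Set (Fin (n + 1) → ℝ)} (hf : ConcaveOn ℝ Γ f)
    (hΓ : ∀ σ : Equiv.Perm (Fin (n + 1)), ∀ lam ∈ Γ, lam ∘ σ ∈ Γ)
    (hs : ∀ σ : Equiv.Perm (Fin (n + 1)), ∀ lam ∈ Γ, f (lam ∘ σ) = f lam)
    {G U : E → E →L[ℝ] E →L[ℝ] ℝ} {h ψ : E → ℝ} {z₀ : E} (y₀ : E)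
    (hG : DifferentiableAt ℝ G z₀) (hU : DifferentiableAt ℝ U z₀)
    (hh : DifferentiableAt ℝ h z₀) (hψ : DifferentiableAt ℝ ψ z₀)
    {lam₀ : Fin n → ℝ} {e : Fin n → E} (he : IsEigenbasis (G z₀) (U z₀) e lam₀)
    (hlam₀ : (Fin.snoc lam₀ (h z₀) : Fin (n + 1) → ℝ) ∈ Γ)
    (hψ₀ : f (Fin.snoc lam₀ (h z₀) : Fin (n + 1) → ℝ) = ψ z₀)
    (hd : DifferentiableAt ℝ f (Fin.snoc lam₀ (h z₀) : Fin (n + 1) → ℝ))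
    (hpos : ∀ i, 0 ≤ partialDeriv f i (Fin.snoc lam₀ (h z₀) : Fin (n + 1) → ℝ))
    (heq : ∀ᶠ z in 𝓝 z₀, ∃ (ε : Fin n → E) (lam : Fin n → ℝ), IsEigenbasis (G z) (U z) ε lam ∧
      (Fin.snoc lam (h z) : Fin (n + 1) → ℝ) ∈ Γ ∧
      f (Fin.snoc lam (h z) : Fin (n + 1) → ℝ) = ψ z)
    {d : Fin n → E}
    (hde : ∀ a b, fderiv ℝ G z₀ y₀ (e a) (e b) + G z₀ (d a) (e b) + G z₀ (e a) (d b) = 0) :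
    fderiv ℝ ψ z₀ y₀ ≤
      ∑ a, partialDeriv f a.castSucc (Fin.snoc lam₀ (h z₀) : Fin (n + 1) → ℝ)
        * (fderiv ℝ U z₀ y₀ (e a) (e a) + U z₀ (d a) (e a) + U z₀ (e a) (d a))
      + partialDeriv f (Fin.last n) (Fin.snoc lam₀ (h z₀) : Fin (n + 1) → ℝ)
        * fderiv ℝ h z₀ y₀ := by
  set D : Fin (n + 1) → ℝ :=
    fun i => partialDeriv f i (Fin.snoc lam₀ (h z₀) : Fin (n + 1) → ℝ) with hD
  have hline : HasDerivAt (fun s : ℝ => z₀ + s • y₀) y₀ 0 := by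
    simpa using ((hasDerivAt_id (0 : ℝ)).smul_const y₀).const_add z₀
  have hz0 : z₀ + (0 : ℝ) • y₀ = z₀ := by simp
  have hw : ∀ a, HasDerivAt (fun s : ℝ => e a + s • d a) (d a) 0 := fun a => by
    simpa using ((hasDerivAt_id (0 : ℝ)).smul_const (d a)).const_add (e a)
  have hbil : ∀ {F : E → E →L[ℝ] E →L[ℝ] ℝ}, DifferentiableAt ℝ F z₀ → ∀ a b,
      HasDerivAt (fun s : ℝ => F (z₀ + s • y₀) (e a + s • d a) (e b + s • d b))
        (fderiv ℝ F z₀ y₀ (e a) (e b) + F z₀ (d a) (e b) + F z₀ (e a) (d b)) 0 :=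
    fun hF a b => by
      simpa only [zero_smul, add_zero] using
        hasDerivAt_bilinear_line (y := y₀) (s₀ := 0) (hz0.symm ▸ hF) (e a) (d a) (e b) (d b)
  -- `δ s` measures the failure of the frame at `z₀ + s • y₀` to be orthonormal. It is `o(s)` as `hde`
  -- says that the Gram matrix is stationary at `s = 0`.
  let K : Fin n → Fin n → ℝ → ℝ := fun a b s =>
    G (z₀ + s • y₀) (e a + s • d a) (e b + s • d b) - if a = b then 1 else 0
  let δ : ℝ → ℝ := fun s => ∑ a, ∑ b, |K a b s|
  have hδ0 : ∀ s, 0 ≤ δ s := fun s =>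
    Finset.sum_nonneg fun a _ => Finset.sum_nonneg fun b _ => abs_nonneg _
  have hδ : δ =o[𝓝 0] fun s : ℝ => s := by
    refine Asymptotics.IsLittleO.fun_sum fun a _ => Asymptotics.IsLittleO.fun_sum fun b _ => ?_
    have h1 := ((hbil hG a b).sub_const (if a = b then (1 : ℝ) else 0))
    rw [hde, hasDerivAt_iff_isLittleO] at h1
    have h2 : K a b =o[𝓝 0] fun s : ℝ => s := by
      simpa [K, he.orthonormal] using h1
    exact h2.abs_left
  -- the eigenvalues stay bounded near `z₀`
  obtain ⟨Λ, hΛ0, hΛ⟩ : ∃ Λ : ℝ, 0 ≤ Λ ∧ ∀ᶠ z in 𝓝 z₀, ∀ (ε : Fin n → E) (lam : Fin n → ℝ),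
      IsEigenbasis (G z) (U z) ε lam → ∀ j, |lam j| ≤ Λ := by
    set c := ∑ a, ‖e a‖ ^ 2 with hc
    have hc0 : 0 ≤ c := Finset.sum_nonneg fun a _ => sq_nonneg _
    refine ⟨(‖U z₀‖ + 1) * (2 * c), by positivity, ?_⟩
    have h1 := ContinuousAt.eventually_norm_sub_lt (F := E →L[ℝ] E →L[ℝ] ℝ) hG.continuousAt
      (r := (2 * (c + 1))⁻¹) (by positivity)
    have h2 := ContinuousAt.eventually_norm_lt (F := E →L[ℝ] E →L[ℝ] ℝ) hU.continuousAt
      (lt_add_one _)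
    filter_upwards [h1, h2] with z hz1 hz2 ε lam hε j
    have h3 := he.norm_sq_le (ε j)
    have h4 : |G z (ε j) (ε j) - G z₀ (ε j) (ε j)| ≤ (2 * (c + 1))⁻¹ * ‖ε j‖ ^ 2 := by
      have := (G z - G z₀).le_opNorm₂ (ε j) (ε j)
      simp only [sub_apply, Real.norm_eq_abs] at this
      refine this.trans ?_
      rw [mul_assoc, ← sq]
      gcongr
    have h5 : G z (ε j) (ε j) = 1 := by simp [hε.orthonormal]
    rw [h5] at h4
    have h6 : ‖ε j‖ ^ 2 ≤ 2 * c := by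
      have h7 := (abs_le.1 h4).1
      have h8 : c * (2 * (c + 1))⁻¹ ≤ 1 / 2 := by
        rw [mul_inv_le_iff₀ (by positivity)]; linarith
      have h9 : c * G z₀ (ε j) (ε j) ≤ c * (1 + (2 * (c + 1))⁻¹ * ‖ε j‖ ^ 2) := by
        gcongr; linarith
      nlinarith [sq_nonneg ‖ε j‖]
    have h7 : lam j = U z (ε j) (ε j) := by simp [hε.diag]
    have h8 := (U z).le_opNorm₂ (ε j) (ε j)
    rw [h7, ← Real.norm_eq_abs]
    refine h8.trans ?_
    rw [mul_assoc, ← sq]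
    gcongr
  -- The tangent plane bound says `φ s ≤ φ 0 + O(δ s)`, so that `φ' 0 ≤ 0`, which is the claim.
  let φ : ℝ → ℝ := fun s => ψ (z₀ + s • y₀)
    - (∑ a, D a.castSucc * (U (z₀ + s • y₀) (e a + s • d a) (e a + s • d a))
      + D (Fin.last n) * h (z₀ + s • y₀))
  have hφ : HasDerivAt φ (fderiv ℝ ψ z₀ y₀
      - (∑ a, D a.castSucc * (fderiv ℝ U z₀ y₀ (e a) (e a) + U z₀ (d a) (e a) + U z₀ (e a) (d a))
        + D (Fin.last n) * fderiv ℝ h z₀ y₀)) 0 := by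
    have h1 : HasDerivAt (fun s : ℝ => ψ (z₀ + s • y₀)) (fderiv ℝ ψ z₀ y₀) 0 :=
      hψ.hasDerivAt_line_zero y₀
    have h2 : HasDerivAt (fun s : ℝ => h (z₀ + s • y₀)) (fderiv ℝ h z₀ y₀) 0 :=
      hh.hasDerivAt_line_zero y₀
    refine h1.sub (HasDerivAt.add ?_ (h2.const_mul _))
    exact HasDerivAt.fun_sum fun a _ => (hbil hU a a).const_mul _
  have hφ0 : φ 0 = ψ z₀ - (∑ a, D a.castSucc * lam₀ a + D (Fin.last n) * h z₀) := by
    simp [φ, he.diag]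
  have hUb : ∀ a, ∀ᶠ s : ℝ in 𝓝 0,
      |U (z₀ + s • y₀) (e a + s • d a) (e a + s • d a)| < |lam₀ a| + 1 := by
    intro a
    have := (hbil hU a a).continuousAt.abs
    refine this.eventually (gt_mem_nhds ?_)
    simp [he.diag]
  set C := ∑ a : Fin n, D a.castSucc * (|lam₀ a| + 1 + 2 * Λ) with hC
  have hle : ∀ᶠ s : ℝ in 𝓝 0, φ s - φ 0 ≤ C * δ s := by
    have hcont : Filter.Tendsto (fun s : ℝ => z₀ + s • y₀) (𝓝 0) (𝓝 z₀) := by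
      have := hline.continuousAt.tendsto
      rwa [hz0] at this
    filter_upwards [hcont.eventually heq, hcont.eventually hΛ, Filter.eventually_all.2 hUb]
      with s hs1 hs2 hs3
    obtain ⟨ε, lam, hε, hmem, hval⟩ := hs1
    have hm := hε.le_of_frame hf hΓ hs hlam₀ hd hpos hmem (hs2 ε lam hε) hΛ0
      (fun a => e a + s • d a) (δ := δ s) rfl
    rw [hval, hψ₀] at hm
    change ψ (z₀ + s • y₀) ≤ ψ z₀ + ∑ a : Fin n, D a.castSucc * _ + D (Fin.last n) * _ at hm
    have hterm : ∀ a : Fin n, D a.castSucc * ((1 + δ s)⁻¹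
          * U (z₀ + s • y₀) (e a + s • d a) (e a + s • d a) - lam₀ a + 2 * δ s * Λ)
        ≤ D a.castSucc * U (z₀ + s • y₀) (e a + s • d a) (e a + s • d a)
          - D a.castSucc * lam₀ a + D a.castSucc * (|lam₀ a| + 1 + 2 * Λ) * δ s := by
      intro a
      have h1 : (1 + δ s)⁻¹ * U (z₀ + s • y₀) (e a + s • d a) (e a + s • d a)
          ≤ U (z₀ + s • y₀) (e a + s • d a) (e a + s • d a) + (|lam₀ a| + 1) * δ s := by
        have hp : 0 < 1 + δ s := by linarith [hδ0 s]
        rw [inv_mul_le_iff₀ hp]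
        have h3 := abs_lt.1 (hs3 a)
        have : 0 ≤ δ s * (U (z₀ + s • y₀) (e a + s • d a) (e a + s • d a) + (|lam₀ a| + 1)) :=
          mul_nonneg (hδ0 s) (by linarith)
        have : 0 ≤ δ s * δ s * (|lam₀ a| + 1) := by positivity
        nlinarith
      have h2 := mul_le_mul_of_nonneg_left h1 (hpos a.castSucc)
      simp only [hD]
      nlinarith
    have hsum := Finset.sum_le_sum fun a (_ : a ∈ Finset.univ) => hterm a
    simp only [Finset.sum_add_distrib, Finset.sum_sub_distrib, ← Finset.sum_mul] at hsum
    rw [hφ0]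
    simp only [φ]
    linarith
  have hconc := hφ.hasDerivWithinAt (s := Ioi 0)
  rw [hasDerivWithinAt_iff_tendsto_slope, sdiff_singleton_eq_self (by simp)] at hconc
  have hδ' : Filter.Tendsto (fun s => C * (δ s / s)) (𝓝[>] 0) (𝓝 0) := by
    simpa using (hδ.tendsto_div_nhds_zero.mono_left nhdsWithin_le_nhds).const_mul C
  have := le_of_tendsto_of_tendsto hconc hδ' (by
    filter_upwards [nhdsWithin_le_nhds hle, self_mem_nhdsWithin] with s hs1 hs2
    rw [slope_def_field, sub_zero, mul_div_assoc']
    exact div_le_div_of_nonneg_right hs1 (le_of_lt hs2))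
  linarith

/-! ### The barrier and the conditions at a maximum -/

theorem second_deriv_nonpos_of_isLocalMax {κ κ' : ℝ → ℝ} {k : ℝ}
    (h1 : ∀ᶠ s in 𝓝 0, HasDerivAt κ (κ' s) s) (h2 : HasDerivAt κ' k 0) (hmax : IsLocalMax κ 0) :
    k ≤ 0 := by
  by_contra! hk
  have hd : deriv κ =ᶠ[𝓝 0] κ' := h1.mono fun s hs => hs.deriv
  have hd2 : deriv (deriv κ) 0 = k := hd.deriv_eq.trans h2.deriv
  have hmin : IsLocalMin κ 0 := isLocalMin_of_deriv_deriv_pos (by rw [hd2]; exact hk)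
    hmax.deriv_eq_zero h1.self_of_nhds.continuousAt
  have hconst : κ =ᶠ[𝓝 0] fun _ => κ 0 := by
    filter_upwards [hmax, hmin] with s h1 h2 using le_antisymm h1 h2
  have : deriv κ =ᶠ[𝓝 0] fun _ => 0 := by
    filter_upwards [hconst.deriv] with s hs
    rw [hs, deriv_const]
  rw [this.deriv_eq, deriv_const] at hd2
  exact hk.ne hd2

/-- The function of `u` which divides `|∇u|` in the quantity to be maximised: positive, strictly
decreasing and strictly concave on `[-B, B]`. -/
def barrier (B s : ℝ) : ℝ := (2 * B + 1) ^ 2 + 1 - (s + B + 1) ^ 2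

theorem hasDerivAt_barrier (B s : ℝ) : HasDerivAt (barrier B) (-2 * (s + B + 1)) s := by
  have := ((((hasDerivAt_id s).add_const B).add_const 1).pow 2).const_sub ((2 * B + 1) ^ 2 + 1)
  refine this.congr_deriv ?_
  simp

theorem one_le_barrier {B s : ℝ} (h : |s| ≤ B) : 1 ≤ barrier B s := by
  have := abs_le.1 h
  unfold barrier
  nlinarith

theorem barrier_le (B s : ℝ) : barrier B s ≤ (2 * B + 1) ^ 2 + 1 := by
  unfold barrier
  nlinarith [sq_nonneg (s + B + 1)]

section Touching

variable {E : Type*} [NormedAddCommGroup E] [NormedSpace ℝ E]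

set_option synthInstance.maxHeartbeats 400000 in
/-- The first and second order conditions at `z₀` for the inequality `Du(Y) ≤ m * ζ(u) * |Y|`, `ζ`
the barrier, with equality for the unit vector `y₀` at `z₀`. They come from the test vectors
`y₀ + s • d` along the line `z₀ + s • v`, where `d` is chosen so that the length of the test vector
is stationary; the square root in `|Y|` is removed by `√N ≤ (1 + N) / 2`. -/
theorem touching_conditions {u : E → ℝ} {G : E → E →L[ℝ] E →L[ℝ] ℝ} {z₀ y₀ : E} {m B : ℝ}
    (hu : ContDiffAt ℝ 3 u z₀) (hG : ContDiffAt ℝ 2 G z₀) (hGnn : ∀ z v, 0 ≤ G z v v)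
    (hm : 0 ≤ m) (huB : |u z₀| ≤ B) (hy₀ : G z₀ y₀ y₀ = 1)
    (hP : fderiv ℝ u z₀ y₀ = m * barrier B (u z₀))
    (hle : ∀ᶠ z in 𝓝 z₀, ∀ Y, fderiv ℝ u z Y ≤ m * barrier B (u z) * √(G z Y Y))
    (v d : E) (hd : fderiv ℝ G z₀ v y₀ y₀ + G z₀ d y₀ + G z₀ y₀ d = 0) :
    fderiv ℝ (fderiv ℝ u) z₀ v y₀ + fderiv ℝ u z₀ d
      = m * (-2 * (u z₀ + B + 1)) * fderiv ℝ u z₀ v ∧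
    fderiv ℝ (fderiv ℝ (fderiv ℝ u)) z₀ v v y₀ + 2 * fderiv ℝ (fderiv ℝ u) z₀ v d
      ≤ m / 2 * barrier B (u z₀) *
          (fderiv ℝ (fun z => fderiv ℝ G z v) z₀ v y₀ y₀ + 2 * fderiv ℝ G z₀ v d y₀
            + 2 * fderiv ℝ G z₀ v y₀ d + 2 * G z₀ d d)
        + m * (-2 * (fderiv ℝ u z₀ v) ^ 2
            + -2 * (u z₀ + B + 1) * fderiv ℝ (fderiv ℝ u) z₀ v v) := by
  have hz0 : z₀ + (0 : ℝ) • v = z₀ := by simp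
  have hcont : Filter.Tendsto (fun s : ℝ => z₀ + s • v) (𝓝 0) (𝓝 z₀) := by
    have := (hasDerivAt_line z₀ v 0).continuousAt.tendsto
    rwa [hz0] at this
  have hu' : ContDiffAt ℝ 2 (fderiv ℝ u) z₀ := hu.fderiv_right (by norm_num)
  have hu'' : ContDiffAt ℝ 1 (fderiv ℝ (fderiv ℝ u)) z₀ :=
    ContDiffAt.fderiv_right (F := E →L[ℝ] ℝ) hu' (by norm_num)
  have hG'' : DifferentiableAt ℝ (fun z => fderiv ℝ G z v) z₀ :=
    ContDiffAt.differentiableAt_fderiv_apply (F := E →L[ℝ] E →L[ℝ] ℝ) hG v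
  have ev : ∀ {p : E → Prop}, (∀ᶠ z in 𝓝 z₀, p z) → ∀ᶠ s : ℝ in 𝓝 0, p (z₀ + s • v) :=
    fun h => hcont.eventually h
  have e1 : ∀ᶠ z in 𝓝 z₀, DifferentiableAt ℝ u z :=
    (hu.eventually (by simp)).mono fun z hz => hz.differentiableAt (by norm_num)
  have e2 : ∀ᶠ z in 𝓝 z₀, DifferentiableAt ℝ (fderiv ℝ u) z :=
    (ContDiffAt.eventually (F := E →L[ℝ] ℝ) hu' (by simp)).mono
      fun z hz => hz.differentiableAt (by norm_num)
  have e3 : ∀ᶠ z in 𝓝 z₀, DifferentiableAt ℝ G z :=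
    (ContDiffAt.eventually (F := E →L[ℝ] E →L[ℝ] ℝ) hG (by simp)).mono
      fun z hz => hz.differentiableAt (by norm_num)
  -- Along the line: `α` is the derivative of `u` on the test vector, `N` its squared length, `υ` the
  -- value of `u`.
  let α : ℝ → ℝ := fun s => fderiv ℝ u (z₀ + s • v) (y₀ + s • d)
  let α' : ℝ → ℝ := fun s => fderiv ℝ (fderiv ℝ u) (z₀ + s • v) v (y₀ + s • d)
    + fderiv ℝ u (z₀ + s • v) d
  let N : ℝ → ℝ := fun s => G (z₀ + s • v) (y₀ + s • d) (y₀ + s • d)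
  let N' : ℝ → ℝ := fun s => fderiv ℝ G (z₀ + s • v) v (y₀ + s • d) (y₀ + s • d)
    + G (z₀ + s • v) d (y₀ + s • d) + G (z₀ + s • v) (y₀ + s • d) d
  let υ : ℝ → ℝ := fun s => u (z₀ + s • v)
  let υ' : ℝ → ℝ := fun s => fderiv ℝ u (z₀ + s • v) v
  have hα : ∀ᶠ s in 𝓝 0, HasDerivAt α (α' s) s :=
    (ev e2).mono fun s hs => hasDerivAt_linear_line hs y₀ d
  have hN : ∀ᶠ s in 𝓝 0, HasDerivAt N (N' s) s :=
    (ev e3).mono fun s hs => hasDerivAt_bilinear_line hs y₀ d y₀ d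
  have hυ : ∀ᶠ s in 𝓝 0, HasDerivAt υ (υ' s) s :=
    (ev e1).mono fun s hs => DifferentiableAt.hasDerivAt_line hs
  have hD1 : DifferentiableAt ℝ (fderiv ℝ u) (z₀ + (0 : ℝ) • v) :=
    hz0.symm ▸ hu'.differentiableAt (by norm_num)
  have hD2 : DifferentiableAt ℝ (fderiv ℝ (fderiv ℝ u)) (z₀ + (0 : ℝ) • v) :=
    hz0.symm ▸ hu''.differentiableAt (by norm_num)
  have hDG : DifferentiableAt ℝ G (z₀ + (0 : ℝ) • v) :=
    hz0.symm ▸ hG.differentiableAt (by norm_num)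
  have hα' : HasDerivAt α' (fderiv ℝ (fderiv ℝ (fderiv ℝ u)) z₀ v v y₀
      + 2 * fderiv ℝ (fderiv ℝ u) z₀ v d) 0 := by
    have h1 := hasDerivAt_bilinear_line hD2 v 0 y₀ d
    have h2 := hasDerivAt_linear_line hD1 d 0
    simp only [zero_smul, add_zero, smul_zero, map_zero, zero_apply] at h1 h2
    exact (h1.add h2).congr_deriv (by ring)
  have hN' : HasDerivAt N' (fderiv ℝ (fun z => fderiv ℝ G z v) z₀ v y₀ y₀
      + 2 * fderiv ℝ G z₀ v d y₀ + 2 * fderiv ℝ G z₀ v y₀ d + 2 * G z₀ d d) 0 := by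
    have h1 := hasDerivAt_bilinear_line (F := fun z => fderiv ℝ G z v) (y := v) (s₀ := 0)
      (hz0.symm ▸ hG'') y₀ d y₀ d
    have h2 := hasDerivAt_bilinear_line hDG d 0 y₀ d
    have h3 := hasDerivAt_bilinear_line hDG y₀ d d 0
    simp only [zero_smul, add_zero, smul_zero, map_zero, zero_apply] at h1 h2 h3
    exact ((h1.add h2).add h3).congr_deriv (by ring)
  have hυ' : HasDerivAt υ' (fderiv ℝ (fderiv ℝ u) z₀ v v) 0 := by
    have h2 := hasDerivAt_linear_line hD1 v 0
    simpa only [zero_smul, add_zero, smul_zero, map_zero] using h2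
  -- By `√N ≤ (1 + N) / 2`, with equality at `N = 1`, the smooth function `κ` has a maximum at `0`.
  let κ : ℝ → ℝ := fun s => α s - m / 2 * ((1 + N s) * barrier B (υ s))
  let κ' : ℝ → ℝ := fun s => α' s - m / 2 * (N' s * barrier B (υ s)
    + (1 + N s) * (-2 * (υ s + B + 1) * υ' s))
  have hκ : ∀ᶠ s in 𝓝 0, HasDerivAt κ (κ' s) s := by
    filter_upwards [hα, hN, hυ] with s h1 h2 h3
    have h4 : HasDerivAt (fun s => barrier B (υ s)) (-2 * (υ s + B + 1) * υ' s) s :=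
      (hasDerivAt_barrier B (υ s)).comp s h3
    exact h1.sub (((h2.const_add 1).mul h4).const_mul (m / 2))
  have hN0 : N 0 = 1 := by simp [N, hy₀]
  have hN'0 : N' 0 = 0 := by simpa [N'] using hd
  have hυ0 : υ 0 = u z₀ := by simp [υ]
  have hυ'0 : υ' 0 = fderiv ℝ u z₀ v := by simp [υ']
  have hκ' : HasDerivAt κ' (fderiv ℝ (fderiv ℝ (fderiv ℝ u)) z₀ v v y₀
        + 2 * fderiv ℝ (fderiv ℝ u) z₀ v d
      - m / 2 * ((fderiv ℝ (fun z => fderiv ℝ G z v) z₀ v y₀ y₀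
            + 2 * fderiv ℝ G z₀ v d y₀ + 2 * fderiv ℝ G z₀ v y₀ d + 2 * G z₀ d d)
            * barrier B (u z₀)
          + 2 * (-2 * (fderiv ℝ u z₀ v) ^ 2
            + -2 * (u z₀ + B + 1) * fderiv ℝ (fderiv ℝ u) z₀ v v))) 0 := by
    have h4 : HasDerivAt (fun s => barrier B (υ s)) (-2 * (υ 0 + B + 1) * υ' 0) 0 :=
      (hasDerivAt_barrier B (υ 0)).comp 0 hυ.self_of_nhds
    have h5 : HasDerivAt (fun s => -2 * (υ s + B + 1) * υ' s)
        (-2 * υ' 0 * υ' 0 + -2 * (υ 0 + B + 1) * fderiv ℝ (fderiv ℝ u) z₀ v v) 0 :=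
      ((((hυ.self_of_nhds.add_const B).add_const 1).const_mul (-2)).mul hυ')
    refine (hα'.sub (((hN'.mul h4).add
      ((hN.self_of_nhds.const_add 1).mul h5)).const_mul (m / 2))).congr_deriv ?_
    simp only [hN0, hN'0, hυ0, hυ'0]
    ring
  have hmax : IsLocalMax κ 0 := by
    have h0 : κ 0 = 0 := by
      simp only [κ, hN0, hυ0, α, zero_smul, add_zero, hP]
      ring
    have hpos : ∀ᶠ s in 𝓝 0, 0 < barrier B (υ s) := by
      have hc : ContinuousAt (fun s => barrier B (υ s)) 0 :=
        ((hasDerivAt_barrier B (υ 0)).comp 0 hυ.self_of_nhds).continuousAt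
      refine hc.eventually (lt_mem_nhds ?_)
      change 0 < barrier B (υ 0)
      rw [hυ0]
      linarith [one_le_barrier huB]
    filter_upwards [ev hle, hpos] with s h1 h2
    rw [h0]
    have h3 := h1 (y₀ + s • d)
    have h4 : √(N s) ≤ (1 + N s) / 2 := by
      have hn : 0 ≤ N s := hGnn _ _
      nlinarith [Real.sq_sqrt hn, sq_nonneg (√(N s) - 1)]
    have h5 : m * barrier B (υ s) * √(N s) ≤ m * barrier B (υ s) * ((1 + N s) / 2) := by
      gcongr
    have h6 : α s ≤ m * barrier B (υ s) * √(N s) := h3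
    simp only [κ]
    linarith
  have hfirst : κ' 0 = 0 := hmax.hasDerivAt_eq_zero hκ.self_of_nhds
  have hsecond := second_deriv_nonpos_of_isLocalMax hκ hκ' hmax
  refine ⟨?_, by linarith⟩
  simp only [κ', hN0, hN'0, hυ0, hυ'0, α', zero_smul, add_zero] at hfirst
  linarith

end Touching

/-! ### Bounds for the geometry in coordinates -/

section LocalEstimate

variable {E : Type*} [NormedAddCommGroup E] [NormedSpace ℝ E]

/-- The metric `G`, its Christoffel symbols `Ch` and a tensor `X`, all expressed in local
coordinates, at the point `z`: regularity, the relations between them which characterise the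
Levi-Civita connection, and quantitative bounds by `R`. -/
structure GeometryBound (R : ℝ) (G : E → E →L[ℝ] E →L[ℝ] ℝ) (Ch : E → E →L[ℝ] E →L[ℝ] E)
    (X : E → E →L[ℝ] E →L[ℝ] ℝ) (z : E) : Prop where
  one_le : 1 ≤ R
  contDiffAt_metric : ContDiffAt ℝ 2 G z
  differentiableAt_christoffel : DifferentiableAt ℝ Ch z
  differentiableAt_tensor : DifferentiableAt ℝ X z
  metric_nonneg : ∀ y v, 0 ≤ G y v v
  metric_symm : ∀ v w, G z v w = G z w v
  christoffel_symm : ∀ v w, Ch z v w = Ch z w v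
  compatible : ∀ l v w, fderiv ℝ G z l v w = G z (Ch z l v) w + G z v (Ch z l w)
  coercive : ∀ v, ‖v‖ ^ 2 ≤ R * G z v v
  metric_le : ∀ v w, |G z v w| ≤ R * ‖v‖ * ‖w‖
  fderiv_metric_le : ∀ l v w, |fderiv ℝ G z l v w| ≤ R * ‖l‖ * ‖v‖ * ‖w‖
  fderiv_fderiv_metric_le : ∀ l v w,
    |fderiv ℝ (fun y => fderiv ℝ G y l) z l v w| ≤ R * ‖l‖ * ‖l‖ * ‖v‖ * ‖w‖
  christoffel_le : ∀ v w, ‖Ch z v w‖ ≤ R * ‖v‖ * ‖w‖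
  fderiv_christoffel_le : ∀ l v w, ‖fderiv ℝ Ch z l v w‖ ≤ R * ‖l‖ * ‖v‖ * ‖w‖
  tensor_le : ∀ v w, |X z v w| ≤ R * ‖v‖ * ‖w‖
  fderiv_tensor_le : ∀ l v w, |fderiv ℝ X z l v w| ≤ R * ‖l‖ * ‖v‖ * ‖w‖

theorem fderiv_fderiv_symm {u : E → ℝ} {z : E} (hu : ContDiffAt ℝ 2 u z) (v w : E) :
    fderiv ℝ (fderiv ℝ u) z v w = fderiv ℝ (fderiv ℝ u) z w v :=
  (hu.isSymmSndFDerivAt (by simp)).eq v w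

set_option synthInstance.maxHeartbeats 400000 in
theorem fderiv_fderiv_fderiv_symm {u : E → ℝ} {z : E} (hu : ContDiffAt ℝ 3 u z) (v w : E) :
    fderiv ℝ (fderiv ℝ (fderiv ℝ u)) z v v w = fderiv ℝ (fderiv ℝ (fderiv ℝ u)) z w v v := by
  have hu' : ContDiffAt ℝ 2 (fderiv ℝ u) z := hu.fderiv_right (by norm_num)
  have h1 : fderiv ℝ (fderiv ℝ (fderiv ℝ u)) z v w = fderiv ℝ (fderiv ℝ (fderiv ℝ u)) z w v :=
    (ContDiffAt.isSymmSndFDerivAt (F := E →L[ℝ] ℝ) hu' (by simp)).eq v w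
  have h2 : fderiv ℝ (fderiv ℝ (fderiv ℝ u)) z v v w
      = fderiv ℝ (fderiv ℝ (fderiv ℝ u)) z v w v := by
    have hu'' : DifferentiableAt ℝ (fderiv ℝ (fderiv ℝ u)) z :=
      (ContDiffAt.fderiv_right (F := E →L[ℝ] ℝ) (m := 1) hu' (by norm_num)).differentiableAt
        (by norm_num)
    have hz : z + (0 : ℝ) • v = z := by simp
    have d1 := hasDerivAt_bilinear_line (y := v) (s₀ := 0) (hz.symm ▸ hu'') v 0 w 0
    have d2 := hasDerivAt_bilinear_line (y := v) (s₀ := 0) (hz.symm ▸ hu'') w 0 v 0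
    simp only [zero_smul, add_zero, smul_zero, map_zero, zero_apply] at d1 d2
    refine d1.unique (d2.congr_of_eventuallyEq ?_)
    have hcont : Filter.Tendsto (fun s : ℝ => z + s • v) (𝓝 0) (𝓝 z) := by
      have := (hasDerivAt_line z v 0).continuousAt.tendsto
      rwa [hz] at this
    filter_upwards [hcont.eventually (hu.eventually (by simp))] with s hs
    exact fderiv_fderiv_symm (hs.of_le (by norm_num)) v w
  rw [h2, h1]

set_option synthInstance.maxHeartbeats 400000 in
theorem fderiv_hessian_add {u : E → ℝ} {z : E} (hu : ContDiffAt ℝ 3 u z)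
    {Ch : E → E →L[ℝ] E →L[ℝ] E} {X U : E → E →L[ℝ] E →L[ℝ] ℝ}
    (hCh : DifferentiableAt ℝ Ch z) (hX : DifferentiableAt ℝ X z) (hU : DifferentiableAt ℝ U z)
    (hUeq : ∀ᶠ y in 𝓝 z, ∀ v w, U y v w
      = fderiv ℝ (fderiv ℝ u) y v w - fderiv ℝ u y (Ch y v w) + X y v w) (l v w : E) :
    fderiv ℝ U z l v w = fderiv ℝ (fderiv ℝ (fderiv ℝ u)) z l v w
      - (fderiv ℝ (fderiv ℝ u) z l (Ch z v w) + fderiv ℝ u z (fderiv ℝ Ch z l v w))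
      + fderiv ℝ X z l v w := by
  have hz : z + (0 : ℝ) • l = z := by simp
  have hu' : ContDiffAt ℝ 2 (fderiv ℝ u) z := hu.fderiv_right (by norm_num)
  have hu'' : DifferentiableAt ℝ (fderiv ℝ (fderiv ℝ u)) z :=
    (ContDiffAt.fderiv_right (F := E →L[ℝ] ℝ) (m := 1) hu' (by norm_num)).differentiableAt
      (by norm_num)
  have d1 := hasDerivAt_bilinear_line (y := l) (s₀ := 0) (hz.symm ▸ hU) v 0 w 0
  have d2 := hasDerivAt_bilinear_line (y := l) (s₀ := 0) (hz.symm ▸ hu'') v 0 w 0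
  have d3 := hasDerivAt_bilinear_line (y := l) (s₀ := 0) (hz.symm ▸ hX) v 0 w 0
  have d4 := hasDerivAt_bilinear_line (y := l) (s₀ := 0) (hz.symm ▸ hCh) v 0 w 0
  have d5 : HasDerivAt (fun s : ℝ => fderiv ℝ u (z + s • l)) (fderiv ℝ (fderiv ℝ u) z l) 0 :=
    DifferentiableAt.hasDerivAt_line_zero (F := E →L[ℝ] ℝ) (hu'.differentiableAt (by norm_num)) l
  simp only [zero_smul, add_zero, smul_zero, map_zero, zero_apply] at d1 d2 d3 d4
  have d6 := d5.clm_apply d4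
  simp only [zero_smul, add_zero] at d6
  refine d1.unique (((d2.sub d6).add d3).congr_of_eventuallyEq ?_)
  have hcont : Filter.Tendsto (fun s : ℝ => z + s • l) (𝓝 0) (𝓝 z) := by
    have := (hasDerivAt_line z l 0).continuousAt.tendsto
    rwa [hz] at this
  filter_upwards [hcont.eventually hUeq] with s hs
  simpa using hs v w

end LocalEstimate

/-! ### The estimate at an interior maximum, in coordinates -/

section LocalEstimate

variable {E : Type*} [NormedAddCommGroup E] [NormedSpace ℝ E]

/-- The remainder left over for one eigendirection `e` when the second order condition at the
maximum is compared with the linearised equation. It contains no second derivatives of `u`. -/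
theorem remainder_le {R : ℝ} {G : E → E →L[ℝ] E →L[ℝ] ℝ} {Ch : E → E →L[ℝ] E →L[ℝ] E}
    {X : E → E →L[ℝ] E →L[ℝ] ℝ} {z y e : E} (hg : GeometryBound R G Ch X z)
    (hy : ‖y‖ ≤ R) (he : ‖e‖ ≤ R) {P m Z ζ' : ℝ} (hP : 0 ≤ P) (hm : 0 ≤ m) (hζ : |ζ'| ≤ Z)
    {p : E → ℝ} (hp : ∀ v, p v = P * G z y v) :
    P / 2 * (fderiv ℝ (fun x => fderiv ℝ G x e) z e y y + 2 * fderiv ℝ G z e (-Ch z e y) y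
        + 2 * fderiv ℝ G z e y (-Ch z e y) + 2 * G z (-Ch z e y) (-Ch z e y))
      - m * ζ' * X z e e + fderiv ℝ X z y e e + X z (-Ch z e y) e + X z e (-Ch z e y)
      - p (Ch z (Ch z e e) y) - p (fderiv ℝ Ch z y e e) - 2 * p (Ch z e (-Ch z e y))
      ≤ R ^ 7 * (8 * P + m * Z + 3) := by
  have hR := hg.one_le
  have hR0 : 0 ≤ R := by linarith
  have hZ0 : 0 ≤ Z := (abs_nonneg _).trans hζ
  have hd : ‖-Ch z e y‖ ≤ R ^ 3 := by
    rw [norm_neg]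
    calc ‖Ch z e y‖ ≤ R * ‖e‖ * ‖y‖ := hg.christoffel_le e y
      _ ≤ R * R * R := by gcongr
      _ = R ^ 3 := by ring
  set d := -Ch z e y
  have hpow : ∀ k : ℕ, k ≤ 7 → R ^ k ≤ R ^ 7 := fun k hk => pow_le_pow_right₀ hR hk
  have b1 : fderiv ℝ (fun x => fderiv ℝ G x e) z e y y ≤ R ^ 7 := by
    calc _ ≤ R * ‖e‖ * ‖e‖ * ‖y‖ * ‖y‖ := (le_abs_self _).trans (hg.fderiv_fderiv_metric_le e y y)
      _ ≤ R * R * R * R * R := by gcongr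
      _ = R ^ 5 := by ring
      _ ≤ R ^ 7 := hpow 5 (by norm_num)
  have b2 : fderiv ℝ G z e d y ≤ R ^ 7 := by
    calc _ ≤ R * ‖e‖ * ‖d‖ * ‖y‖ := (le_abs_self _).trans (hg.fderiv_metric_le e d y)
      _ ≤ R * R * R ^ 3 * R := by gcongr
      _ = R ^ 6 := by ring
      _ ≤ R ^ 7 := hpow 6 (by norm_num)
  have b3 : fderiv ℝ G z e y d ≤ R ^ 7 := by
    calc _ ≤ R * ‖e‖ * ‖y‖ * ‖d‖ := (le_abs_self _).trans (hg.fderiv_metric_le e y d)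
      _ ≤ R * R * R * R ^ 3 := by gcongr
      _ = R ^ 6 := by ring
      _ ≤ R ^ 7 := hpow 6 (by norm_num)
  have b4 : G z d d ≤ R ^ 7 := by
    calc _ ≤ R * ‖d‖ * ‖d‖ := (le_abs_self _).trans (hg.metric_le d d)
      _ ≤ R * R ^ 3 * R ^ 3 := by gcongr
      _ = R ^ 7 := by ring
  have b5 : -(ζ' * X z e e) ≤ Z * R ^ 7 := by
    calc _ ≤ |ζ' * X z e e| := neg_le_abs _
      _ = |ζ'| * |X z e e| := abs_mul _ _
      _ ≤ |ζ'| * (R * ‖e‖ * ‖e‖) := by gcongr; exact hg.tensor_le e e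
      _ ≤ Z * (R * R * R) := by gcongr
      _ = Z * R ^ 3 := by ring
      _ ≤ Z * R ^ 7 := by
        have := hpow 3 (by norm_num)
        gcongr
  have b6 : fderiv ℝ X z y e e ≤ R ^ 7 := by
    calc _ ≤ R * ‖y‖ * ‖e‖ * ‖e‖ := (le_abs_self _).trans (hg.fderiv_tensor_le y e e)
      _ ≤ R * R * R * R := by gcongr
      _ = R ^ 4 := by ring
      _ ≤ R ^ 7 := hpow 4 (by norm_num)
  have b7 : X z d e ≤ R ^ 7 := by
    calc _ ≤ R * ‖d‖ * ‖e‖ := (le_abs_self _).trans (hg.tensor_le d e)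
      _ ≤ R * R ^ 3 * R := by gcongr
      _ = R ^ 5 := by ring
      _ ≤ R ^ 7 := hpow 5 (by norm_num)
  have b8 : X z e d ≤ R ^ 7 := by
    calc _ ≤ R * ‖e‖ * ‖d‖ := (le_abs_self _).trans (hg.tensor_le e d)
      _ ≤ R * R * R ^ 3 := by gcongr
      _ = R ^ 5 := by ring
      _ ≤ R ^ 7 := hpow 5 (by norm_num)
  have hpv : ∀ v, ‖v‖ ≤ R ^ 5 → |p v| ≤ P * R ^ 7 := by
    intro v hv
    rw [hp, abs_mul, abs_of_nonneg hP]
    have : |G z y v| ≤ R ^ 7 := by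
      calc _ ≤ R * ‖y‖ * ‖v‖ := hg.metric_le y v
        _ ≤ R * R * R ^ 5 := by gcongr
        _ = R ^ 7 := by ring
    gcongr
  have b9 : -p (Ch z (Ch z e e) y) ≤ P * R ^ 7 := by
    refine (neg_le_abs _).trans (hpv _ ?_)
    have h1 : ‖Ch z e e‖ ≤ R * R * R := (hg.christoffel_le e e).trans (by gcongr)
    calc _ ≤ R * ‖Ch z e e‖ * ‖y‖ := hg.christoffel_le _ _
      _ ≤ R * (R * R * R) * R := by gcongr
      _ = R ^ 5 := by ring
  have b10 : -p (fderiv ℝ Ch z y e e) ≤ P * R ^ 7 := by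
    refine (neg_le_abs _).trans (hpv _ ?_)
    calc _ ≤ R * ‖y‖ * ‖e‖ * ‖e‖ := hg.fderiv_christoffel_le _ _ _
      _ ≤ R * R * R * R := by gcongr
      _ = R ^ 4 := by ring
      _ ≤ R ^ 5 := pow_le_pow_right₀ hR (by norm_num)
  have b11 : -p (Ch z e d) ≤ P * R ^ 7 := by
    refine (neg_le_abs _).trans (hpv _ ?_)
    calc _ ≤ R * ‖e‖ * ‖d‖ := hg.christoffel_le _ _
      _ ≤ R * R * R ^ 3 := by gcongr
      _ = R ^ 5 := by ring
  have c1 : P / 2 * (fderiv ℝ (fun x => fderiv ℝ G x e) z e y y + 2 * fderiv ℝ G z e d y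
      + 2 * fderiv ℝ G z e y d + 2 * G z d d) ≤ P / 2 * (7 * R ^ 7) := by
    gcongr; linarith
  have c2 : m * -(ζ' * X z e e) ≤ m * (Z * R ^ 7) := by gcongr
  have c3 : 0 ≤ P * R ^ 7 := by positivity
  linarith

/-- The bound for `P ^ 2`, `P` the length of the gradient, at an interior maximum. -/
def interiorBound (n : ℕ) (R A B ν₀ K₀ : ℝ) : ℝ :=
  1 + ((2 * B + 1) ^ 2 + 1) * n * R ^ 3
    + ((2 * B + 1) ^ 2 + 1) * n / (2 * ν₀) * (A + (2 * (2 * B + 1)) * K₀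
      + R ^ 7 * (11 + 2 * (2 * B + 1)))

/-- The inequality at an interior maximum of `|∇u| / ζ(u)`, `ζ` the barrier: the second order
conditions in the eigendirections `e a`, weighted with `f_a`, are compared with the linearised
equation and leave `2 m ∑ f_a (Du(e a))²` on the good side. -/
theorem exists_eigenbasis_weighted_le {n : ℕ} {f : (Fin (n + 1) → ℝ) → ℝ}
    {Γ : Set (Fin (n + 1) → ℝ)} (hf : ConcaveOn ℝ Γ f)
    (hΓ : ∀ σ : Equiv.Perm (Fin (n + 1)), ∀ lam ∈ Γ, lam ∘ σ ∈ Γ)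
    (hs : ∀ σ : Equiv.Perm (Fin (n + 1)), ∀ lam ∈ Γ, f (lam ∘ σ) = f lam)
    (hfd : ∀ lam ∈ Γ, DifferentiableAt ℝ f lam)
    (hf_incr : ∀ lam ∈ Γ, ∀ i, 0 < partialDeriv f i lam)
    {K₀ : ℝ} (hK₀ : 0 ≤ K₀)
    (hf_euler : ∀ lam ∈ Γ,
      -K₀ * (1 + ∑ i, partialDeriv f i lam) ≤ ∑ i, partialDeriv f i lam * lam i)
    {R A B : ℝ} {G : E → E →L[ℝ] E →L[ℝ] ℝ} {Ch : E → E →L[ℝ] E →L[ℝ] E}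
    {X U : E → E →L[ℝ] E →L[ℝ] ℝ} {u w ψ : E → ℝ} {z y : E} (hg : GeometryBound R G Ch X z)
    (hu : ContDiffAt ℝ 3 u z) (huB : |u z| ≤ B)
    (hw : DifferentiableAt ℝ w z) (hψ : DifferentiableAt ℝ ψ z)
    (hU : DifferentiableAt ℝ U z)
    (hUeq : ∀ᶠ x in 𝓝 z, ∀ v v', U x v v'
      = fderiv ℝ (fderiv ℝ u) x v v' - fderiv ℝ u x (Ch x v v') + X x v v')
    (heq : ∀ᶠ x in 𝓝 z, ∃ (ε : Fin n → E) (lam : Fin n → ℝ), IsEigenbasis (G x) (U x) ε lam ∧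
      (Fin.snoc lam (-w x) : Fin (n + 1) → ℝ) ∈ Γ ∧
      f (Fin.snoc lam (-w x) : Fin (n + 1) → ℝ) = ψ x)
    {P m : ℝ} (hP0 : 0 ≤ P) (hm0 : 0 ≤ m) (hPm : P = m * barrier B (u z)) (hy : G z y y = 1)
    (hDu : ∀ v, fderiv ℝ u z v = P * G z y v)
    (hDψ : -A ≤ fderiv ℝ ψ z y)
    (hle : ∀ᶠ x in 𝓝 z, ∀ Y, fderiv ℝ u x Y ≤ m * barrier B (u x) * √(G x Y Y))
    (htime : m * (-2 * (u z + B + 1)) * w z ≤ fderiv ℝ w z y) :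
    ∃ (e : Fin n → E) (lam : Fin n → ℝ), IsEigenbasis (G z) (U z) e lam ∧
      (Fin.snoc lam (-w z) : Fin (n + 1) → ℝ) ∈ Γ ∧
      (∀ a, lam a * G z y (e a)
        = m * (-2 * (u z + B + 1)) * (P * G z y (e a)) + X z (e a) y) ∧
      2 * m * ∑ a : Fin n, partialDeriv f a.castSucc (Fin.snoc lam (-w z) : Fin (n + 1) → ℝ)
          * (P * G z y (e a)) ^ 2
        ≤ A + m * (2 * (2 * B + 1)) * K₀
            * (1 + ∑ i, partialDeriv f i (Fin.snoc lam (-w z) : Fin (n + 1) → ℝ))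
          + R ^ 7 * (8 * P + m * (2 * (2 * B + 1)) + 3)
            * ∑ i, partialDeriv f i (Fin.snoc lam (-w z) : Fin (n + 1) → ℝ) := by
  obtain ⟨e, lam, he, hmem, hval⟩ := heq.self_of_nhds
  set D : Fin (n + 1) → ℝ :=
    fun i => partialDeriv f i (Fin.snoc lam (-w z) : Fin (n + 1) → ℝ) with hD
  have hDpos : ∀ i, 0 < D i := hf_incr _ hmem
  set σ := ∑ i, D i with hσ
  have hσ0 : 0 ≤ σ := Finset.sum_nonneg fun i _ => (hDpos i).le
  have hσ' : ∑ a : Fin n, D a.castSucc ≤ σ := by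
    rw [hσ, Fin.sum_univ_castSucc]
    linarith [hDpos (Fin.last n)]
  have hR := hg.one_le
  have hR0 : 0 ≤ R := by linarith
  have hnorm : ∀ v, G z v v = 1 → ‖v‖ ≤ R := by
    intro v hv
    have := hg.coercive v
    rw [hv] at this
    nlinarith [norm_nonneg v]
  have hyR := hnorm y hy
  have heR : ∀ a, ‖e a‖ ≤ R := fun a => hnorm _ (by simp [he.orthonormal])
  have hB0 : 0 ≤ B := (abs_nonneg _).trans huB
  have huB' := abs_le.1 huB
  set ζ' := -2 * (u z + B + 1) with hζ'
  set Z := 2 * (2 * B + 1) with hZ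
  have hζ'Z : |ζ'| ≤ Z := by rw [abs_le]; constructor <;> linarith
  have hζ'neg : ζ' ≤ -2 := by linarith
  have hcompat : ∀ v w w', fderiv ℝ G z v w w' + G z (-Ch z v w) w' + G z w (-Ch z v w') = 0 := by
    intro v w w'
    rw [hg.compatible]
    simp only [map_neg, neg_apply]
    ring
  -- The test vectors are parallel to first order, since their derivative in direction `v` is
  -- `-Ch z v y`.
  have htouch := fun v => touching_conditions hu hg.contDiffAt_metric hg.metric_nonneg hm0 huB hy
    (by rw [hDu, hy, mul_one, hPm]) hle v (-Ch z v y) (hcompat v y y)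
  have hfirst : ∀ v, fderiv ℝ (fderiv ℝ u) z v y
      = fderiv ℝ u z (Ch z v y) + m * ζ' * fderiv ℝ u z v := by
    intro v
    have := (htouch v).1
    rw [map_neg] at this
    linarith
  have hUz := hUeq.self_of_nhds
  have hu2 : ContDiffAt ℝ 2 u z := hu.of_le (by norm_num)
  -- The eigenbasis is transported parallelly in the direction `y`.
  have hlin := fderiv_le_linearization (h := fun x => -w x) hf hΓ hs y
    (hg.contDiffAt_metric.differentiableAt (by norm_num)) hU hw.neg hψ he hmem hval
    (hfd _ hmem) (fun i => (hDpos i).le) heq (d := fun a => -Ch z y (e a))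
    (fun a b => hcompat y (e a) (e b))
  have hfneg : fderiv ℝ (fun x => -w x) z y = -fderiv ℝ w z y := by
    rw [fderiv_fun_neg]; rfl
  rw [hfneg] at hlin
  change fderiv ℝ ψ z y ≤ ∑ a : Fin n, D a.castSucc * _ + D (Fin.last n) * _ at hlin
  set C₁ := R ^ 7 * (8 * P + m * Z + 3) with hC₁
  have hC₁0 : 0 ≤ C₁ := by positivity
  -- For each eigendirection, the third derivatives `D³u(e a, e a, y)` of the linearised equation are
  -- replaced through the second order condition, and the remaining second derivatives, which enter
  -- through `Ch`, through the first order condition or cancel by the symmetry of `Ch`.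
  have hterm : ∀ a, fderiv ℝ U z y (e a) (e a) + U z (-Ch z y (e a)) (e a)
      + U z (e a) (-Ch z y (e a))
      ≤ -2 * m * (fderiv ℝ u z (e a)) ^ 2 + m * ζ' * lam a + C₁ := by
    intro a
    have hrem := remainder_le hg hyR (heR a) hP0 hm0 hζ'Z (p := fun v => fderiv ℝ u z v) hDu
    have h2 := (htouch (e a)).2
    have h3 := fderiv_hessian_add hu hg.differentiableAt_christoffel hg.differentiableAt_tensor hU
      hUeq y (e a) (e a)
    have h4 : lam a = fderiv ℝ (fderiv ℝ u) z (e a) (e a) - fderiv ℝ u z (Ch z (e a) (e a))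
        + X z (e a) (e a) := by
      rw [← hUz]; simp [he.diag]
    have h5 := hfirst (Ch z (e a) (e a))
    rw [fderiv_fderiv_symm hu2] at h5
    rw [hUz, hUz, hg.christoffel_symm y (e a), h3, ← fderiv_fderiv_fderiv_symm hu, h5,
      fderiv_fderiv_symm hu2 (-Ch z (e a) y) (e a),
      hg.christoffel_symm (-Ch z (e a) y) (e a)]
    have h6 : m / 2 * barrier B (u z) = P / 2 := by rw [hPm]; ring
    rw [h6, ← hζ'] at h2
    have h7 : m * ζ' * lam a = m * ζ' * fderiv ℝ (fderiv ℝ u) z (e a) (e a)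
      - m * ζ' * fderiv ℝ u z (Ch z (e a) (e a)) + m * ζ' * X z (e a) (e a) := by rw [h4]; ring
    rw [h7]
    linarith
  have hsum : ∑ a : Fin n, D a.castSucc * (fderiv ℝ U z y (e a) (e a) + U z (-Ch z y (e a)) (e a)
      + U z (e a) (-Ch z y (e a)))
      ≤ -2 * m * ∑ a : Fin n, D a.castSucc * (fderiv ℝ u z (e a)) ^ 2
        + m * ζ' * ∑ a : Fin n, D a.castSucc * lam a + C₁ * σ := by
    have h1 : ∑ a : Fin n, D a.castSucc * (fderiv ℝ U z y (e a) (e a)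
        + U z (-Ch z y (e a)) (e a) + U z (e a) (-Ch z y (e a)))
        ≤ ∑ a : Fin n, D a.castSucc * (-2 * m * (fderiv ℝ u z (e a)) ^ 2 + m * ζ' * lam a + C₁) :=
      Finset.sum_le_sum fun a _ => mul_le_mul_of_nonneg_left (hterm a) (hDpos _).le
    have h2 : ∑ a : Fin n, D a.castSucc * (-2 * m * (fderiv ℝ u z (e a)) ^ 2 + m * ζ' * lam a + C₁)
        = -2 * m * ∑ a : Fin n, D a.castSucc * (fderiv ℝ u z (e a)) ^ 2
        + m * ζ' * ∑ a : Fin n, D a.castSucc * lam a + C₁ * ∑ a : Fin n, D a.castSucc := by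
      simp only [Finset.mul_sum, ← Finset.sum_add_distrib]
      exact Finset.sum_congr rfl fun a _ => by ring
    have h3 : C₁ * ∑ a : Fin n, D a.castSucc ≤ C₁ * σ := by gcongr
    linarith
  have heuler : -K₀ * (1 + σ) ≤ ∑ a : Fin n, D a.castSucc * lam a + D (Fin.last n) * -w z := by
    have := hf_euler _ hmem
    rw [Fin.sum_univ_castSucc (f := fun i => partialDeriv f i _ * _)] at this
    simpa [hσ, hD] using this
  have htime' : D (Fin.last n) * -fderiv ℝ w z y ≤ D (Fin.last n) * -(m * ζ' * w z) :=
    mul_le_mul_of_nonneg_left (neg_le_neg htime) (hDpos _).le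
  have heuler' : m * ζ' * (∑ a : Fin n, D a.castSucc * lam a + D (Fin.last n) * -w z)
      ≤ m * Z * K₀ * (1 + σ) := by
    have h1 : m * -ζ' * (-K₀ * (1 + σ))
        ≤ m * -ζ' * (∑ a : Fin n, D a.castSucc * lam a + D (Fin.last n) * -w z) :=
      mul_le_mul_of_nonneg_left heuler (mul_nonneg hm0 (by linarith))
    have h2 : m * -ζ' * (K₀ * (1 + σ)) ≤ m * Z * (K₀ * (1 + σ)) := by
      have := (abs_le.1 hζ'Z).1
      gcongr
      linarith
    linarith
  refine ⟨e, lam, he, hmem, fun a => ?_, ?_⟩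
  · rw [← he.apply_right y a, hUz, hfirst, hDu (e a), hg.metric_symm y (e a),
      hg.metric_symm (e a) y]
    ring
  · simp only [← hDu]
    change 2 * m * ∑ a : Fin n, D a.castSucc * (fderiv ℝ u z (e a)) ^ 2
      ≤ A + m * Z * K₀ * (1 + σ) + C₁ * σ
    linarith

/-- The right side of the weighted inequality is absorbed by its good term: `m` is comparable to
`P`, so that `1 + σ` and one power of `P` cancel. -/
theorem sq_le_of_weighted_le {P m M n q A Z K₀ R ν₀ σ S : ℝ} (hν₀ : 0 < ν₀) (hσ0 : 0 ≤ σ)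
    (hA : 0 ≤ A) (hK₀ : 0 ≤ K₀) (hZ0 : 0 ≤ Z) (hR0 : 0 ≤ R) (hm0 : 0 ≤ m) (hn0 : 0 ≤ n)
    (hM0 : 0 ≤ M) (hP1 : 1 ≤ P) (hmP : m ≤ P) (hPmM : P ≤ m * M) (ha : 1 ≤ n * q ^ 2)
    (hlow : ν₀ * (1 + σ) * (P * q) ^ 2 ≤ S)
    (hgood : 2 * m * S ≤ A + m * Z * K₀ * (1 + σ) + R ^ 7 * (8 * P + m * Z + 3) * σ) :
    P ^ 2 ≤ M * n / (2 * ν₀) * (A + Z * K₀ + R ^ 7 * (11 + Z)) := by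
  have hP0 : 0 ≤ P := by linarith
  have hfin : 2 * m * (ν₀ * (1 + σ) * (P * q) ^ 2)
      ≤ P * (A + Z * K₀ + R ^ 7 * (11 + Z)) * (1 + σ) := by
    have h1 : 2 * m * (ν₀ * (1 + σ) * (P * q) ^ 2)
        ≤ 2 * m * S := by gcongr
    have h2 : A ≤ P * A * (1 + σ) := by
      have : A * 1 ≤ A * (P * (1 + σ)) := by
        gcongr
        exact one_le_mul_of_one_le_of_one_le hP1 (by linarith)
      linarith
    have h3 : m * Z * K₀ * (1 + σ) ≤ P * Z * K₀ * (1 + σ) := by gcongr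
    have h4 : (R ^ 7 * (8 * P + m * Z + 3)) * σ ≤ P * (R ^ 7 * (11 + Z)) * (1 + σ) := by
      have h5 : (R ^ 7 * (8 * P + m * Z + 3)) ≤ P * (R ^ 7 * (11 + Z)) := by
        have : 8 * P + m * Z + 3 ≤ P * (11 + Z) := by
          have : m * Z ≤ P * Z := by gcongr
          linarith
        calc R ^ 7 * (8 * P + m * Z + 3) ≤ R ^ 7 * (P * (11 + Z)) := by gcongr
          _ = _ := by ring
      calc _ ≤ P * (R ^ 7 * (11 + Z)) * σ := by gcongr
        _ ≤ P * (R ^ 7 * (11 + Z)) * (1 + σ) := by gcongr; linarith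
    linarith
  have hfin2 : 2 * m * (ν₀ * (P * q) ^ 2) ≤ P * (A + Z * K₀ + R ^ 7 * (11 + Z)) := by
    refine le_of_mul_le_mul_right ?_ (by linarith : (0 : ℝ) < 1 + σ)
    linarith
  have hfin3 : P ^ 2 ≤ M * n / (2 * ν₀) * (A + Z * K₀ + R ^ 7 * (11 + Z)) := by
    have hPpos : 0 < P := by linarith
    have h1 : P ^ 3 ≤ M * n * (m * (P * q) ^ 2) := by
      calc P ^ 3 = P * P ^ 2 * 1 := by ring
        _ ≤ (m * M) * P ^ 2 * (n * q ^ 2) := by gcongr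
        _ = _ := by ring
    have h2 : P ^ 3 * (2 * ν₀) ≤ M * n * (P * (A + Z * K₀ + R ^ 7 * (11 + Z))) := by
      calc P ^ 3 * (2 * ν₀) ≤ M * n * (m * (P * q) ^ 2) * (2 * ν₀) := by gcongr
        _ = M * n * (2 * m * (ν₀ * (P * q) ^ 2)) := by ring
        _ ≤ _ := by gcongr
    rw [div_mul_eq_mul_div, le_div_iff₀ (by positivity)]
    refine le_of_mul_le_mul_left ?_ hPpos
    linarith
  exact hfin3

/-- The gradient bound at an interior maximum of `|∇u| / ζ(u)`. By the first order condition the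
eigenvalue in a direction carrying at least the fraction `1 / n` of the squared gradient is negative
if the gradient is large; there `f_a ≥ ν₀ (1 + ∑ f_i)`, and the good term wins. -/
theorem sq_le_interiorBound {n : ℕ} {f : (Fin (n + 1) → ℝ) → ℝ}
    {Γ : Set (Fin (n + 1) → ℝ)} (hf : ConcaveOn ℝ Γ f)
    (hΓ : ∀ σ : Equiv.Perm (Fin (n + 1)), ∀ lam ∈ Γ, lam ∘ σ ∈ Γ)
    (hs : ∀ σ : Equiv.Perm (Fin (n + 1)), ∀ lam ∈ Γ, f (lam ∘ σ) = f lam)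
    (hfd : ∀ lam ∈ Γ, DifferentiableAt ℝ f lam)
    (hf_incr : ∀ lam ∈ Γ, ∀ i, 0 < partialDeriv f i lam)
    {ν₀ : ℝ} (hν₀ : 0 < ν₀)
    (hf_neg : ∀ lam ∈ Γ, ∀ j, lam j < 0 →
      ν₀ * (1 + ∑ i, partialDeriv f i lam) ≤ partialDeriv f j lam)
    {K₀ : ℝ} (hK₀ : 0 ≤ K₀)
    (hf_euler : ∀ lam ∈ Γ,
      -K₀ * (1 + ∑ i, partialDeriv f i lam) ≤ ∑ i, partialDeriv f i lam * lam i)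
    {R A B : ℝ} (hA : 0 ≤ A) {G : E → E →L[ℝ] E →L[ℝ] ℝ} {Ch : E → E →L[ℝ] E →L[ℝ] E}
    {X U : E → E →L[ℝ] E →L[ℝ] ℝ} {u w ψ : E → ℝ} {z y : E} (hg : GeometryBound R G Ch X z)
    (hu : ContDiffAt ℝ 3 u z) (huB : |u z| ≤ B)
    (hw : DifferentiableAt ℝ w z) (hψ : DifferentiableAt ℝ ψ z)
    (hU : DifferentiableAt ℝ U z)
    (hUeq : ∀ᶠ x in 𝓝 z, ∀ v v', U x v v'
      = fderiv ℝ (fderiv ℝ u) x v v' - fderiv ℝ u x (Ch x v v') + X x v v')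
    (heq : ∀ᶠ x in 𝓝 z, ∃ (ε : Fin n → E) (lam : Fin n → ℝ), IsEigenbasis (G x) (U x) ε lam ∧
      (Fin.snoc lam (-w x) : Fin (n + 1) → ℝ) ∈ Γ ∧
      f (Fin.snoc lam (-w x) : Fin (n + 1) → ℝ) = ψ x)
    {P m : ℝ} (hP0 : 0 ≤ P) (hm0 : 0 ≤ m) (hPm : P = m * barrier B (u z)) (hy : G z y y = 1)
    (hDu : ∀ v, fderiv ℝ u z v = P * G z y v)
    (hDψ : -A ≤ fderiv ℝ ψ z y)
    (hle : ∀ᶠ x in 𝓝 z, ∀ Y, fderiv ℝ u x Y ≤ m * barrier B (u x) * √(G x Y Y))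
    (htime : m * (-2 * (u z + B + 1)) * w z ≤ fderiv ℝ w z y) :
    P ^ 2 ≤ interiorBound n R A B ν₀ K₀ := by
  obtain ⟨e, lam, he, hmem, hlamq, hgood⟩ := exists_eigenbasis_weighted_le hf hΓ hs hfd hf_incr hK₀
    hf_euler hg hu huB hw hψ hU hUeq heq hP0 hm0 hPm hy hDu hDψ hle htime
  set D : Fin (n + 1) → ℝ :=
    fun i => partialDeriv f i (Fin.snoc lam (-w z) : Fin (n + 1) → ℝ) with hD
  have hDpos : ∀ i, 0 < D i := hf_incr _ hmem
  set σ := ∑ i, D i with hσ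
  have hσ0 : 0 ≤ σ := Finset.sum_nonneg fun i _ => (hDpos i).le
  have hR := hg.one_le
  have hR0 : 0 ≤ R := by linarith
  have hnorm : ∀ v, G z v v = 1 → ‖v‖ ≤ R := by
    intro v hv
    have := hg.coercive v
    rw [hv] at this
    nlinarith [norm_nonneg v]
  have hyR := hnorm y hy
  have heR : ∀ a, ‖e a‖ ≤ R := fun a => hnorm _ (by simp [he.orthonormal])
  have hB0 : 0 ≤ B := (abs_nonneg _).trans huB
  have huB' := abs_le.1 huB
  set ζ' := -2 * (u z + B + 1) with hζ'
  set Z := 2 * (2 * B + 1) with hZ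
  have hZ0 : 0 ≤ Z := by positivity
  have hζ'neg : ζ' ≤ -2 := by linarith
  set M := (2 * B + 1) ^ 2 + 1 with hM
  have hM1 : 1 ≤ M := by nlinarith
  have hmP : m ≤ P := by rw [hPm]; nlinarith [one_le_barrier huB]
  have hPmM : P ≤ m * M := by rw [hPm]; gcongr; exact barrier_le B (u z)
  clear_value ζ' Z M σ
  change 2 * m * ∑ a : Fin n, D a.castSucc * (P * G z y (e a)) ^ 2
      ≤ A + m * Z * K₀ * (1 + σ) + R ^ 7 * (8 * P + m * Z + 3) * σ at hgood
  -- a direction carrying at least the fraction `1 / n` of the gradient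
  have hq : ∑ a, (G z y (e a)) ^ 2 = 1 := by
    rw [← hy, he.metric_apply y y]
    exact Finset.sum_congr rfl fun a _ => sq _
  obtain ⟨a, ha⟩ : ∃ a, 1 ≤ n * (G z y (e a)) ^ 2 := by
    by_contra! hcon
    have hn : (Finset.univ : Finset (Fin n)).Nonempty := by
      by_contra hne
      rw [Finset.not_nonempty_iff_eq_empty] at hne
      rw [hne] at hq
      simp at hq
    have := Finset.sum_lt_sum_of_nonempty hn fun a _ => hcon a
    rw [← Finset.mul_sum, hq] at this
    simp at this
  set q := G z y (e a) with hqdef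
  have hn0 : (0 : ℝ) ≤ n := Nat.cast_nonneg n
  have hq1 : |q| ≤ 1 := by
    rw [← sq_le_one_iff_abs_le_one, ← hq]
    exact Finset.single_le_sum (f := fun a => G z y (e a) ^ 2) (fun b _ => sq_nonneg _)
      (Finset.mem_univ a)
  have hrest : 0 ≤ M * n / (2 * ν₀) * (A + Z * K₀ + R ^ 7 * (11 + Z)) := by positivity
  rw [interiorBound, ← hM, ← hZ]
  -- below this threshold nothing is left to show; above it `χ` cannot change the sign of `lam a`
  by_cases hPbig : P ^ 2 ≤ 1 + M * n * R ^ 3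
  · linarith
  push Not at hPbig
  have hP1 : 1 ≤ P := by
    have : 0 ≤ M * n * R ^ 3 := by positivity
    nlinarith
  have hlamneg : lam a < 0 := by
    by_contra! hlam
    have h1 : lam a * q = m * ζ' * (P * q) + X z (e a) y := hlamq a
    have h2 : 0 ≤ lam a * q * q := by
      rw [mul_assoc]; exact mul_nonneg hlam (mul_self_nonneg q)
    rw [h1] at h2
    have h3 : X z (e a) y * q ≤ R ^ 3 := by
      calc X z (e a) y * q ≤ |X z (e a) y * q| := le_abs_self _
        _ = |X z (e a) y| * |q| := abs_mul _ _
        _ ≤ (R * ‖e a‖ * ‖y‖) * 1 := by gcongr; exact hg.tensor_le _ _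
        _ ≤ (R * R * R) * 1 := by gcongr; exact heR a
        _ = R ^ 3 := by ring
    have h4 : 2 * (m * P) * q ^ 2 ≤ R ^ 3 := by
      have h5 : m * P * q ^ 2 * ζ' ≤ m * P * q ^ 2 * (-2) :=
        mul_le_mul_of_nonneg_left hζ'neg (by positivity)
      linarith
    have h5 : P ^ 2 ≤ M * (m * P) := by
      calc P ^ 2 = P * P := sq P
        _ ≤ (m * M) * P := by gcongr
        _ = M * (m * P) := by ring
    have h6 : P ^ 2 * 1 ≤ P ^ 2 * (n * q ^ 2) := by gcongr
    have h7 : P ^ 2 * (n * q ^ 2) ≤ M * (m * P) * (n * q ^ 2) := by gcongr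
    have h8 : M * (m * P) * (n * q ^ 2) = M * n * (m * P * q ^ 2) := by ring
    have h9 : M * n * (m * P * q ^ 2) ≤ M * n * R ^ 3 := by
      have : 0 ≤ m * P * q ^ 2 := by positivity
      gcongr
      linarith
    linarith
  have hDa : ν₀ * (1 + σ) ≤ D a.castSucc := by
    rw [hσ]
    exact hf_neg _ hmem a.castSucc (by simpa using hlamneg)
  have hlow : ν₀ * (1 + σ) * (P * q) ^ 2
      ≤ ∑ a : Fin n, D a.castSucc * (P * G z y (e a)) ^ 2 := by
    calc ν₀ * (1 + σ) * (P * q) ^ 2 ≤ D a.castSucc * (P * G z y (e a)) ^ 2 := by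
          gcongr
      _ ≤ _ := Finset.single_le_sum (f := fun a : Fin n => D a.castSucc * (P * G z y (e a)) ^ 2)
          (fun b _ => mul_nonneg (hDpos _).le (sq_nonneg _)) (Finset.mem_univ a)
  have hfin3 := sq_le_of_weighted_le hν₀ hσ0 hA hK₀ hZ0 hR0 hm0 hn0 (zero_le_one.trans hM1) hP1 hmP
    hPmM ha hlow hgood
  have : 0 ≤ M * n * R ^ 3 := by positivity
  linarith

end LocalEstimate

/-! ### Coordinate vector fields and bilinear forms given by coefficients -/

section ConstantLinearMap

variable {E V W : Type*} [NormedAddCommGroup E] [NormedSpace ℝ E]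
  [NormedAddCommGroup V] [NormedSpace ℝ V] [NormedAddCommGroup W] [NormedSpace ℝ W]

theorem ContDiffWithinAt.clm_apply_const {a : E → V} {s : Set E} {z : E} {m : WithTop ℕ∞}
    (ha : ContDiffWithinAt ℝ m a s z) (L : V →L[ℝ] W) :
    ContDiffWithinAt ℝ m (fun y => L (a y)) s z :=
  L.contDiff.comp_contDiffWithinAt ha

theorem DifferentiableAt.clm_apply_const {a : E → V} {z : E} (ha : DifferentiableAt ℝ a z)
    (L : V →L[ℝ] W) : DifferentiableAt ℝ (fun y => L (a y)) z :=
  L.differentiableAt.comp z ha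

end ConstantLinearMap

section EuclideanSpace

variable {n : ℕ}

theorem contDiffWithinAt_det {A : EuclideanSpace ℝ (Fin n) → Matrix (Fin n) (Fin n) ℝ}
    {s : Set (EuclideanSpace ℝ (Fin n))} {z : EuclideanSpace ℝ (Fin n)}
    (hA : ∀ i j, ContDiffWithinAt ℝ ∞ (fun y => A y i j) s z) :
    ContDiffWithinAt ℝ ∞ (fun y => (A y).det) s z := by
  simp only [Matrix.det_apply']
  exact ContDiffWithinAt.sum fun σ _ => contDiffWithinAt_const.mul
    (contDiffWithinAt_prod fun i _ => hA _ _)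

theorem contDiffWithinAt_matrix_inv {A : EuclideanSpace ℝ (Fin n) → Matrix (Fin n) (Fin n) ℝ}
    {s : Set (EuclideanSpace ℝ (Fin n))} {z : EuclideanSpace ℝ (Fin n)}
    (hA : ∀ i j, ContDiffWithinAt ℝ ∞ (fun y => A y i j) s z) (hdet : (A z).det ≠ 0)
    (i j : Fin n) : ContDiffWithinAt ℝ ∞ (fun y => (A y)⁻¹ i j) s z := by
  simp only [Matrix.inv_def, Ring.inverse_eq_inv', Matrix.smul_apply, smul_eq_mul,
    Matrix.adjugate_apply]
  refine ((contDiffWithinAt_det hA).inv hdet).mul (contDiffWithinAt_det fun k l => ?_)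
  by_cases h : k = j
  · subst h
    simpa using contDiffWithinAt_const
  · simpa [Matrix.updateRow_ne h] using hA k l

theorem ContinuousLinearMap.apply_eq_sum_single {F : Type*} [AddCommGroup F] [Module ℝ F]
    [TopologicalSpace F] (L : EuclideanSpace ℝ (Fin n) →L[ℝ] F) (v : EuclideanSpace ℝ (Fin n)) :
    L v = ∑ i, v i • L (EuclideanSpace.single i 1) := by
  have hv : v = ∑ i, v i • EuclideanSpace.single i (1 : ℝ) := by
    simpa using ((EuclideanSpace.basisFun (Fin n) ℝ).sum_repr v).symm
  conv_lhs => rw [hv]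
  simp only [map_sum, map_smul]

variable {V : Type*} [NormedAddCommGroup V] [NormedSpace ℝ V]

/-- The map which sends `a` to the bilinear map `(v, w) ↦ v i • w j • a`. -/
def coeffForm (V : Type*) [NormedAddCommGroup V] [NormedSpace ℝ V] (i j : Fin n) :
    V →L[ℝ] EuclideanSpace ℝ (Fin n) →L[ℝ] EuclideanSpace ℝ (Fin n) →L[ℝ] V :=
  (ContinuousLinearMap.smulRightL ℝ (EuclideanSpace ℝ (Fin n))
      (EuclideanSpace ℝ (Fin n) →L[ℝ] V) (EuclideanSpace.proj i)).comp
    (ContinuousLinearMap.smulRightL ℝ (EuclideanSpace ℝ (Fin n)) V (EuclideanSpace.proj j))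

/-- The bilinear map with values in `V` whose coefficients in the standard basis are `a i j`. -/
def bilinOfCoeff (a : Fin n → Fin n → V) :
    EuclideanSpace ℝ (Fin n) →L[ℝ] EuclideanSpace ℝ (Fin n) →L[ℝ] V :=
  ∑ i, ∑ j, coeffForm V i j (a i j)

theorem bilinOfCoeff_apply (a : Fin n → Fin n → V) (v w : EuclideanSpace ℝ (Fin n)) :
    bilinOfCoeff a v w = ∑ i, ∑ j, v i • w j • a i j := by
  simp [bilinOfCoeff, coeffForm, ContinuousLinearMap.smulRightL]

set_option synthInstance.maxHeartbeats 400000 in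
theorem contDiffWithinAt_bilinOfCoeff {a : EuclideanSpace ℝ (Fin n) → Fin n → Fin n → V}
    {s : Set (EuclideanSpace ℝ (Fin n))} {z : EuclideanSpace ℝ (Fin n)} {m : WithTop ℕ∞}
    (ha : ∀ i j, ContDiffWithinAt ℝ m (fun y => a y i j) s z) :
    ContDiffWithinAt ℝ m (fun y => bilinOfCoeff (a y)) s z :=
  ContDiffWithinAt.sum fun i _ => ContDiffWithinAt.sum fun j _ =>
    (ha i j).clm_apply_const
      (W := EuclideanSpace ℝ (Fin n) →L[ℝ] EuclideanSpace ℝ (Fin n) →L[ℝ] V) (coeffForm V i j)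

set_option synthInstance.maxHeartbeats 400000 in
theorem differentiableAt_bilinOfCoeff {a : EuclideanSpace ℝ (Fin n) → Fin n → Fin n → V}
    {z : EuclideanSpace ℝ (Fin n)} (ha : ∀ i j, DifferentiableAt ℝ (fun y => a y i j) z) :
    DifferentiableAt ℝ (fun y => bilinOfCoeff (a y)) z := by
  have h : ∀ i j, DifferentiableAt ℝ (fun y => coeffForm V i j (a y i j)) z := fun i j =>
    (ha i j).clm_apply_const
      (W := EuclideanSpace ℝ (Fin n) →L[ℝ] EuclideanSpace ℝ (Fin n) →L[ℝ] V) (coeffForm V i j)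
  exact DifferentiableAt.fun_sum (𝕜 := ℝ)
    (F := EuclideanSpace ℝ (Fin n) →L[ℝ] EuclideanSpace ℝ (Fin n) →L[ℝ] V) fun i _ =>
    DifferentiableAt.fun_sum (𝕜 := ℝ)
    (F := EuclideanSpace ℝ (Fin n) →L[ℝ] EuclideanSpace ℝ (Fin n) →L[ℝ] V) fun j _ => h i j

end EuclideanSpace

section UniformBounds

variable {E : Type*} [NormedAddCommGroup E] [NormedSpace ℝ E]
  {V : Type*} [NormedAddCommGroup V] [NormedSpace ℝ V]

set_option synthInstance.maxHeartbeats 400000 in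
/-- Derivatives relative to `s` are continuous on all of the compact set `K`, also where `K` touches
the boundary of `s`; at the points of `K` interior to `s` they are the ordinary ones, whence a bound
that does not deteriorate towards the boundary. -/
theorem exists_fderiv_bound_of_contDiffWithinAt {F : E → V} {s t K : Set E}
    (hs : UniqueDiffOn ℝ s) (hts : t ⊆ s) (hK : IsCompact K) (hKt : K ⊆ t)
    (hF : ∀ z ∈ t, ContDiffWithinAt ℝ ∞ F s z) :
    ∃ C : ℝ, 0 ≤ C ∧ ∀ z ∈ K, s ∈ 𝓝 z → ContDiffAt ℝ 2 F z ∧ ‖F z‖ ≤ C ∧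
      (∀ l, ‖fderiv ℝ F z l‖ ≤ C * ‖l‖) ∧
      ∀ l, ‖fderiv ℝ (fun y => fderiv ℝ F y l) z l‖ ≤ C * ‖l‖ * ‖l‖ := by
  have h1 : ∀ z ∈ t, ContDiffWithinAt ℝ ∞ (fderivWithin ℝ F s) s z := fun z hz =>
    (hF z hz).fderivWithin_right (m := ∞) hs (by simp) (hts hz)
  have h2 : ∀ z ∈ t, ContDiffWithinAt ℝ ∞ (fderivWithin ℝ (fderivWithin ℝ F s) s) s z :=
    fun z hz => (h1 z hz).fderivWithin_right (m := ∞) hs (by simp) (hts hz)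
  obtain ⟨C0, hC0⟩ := hK.exists_bound_of_continuousOn (f := F)
    fun z hz => (hF z (hKt hz)).continuousWithinAt.mono (hKt.trans hts)
  obtain ⟨C1, hC1⟩ := hK.exists_bound_of_continuousOn (f := fderivWithin ℝ F s)
    fun z hz => (h1 z (hKt hz)).continuousWithinAt.mono (hKt.trans hts)
  obtain ⟨C2, hC2⟩ := hK.exists_bound_of_continuousOn
    (f := fderivWithin ℝ (fderivWithin ℝ F s) s)
    fun z hz => (h2 z (hKt hz)).continuousWithinAt.mono (hKt.trans hts)
  refine ⟨max 0 (max C0 (max C1 C2)), le_max_left _ _, fun z hz hsz => ?_⟩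
  have e1 : fderivWithin ℝ F s =ᶠ[𝓝 z] fderiv ℝ F := by
    filter_upwards [eventually_mem_nhds_iff.2 hsz] with y hy
    exact fderivWithin_of_mem_nhds hy
  have hcd := (hF z (hKt hz)).contDiffAt hsz
  have hd : DifferentiableAt ℝ (fderiv ℝ F) z :=
    ((hcd.of_le (m := 2) ENat.LEInfty.out).fderiv_right (m := 1)
      (by norm_num)).differentiableAt (by norm_num)
  have e2 : fderivWithin ℝ (fderivWithin ℝ F s) s z = fderiv ℝ (fderiv ℝ F) z := by
    rw [fderivWithin_of_mem_nhds hsz, e1.fderiv_eq]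
  refine ⟨hcd.of_le ENat.LEInfty.out, (hC0 z hz).trans (by simp), fun l => ?_,
    fun l => ?_⟩
  · refine (ContinuousLinearMap.le_opNorm _ _).trans
      (mul_le_mul_of_nonneg_right ?_ (norm_nonneg _))
    have := hC1 z hz
    rw [e1.self_of_nhds] at this
    exact this.trans (by simp)
  · have e3 : fderiv ℝ (fun y => fderiv ℝ F y l) z l = fderiv ℝ (fderiv ℝ F) z l l := by
      have := (hd.hasFDerivAt.clm_apply (hasFDerivAt_const l z)).fderiv
      rw [this]
      simp
    rw [e3]
    refine (ContinuousLinearMap.le_opNorm₂ _ _ _).trans ?_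
    have := hC2 z hz
    rw [e2] at this
    gcongr
    exact this.trans (by simp)

end UniformBounds

section Coordinates

variable {n : ℕ} [NeZero n] {M : Type*} [TopologicalSpace M]
  [ChartedSpace (EuclideanHalfSpace n) M]

theorem mfderivWithin_symm_apply (c : M) (z v : EuclideanSpace ℝ (Fin n)) :
    mfderivWithin 𝓘(ℝ, EuclideanSpace ℝ (Fin n)) (𝓡∂ n) (extChartAt (𝓡∂ n) c).symm
      (range (𝓡∂ n)) z v = ∑ i, v i • coordVector c i z :=
  ContinuousLinearMap.apply_eq_sum_single _ v

section

variable [RiemannianBundle (fun x : M => TangentSpace (𝓡∂ n) x)]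

theorem inner_sum_smul_coordVector (c : M) (z v w : EuclideanSpace ℝ (Fin n)) :
    inner ℝ (∑ i, v i • coordVector c i z) (∑ i, w i • coordVector c i z)
      = ∑ i, ∑ j, v i * w j * metricMatrix c z i j := by
  simp only [sum_inner, inner_sum, real_inner_smul_left, real_inner_smul_right, metricMatrix,
    Matrix.of_apply, mul_assoc]
  rw [Finset.sum_comm]
  exact Finset.sum_congr rfl fun i _ => Finset.sum_congr rfl fun j _ => by ring

theorem metricMatrix_symm (c : M) (z : EuclideanSpace ℝ (Fin n)) (i j : Fin n) :
    metricMatrix c z i j = metricMatrix c z j i :=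
  real_inner_comm (coordVector c j z) (coordVector c i z)

end

section Smooth

variable [IsManifold (𝓡∂ n) ∞ M]

/-- The coordinate vector fields are smooth up to the boundary: in the trivialisation of the tangent
bundle given by the chart they are constant. -/
theorem contMDiffWithinAt_coordVector (c : M) (i : Fin n) {z : EuclideanSpace ℝ (Fin n)}
    (hz : z ∈ (extChartAt (𝓡∂ n) c).target) :
    ContMDiffWithinAt 𝓘(ℝ, EuclideanSpace ℝ (Fin n))
      ((𝓡∂ n).prod 𝓘(ℝ, EuclideanSpace ℝ (Fin n))) ∞
      (fun y => TotalSpace.mk' (EuclideanSpace ℝ (Fin n))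
        (E := fun x : M => TangentSpace (𝓡∂ n) x)
        ((extChartAt (𝓡∂ n) c).symm y) (coordVector c i y)) (range (𝓡∂ n)) z := by
  set e := trivializationAt (EuclideanSpace ℝ (Fin n)) (fun x : M => TangentSpace (𝓡∂ n) x) c
    with he
  let b := (EuclideanSpace.basisFun (Fin n) ℝ).toBasis
  have hx : (extChartAt (𝓡∂ n) c).symm z ∈ e.baseSet := by
    have := (extChartAt (𝓡∂ n) c).map_target hz
    simpa [he] using this
  have h1 := contMDiffAt_localFrame_of_mem (n := ∞) (I := 𝓡∂ n) e b i hx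
  have h2 : ContMDiffWithinAt 𝓘(ℝ, EuclideanSpace ℝ (Fin n)) (𝓡∂ n) ∞
      (extChartAt (𝓡∂ n) c).symm (range (𝓡∂ n)) z :=
    contMDiffWithinAt_extChartAt_symm_range c hz
  have h3 := h1.comp_contMDiffWithinAt z h2
  have key : ∀ y ∈ (extChartAt (𝓡∂ n) c).target,
      TotalSpace.mk' (EuclideanSpace ℝ (Fin n))
        (E := fun x : M => TangentSpace (𝓡∂ n) x)
        ((extChartAt (𝓡∂ n) c).symm y) (coordVector c i y)
      = ((fun x => TotalSpace.mk' (EuclideanSpace ℝ (Fin n)) x (e.localFrame b i x))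
        ∘ (extChartAt (𝓡∂ n) c).symm) y := by
    intro y hy
    have hs := (extChartAt (𝓡∂ n) c).map_target hy
    have hy' : (extChartAt (𝓡∂ n) c).symm y ∈ e.baseSet := by simpa [he] using hs
    have hsrc : (extChartAt (𝓡∂ n) c).symm y ∈ (chartAt (EuclideanHalfSpace n) c).source := by
      simpa using hs
    have h := TangentBundle.symmL_trivializationAt (I := 𝓡∂ n) (x₀ := c) hsrc
    rw [(extChartAt (𝓡∂ n) c).right_inv hy] at h
    simp only [Function.comp]
    rw [e.localFrame_apply_of_mem_baseSet b hy']
    congr 1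
    unfold coordVector
    rw [← h]
    rw [Trivialization.basisAt, Module.Basis.map_apply, OrthonormalBasis.coe_toBasis,
      EuclideanSpace.basisFun_apply]
    rw [Trivialization.linearEquivAt_symm_apply]
    exact Trivialization.symmL_apply (R := ℝ) e hy' (EuclideanSpace.single i 1)
  refine h3.congr_of_eventuallyEq ?_ (key z hz)
  filter_upwards [extChartAt_target_mem_nhdsWithin_of_mem hz] with y hy
  exact key y hy

theorem contDiffWithinAt_tensor_coordVector (c : M) (i j : Fin n) {z : EuclideanSpace ℝ (Fin n)}
    (hz : z ∈ (extChartAt (𝓡∂ n) c).target)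
    {χ : (x : M) → TangentSpace (𝓡∂ n) x →L[ℝ] TangentSpace (𝓡∂ n) x →L[ℝ] ℝ}
    (hχ : ContMDiff (𝓡∂ n)
      ((𝓡∂ n).prod 𝓘(ℝ, EuclideanSpace ℝ (Fin n) →L[ℝ] EuclideanSpace ℝ (Fin n) →L[ℝ] ℝ)) ∞
      (fun x => TotalSpace.mk'
        (EuclideanSpace ℝ (Fin n) →L[ℝ] EuclideanSpace ℝ (Fin n) →L[ℝ] ℝ) x (χ x))) :
    ContDiffWithinAt ℝ ∞ (fun y => χ ((extChartAt (𝓡∂ n) c).symm y)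
      (coordVector c i y) (coordVector c j y)) (range (𝓡∂ n)) z := by
  have h2 : ContMDiffWithinAt 𝓘(ℝ, EuclideanSpace ℝ (Fin n)) (𝓡∂ n) ∞
      (extChartAt (𝓡∂ n) c).symm (range (𝓡∂ n)) z :=
    contMDiffWithinAt_extChartAt_symm_range c hz
  have h3 := (hχ ((extChartAt (𝓡∂ n) c).symm z)).comp_contMDiffWithinAt z h2
  have h4 := ContMDiffWithinAt.clm_bundle_apply₂ (F₁ := EuclideanSpace ℝ (Fin n))
    (F₂ := EuclideanSpace ℝ (Fin n)) (F₃ := ℝ) (E₃ := Bundle.Trivial M ℝ) h3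
    (contMDiffWithinAt_coordVector c i hz) (contMDiffWithinAt_coordVector c j hz)
  simp only [contMDiffWithinAt_totalSpace] at h4
  exact h4.2.contDiffWithinAt

section Metric

variable [RiemannianBundle (fun x : M => TangentSpace (𝓡∂ n) x)]
  [IsContMDiffRiemannianBundle (𝓡∂ n) ∞ (EuclideanSpace ℝ (Fin n))
      (fun x : M => TangentSpace (𝓡∂ n) x)]

theorem contDiffWithinAt_metricMatrix (c : M) (i j : Fin n) {z : EuclideanSpace ℝ (Fin n)}
    (hz : z ∈ (extChartAt (𝓡∂ n) c).target) :
    ContDiffWithinAt ℝ ∞ (fun y => metricMatrix c y i j) (range (𝓡∂ n)) z :=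
  ((contMDiffWithinAt_coordVector c i hz).inner_bundle
    (contMDiffWithinAt_coordVector c j hz)).contDiffWithinAt

end Metric

end Smooth

theorem ContDiffWithinAt.coordDeriv {h : EuclideanSpace ℝ (Fin n) → ℝ}
    {z : EuclideanSpace ℝ (Fin n)} (hz : z ∈ range (𝓡∂ n))
    (hh : ContDiffWithinAt ℝ ∞ h (range (𝓡∂ n)) z) (i : Fin n) :
    ContDiffWithinAt ℝ ∞ (coordDeriv i h) (range (𝓡∂ n)) z := by
  have := hh.fderivWithin_right (m := ∞) (𝓡∂ n).uniqueDiffOn (by simp) hz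
  exact this.clm_apply contDiffWithinAt_const


section CoordVector

variable [IsManifold (𝓡∂ n) 1 M]

theorem coordComponent_sum_smul_coordVector (c : M) {z : EuclideanSpace ℝ (Fin n)}
    (hz : z ∈ (extChartAt (𝓡∂ n) c).target) (v : EuclideanSpace ℝ (Fin n)) (i : Fin n) :
    coordComponent c ((extChartAt (𝓡∂ n) c).symm z) i (∑ j, v j • coordVector c j z) = v i := by
  rw [← mfderivWithin_symm_apply]
  have := congrArg (fun L => L v) (mfderiv_extChartAt_comp_mfderivWithin_extChartAt_symm hz)
  exact congrArg (fun w : EuclideanSpace ℝ (Fin n) => w i) this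

theorem sum_coordComponent_smul_coordVector (c : M) {z : EuclideanSpace ℝ (Fin n)}
    (hz : z ∈ (extChartAt (𝓡∂ n) c).target)
    (v : TangentSpace (𝓡∂ n) ((extChartAt (𝓡∂ n) c).symm z)) :
    ∑ j, coordComponent c ((extChartAt (𝓡∂ n) c).symm z) j v • coordVector c j z = v := by
  have := congrArg (fun L => L v) (mfderivWithin_extChartAt_symm_comp_mfderiv_extChartAt hz)
  have h := mfderivWithin_symm_apply c z (mfderiv (𝓡∂ n) 𝓘(ℝ, EuclideanSpace ℝ (Fin n))
    (extChartAt (𝓡∂ n) c) ((extChartAt (𝓡∂ n) c).symm z) v)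
  exact h.symm.trans this

variable [RiemannianBundle (fun x : M => TangentSpace (𝓡∂ n) x)]

/-- The metric matrix is a Gram matrix of linearly independent vectors. -/
theorem det_metricMatrix_ne_zero (c : M) {z : EuclideanSpace ℝ (Fin n)}
    (hz : z ∈ (extChartAt (𝓡∂ n) c).target) : (metricMatrix c z).det ≠ 0 := by
  intro h
  obtain ⟨v, hv, hgv⟩ := Matrix.exists_mulVec_eq_zero_iff.2 h
  apply hv
  have h0 : (∑ i, v i • coordVector c i z) = 0 := by
    rw [← inner_self_eq_zero (𝕜 := ℝ)]
    have := inner_sum_smul_coordVector c z (WithLp.toLp 2 v) (WithLp.toLp 2 v)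
    refine this.trans (Finset.sum_eq_zero fun i _ => ?_)
    have hi := congrFun hgv i
    simp only [Matrix.mulVec, dotProduct, Pi.zero_apply] at hi
    rw [← mul_zero (v i), ← hi, Finset.mul_sum]
    exact Finset.sum_congr rfl fun j _ => by simp; ring
  funext i
  have := coordComponent_sum_smul_coordVector c hz (WithLp.toLp 2 v) i
  rw [show (WithLp.toLp 2 v).ofLp = v from rfl, h0] at this
  rw [← this]
  exact congrArg (fun w : EuclideanSpace ℝ (Fin n) => w i) (map_zero
    (mfderiv (𝓡∂ n) 𝓘(ℝ, EuclideanSpace ℝ (Fin n)) (extChartAt (𝓡∂ n) c) _))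

end CoordVector
end Coordinates

/-! ### The metric and the Christoffel symbols in a chart -/

section CoordinateForms

variable {n : ℕ} [NeZero n] {M : Type*} [TopologicalSpace M]
  [ChartedSpace (EuclideanHalfSpace n) M]

/-- The tensor `χ` in the chart at `c`, as a bilinear form on the coordinate space. -/
def tensorForm (c : M) (χ : (x : M) → TangentSpace (𝓡∂ n) x →L[ℝ] TangentSpace (𝓡∂ n) x →L[ℝ] ℝ)
    (z : EuclideanSpace ℝ (Fin n)) :
    EuclideanSpace ℝ (Fin n) →L[ℝ] EuclideanSpace ℝ (Fin n) →L[ℝ] ℝ :=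
  bilinOfCoeff fun i j => χ ((extChartAt (𝓡∂ n) c).symm z) (coordVector c i z) (coordVector c j z)

theorem contDiffWithinAt_tensorForm [IsManifold (𝓡∂ n) ∞ M] (c : M) {z : EuclideanSpace ℝ (Fin n)}
    (hz : z ∈ (extChartAt (𝓡∂ n) c).target)
    {χ : (x : M) → TangentSpace (𝓡∂ n) x →L[ℝ] TangentSpace (𝓡∂ n) x →L[ℝ] ℝ}
    (hχ : ContMDiff (𝓡∂ n)
      ((𝓡∂ n).prod 𝓘(ℝ, EuclideanSpace ℝ (Fin n) →L[ℝ] EuclideanSpace ℝ (Fin n) →L[ℝ] ℝ)) ∞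
      (fun x => TotalSpace.mk'
        (EuclideanSpace ℝ (Fin n) →L[ℝ] EuclideanSpace ℝ (Fin n) →L[ℝ] ℝ) x (χ x))) :
    ContDiffWithinAt ℝ ∞ (tensorForm c χ) (range (𝓡∂ n)) z :=
  contDiffWithinAt_bilinOfCoeff fun i j => contDiffWithinAt_tensor_coordVector c i j hz hχ

variable [RiemannianBundle (fun x : M => TangentSpace (𝓡∂ n) x)]

/-- The metric in the chart at `c`, as a bilinear form on the coordinate space. -/
def metricForm (c : M) (z : EuclideanSpace ℝ (Fin n)) :
    EuclideanSpace ℝ (Fin n) →L[ℝ] EuclideanSpace ℝ (Fin n) →L[ℝ] ℝ :=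
  bilinOfCoeff fun i j => metricMatrix c z i j

/-- The Christoffel symbols in the chart at `c`, as a vector-valued bilinear map on the coordinate
space. -/
def christoffelForm (c : M) (z : EuclideanSpace ℝ (Fin n)) :
    EuclideanSpace ℝ (Fin n) →L[ℝ] EuclideanSpace ℝ (Fin n) →L[ℝ] EuclideanSpace ℝ (Fin n) :=
  bilinOfCoeff fun i j => WithLp.toLp 2 fun k => christoffel c k i j z

theorem metricForm_apply (c : M) (z v w : EuclideanSpace ℝ (Fin n)) :
    metricForm c z v w
      = inner ℝ (∑ i, v i • coordVector c i z) (∑ i, w i • coordVector c i z) := by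
  rw [inner_sum_smul_coordVector, metricForm, bilinOfCoeff_apply]
  simp [mul_assoc]

theorem metricForm_nonneg (c : M) (z v : EuclideanSpace ℝ (Fin n)) : 0 ≤ metricForm c z v v := by
  rw [metricForm_apply]
  exact real_inner_self_nonneg

theorem metricForm_symm (c : M) (z v w : EuclideanSpace ℝ (Fin n)) :
    metricForm c z v w = metricForm c z w v := by
  rw [metricForm_apply, metricForm_apply]
  exact real_inner_comm _ _

theorem christoffelForm_apply (c : M) (z v w : EuclideanSpace ℝ (Fin n)) (k : Fin n) :
    christoffelForm c z v w k = ∑ i, ∑ j, v i * w j * christoffel c k i j z := by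
  simp [christoffelForm, bilinOfCoeff_apply, mul_assoc]

theorem christoffel_symm (c : M) (k i j : Fin n) (z : EuclideanSpace ℝ (Fin n)) :
    christoffel c k i j z = christoffel c k j i z := by
  unfold christoffel
  congr 1
  refine Finset.sum_congr rfl fun l _ => ?_
  rw [show (fun y => metricMatrix c y i j) = fun y => metricMatrix c y j i from
    funext fun y => metricMatrix_symm c y i j]
  ring

theorem christoffelForm_symm (c : M) (z v w : EuclideanSpace ℝ (Fin n)) :
    christoffelForm c z v w = christoffelForm c z w v := by
  ext k
  rw [christoffelForm_apply, christoffelForm_apply, Finset.sum_comm]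
  refine Finset.sum_congr rfl fun i _ => Finset.sum_congr rfl fun j _ => ?_
  rw [christoffel_symm]
  ring

theorem fderiv_eq_sum_coordDeriv {h : EuclideanSpace ℝ (Fin n) → ℝ} {z : EuclideanSpace ℝ (Fin n)}
    (hz : range (𝓡∂ n) ∈ 𝓝 z) (v : EuclideanSpace ℝ (Fin n)) :
    fderiv ℝ h z v = ∑ i, v i * coordDeriv i h z := by
  rw [ContinuousLinearMap.apply_eq_sum_single]
  simp only [coordDeriv, fderivWithin_of_mem_nhds hz, smul_eq_mul]

theorem metricForm_christoffelForm (c : M) (z l v w : EuclideanSpace ℝ (Fin n)) :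
    metricForm c z (christoffelForm c z l v) w
      = ∑ i, ∑ j, v i * w j * ∑ m, l m * ∑ k, christoffel c k m i z * metricMatrix c z k j := by
  simp only [metricForm, bilinOfCoeff_apply, smul_eq_mul, christoffelForm_apply, Finset.mul_sum,
    Finset.sum_mul]
  calc _ = ∑ k, ∑ i, ∑ j, ∑ m,
        l m * v i * christoffel c k m i z * (w j * metricMatrix c z k j) := by
        exact Finset.sum_congr rfl fun k _ =>
          (Finset.sum_congr rfl fun j _ => Finset.sum_comm).trans Finset.sum_comm
    _ = ∑ i, ∑ j, ∑ m, ∑ k, l m * v i * christoffel c k m i z * (w j * metricMatrix c z k j) := by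
        rw [Finset.sum_comm]
        refine Finset.sum_congr rfl fun i _ => ?_
        rw [Finset.sum_comm]
        exact Finset.sum_congr rfl fun j _ => Finset.sum_comm
    _ = _ := Finset.sum_congr rfl fun i _ => Finset.sum_congr rfl fun j _ =>
        Finset.sum_congr rfl fun m _ => Finset.sum_congr rfl fun k _ => by ring

section OneSmooth
variable [IsManifold (𝓡∂ n) 1 M]

theorem metricForm_pos (c : M) {z : EuclideanSpace ℝ (Fin n)}
    (hz : z ∈ (extChartAt (𝓡∂ n) c).target) {v : EuclideanSpace ℝ (Fin n)} (hv : v ≠ 0) :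
    0 < metricForm c z v v := by
  refine lt_of_le_of_ne (metricForm_nonneg c z v) fun h => hv ?_
  rw [metricForm_apply] at h
  have h0 := inner_self_eq_zero.1 h.symm
  ext i
  rw [← coordComponent_sum_smul_coordVector c hz v i, h0]
  exact congrArg (fun w : EuclideanSpace ℝ (Fin n) => w i) (map_zero
    (mfderiv (𝓡∂ n) 𝓘(ℝ, EuclideanSpace ℝ (Fin n)) (extChartAt (𝓡∂ n) c) _))

/-- Lowering the upper index of the Christoffel symbols gives those of the first kind. -/
theorem sum_christoffel_mul_metricMatrix (c : M) {z : EuclideanSpace ℝ (Fin n)}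
    (hz : z ∈ (extChartAt (𝓡∂ n) c).target) (i j m : Fin n) :
    ∑ k, christoffel c k i j z * metricMatrix c z k m = 2⁻¹ *
      (coordDeriv i (fun y => metricMatrix c y j m) z
      + coordDeriv j (fun y => metricMatrix c y i m) z
      - coordDeriv m (fun y => metricMatrix c y i j) z) := by
  have hinv : metricMatrix c z * (metricMatrix c z)⁻¹ = 1 :=
    Matrix.mul_nonsing_inv _ (det_metricMatrix_ne_zero c hz).isUnit
  set D : Fin n → ℝ := fun l => coordDeriv i (fun y => metricMatrix c y j l) z
      + coordDeriv j (fun y => metricMatrix c y i l) z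
      - coordDeriv l (fun y => metricMatrix c y i j) z with hD
  have h1 : (metricMatrix c z).mulVec ((metricMatrix c z)⁻¹.mulVec D) = D := by
    rw [Matrix.mulVec_mulVec, hinv, Matrix.one_mulVec]
  have h2 := congrFun h1 m
  simp only [Matrix.mulVec, dotProduct] at h2
  rw [show 2⁻¹ * (coordDeriv i (fun y => metricMatrix c y j m) z
      + coordDeriv j (fun y => metricMatrix c y i m) z
      - coordDeriv m (fun y => metricMatrix c y i j) z) = 2⁻¹ * D m from rfl, ← h2,
    Finset.mul_sum]
  refine Finset.sum_congr rfl fun k _ => ?_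
  rw [metricMatrix_symm c z k m, christoffel]
  ring

theorem coordDeriv_metricMatrix (c : M) {z : EuclideanSpace ℝ (Fin n)}
    (hz : z ∈ (extChartAt (𝓡∂ n) c).target) (l i j : Fin n) :
    coordDeriv l (fun y => metricMatrix c y i j) z
      = ∑ k, christoffel c k l i z * metricMatrix c z k j
        + ∑ k, christoffel c k l j z * metricMatrix c z k i := by
  rw [sum_christoffel_mul_metricMatrix c hz, sum_christoffel_mul_metricMatrix c hz,
    show (fun y => metricMatrix c y j i) = fun y => metricMatrix c y i j from
    funext fun y => metricMatrix_symm c y j i]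
  ring

end OneSmooth

section Smooth

variable [IsManifold (𝓡∂ n) ∞ M]
  [IsContMDiffRiemannianBundle (𝓡∂ n) ∞ (EuclideanSpace ℝ (Fin n))
      (fun x : M => TangentSpace (𝓡∂ n) x)]

theorem contDiffWithinAt_metricForm (c : M) {z : EuclideanSpace ℝ (Fin n)}
    (hz : z ∈ (extChartAt (𝓡∂ n) c).target) :
    ContDiffWithinAt ℝ ∞ (metricForm c) (range (𝓡∂ n)) z :=
  contDiffWithinAt_bilinOfCoeff fun i j => contDiffWithinAt_metricMatrix c i j hz

theorem contDiffWithinAt_christoffelForm (c : M) {z : EuclideanSpace ℝ (Fin n)}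
    (hz : z ∈ (extChartAt (𝓡∂ n) c).target) :
    ContDiffWithinAt ℝ ∞ (christoffelForm c) (range (𝓡∂ n)) z := by
  have : IsManifold (𝓡∂ n) 1 M := IsManifold.of_le (n := ∞) ENat.LEInfty.out
  have hr := extChartAt_target_subset_range c hz
  refine contDiffWithinAt_bilinOfCoeff fun i j => (contDiffWithinAt_euclidean.2 fun k => ?_)
  refine contDiffWithinAt_const.mul (ContDiffWithinAt.sum fun l _ => ContDiffWithinAt.mul ?_ ?_)
  · exact contDiffWithinAt_matrix_inv (fun i j => contDiffWithinAt_metricMatrix c i j hz)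
      (det_metricMatrix_ne_zero c hz) k l
  · exact (((contDiffWithinAt_metricMatrix c j l hz).coordDeriv hr i).add
      ((contDiffWithinAt_metricMatrix c i l hz).coordDeriv hr j)).sub
      ((contDiffWithinAt_metricMatrix c i j hz).coordDeriv hr l)

/-- The Levi-Civita connection is compatible with the metric. -/
theorem fderiv_metricForm (c : M) {z : EuclideanSpace ℝ (Fin n)}
    (hz : z ∈ (extChartAt (𝓡∂ n) c).target) (hr : range (𝓡∂ n) ∈ 𝓝 z)
    (l v w : EuclideanSpace ℝ (Fin n)) :
    fderiv ℝ (metricForm c) z l v w = metricForm c z (christoffelForm c z l v) w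
      + metricForm c z v (christoffelForm c z l w) := by
  have : IsManifold (𝓡∂ n) 1 M := IsManifold.of_le (n := ∞) ENat.LEInfty.out
  have hG : DifferentiableAt ℝ (metricForm c) z :=
    ((contDiffWithinAt_metricForm c hz).contDiffAt hr).differentiableAt (by simp)
  have hz0 : z + (0 : ℝ) • l = z := by simp
  have d1 := hasDerivAt_bilinear_line (y := l) (s₀ := 0) (hz0.symm ▸ hG) v 0 w 0
  simp only [zero_smul, add_zero, smul_zero, map_zero, zero_apply] at d1
  have d2 : HasDerivAt (fun s : ℝ => ∑ i, ∑ j, v i * w j * metricMatrix c (z + s • l) i j)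
      (∑ i, ∑ j, v i * w j * fderiv ℝ (fun y => metricMatrix c y i j) z l) 0 := by
    refine HasDerivAt.fun_sum fun i _ => HasDerivAt.fun_sum fun j _ => HasDerivAt.const_mul _ ?_
    exact DifferentiableAt.hasDerivAt_line_zero
      (((contDiffWithinAt_metricMatrix c i j hz).contDiffAt hr).differentiableAt (by simp)) l
  have e : (fun s : ℝ => metricForm c (z + s • l) v w)
      = fun s : ℝ => ∑ i, ∑ j, v i * w j * metricMatrix c (z + s • l) i j := by
    funext s
    simp [metricForm, bilinOfCoeff_apply, mul_assoc]
  rw [e] at d1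
  rw [d1.unique d2]
  simp only [fderiv_eq_sum_coordDeriv hr, coordDeriv_metricMatrix c hz]
  rw [metricForm_symm c z v, metricForm_christoffelForm, metricForm_christoffelForm,
    Finset.sum_comm (f := fun i j => w i * v j * _)]
  simp only [mul_add, Finset.sum_add_distrib]
  congr 1
  exact Finset.sum_congr rfl fun i _ => Finset.sum_congr rfl fun j _ => by rw [mul_comm (v i)]

/-- The metric is uniformly positive definite over compact sets: its minimum over `K` times the unit
sphere is positive. -/
theorem exists_norm_sq_le_metricForm (c : M) {K : Set (EuclideanSpace ℝ (Fin n))}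
    (hK : IsCompact K) (hKt : K ⊆ (extChartAt (𝓡∂ n) c).target) :
    ∃ C : ℝ, ∀ z ∈ K, ∀ v, ‖v‖ ^ 2 ≤ C * metricForm c z v v := by
  have : IsManifold (𝓡∂ n) 1 M := IsManifold.of_le (n := ∞) ENat.LEInfty.out
  have hcG : ContinuousOn (metricForm c) K := fun z hz =>
    (contDiffWithinAt_metricForm c (hKt hz)).continuousWithinAt.mono
      (hKt.trans (extChartAt_target_subset_range c))
  have hc : ContinuousOn (fun p : EuclideanSpace ℝ (Fin n) × EuclideanSpace ℝ (Fin n) =>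
      (metricForm c p.1 p.2 p.2)⁻¹) (K ×ˢ Metric.sphere 0 1) := by
    refine ContinuousOn.inv₀ ?_ fun p hp => (metricForm_pos c (hKt hp.1) ?_).ne'
    · exact ((hcG.comp continuousOn_fst fun p hp => hp.1).clm_apply continuousOn_snd).clm_apply
        continuousOn_snd
    · rintro h
      have := hp.2
      simp [h] at this
  obtain ⟨C, hC⟩ := (hK.prod (isCompact_sphere 0 1)).exists_bound_of_continuousOn hc
  refine ⟨C, fun z hz v => ?_⟩
  rcases eq_or_ne v 0 with rfl | hv
  · simp
  have hv' : ‖v‖ ≠ 0 := norm_ne_zero_iff.2 hv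
  have h1 := hC (z, ‖v‖⁻¹ • v) ⟨hz, by simp [norm_smul, hv']⟩
  have hp := metricForm_pos c (hKt hz) hv
  simp only [map_smul, smul_apply, smul_eq_mul, mul_inv_rev, inv_inv, norm_mul, norm_inv,
    norm_norm, Real.norm_of_nonneg hp.le] at h1
  have h2 := mul_le_mul_of_nonneg_right h1 hp.le
  calc ‖v‖ ^ 2 = (metricForm c z v v)⁻¹ * ‖v‖ * ‖v‖ * metricForm c z v v := by
        field_simp
    _ ≤ _ := h2

/-- Over a compact part of a coordinate domain, all the bounds on the geometry hold with one
constant. -/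
theorem exists_geometryBound (c : M) {K : Set (EuclideanSpace ℝ (Fin n))}
    (hK : IsCompact K) (hKt : K ⊆ (extChartAt (𝓡∂ n) c).target)
    {χ : (x : M) → TangentSpace (𝓡∂ n) x →L[ℝ] TangentSpace (𝓡∂ n) x →L[ℝ] ℝ}
    (hχ : ContMDiff (𝓡∂ n)
      ((𝓡∂ n).prod 𝓘(ℝ, EuclideanSpace ℝ (Fin n) →L[ℝ] EuclideanSpace ℝ (Fin n) →L[ℝ] ℝ)) ∞
      (fun x => TotalSpace.mk'
        (EuclideanSpace ℝ (Fin n) →L[ℝ] EuclideanSpace ℝ (Fin n) →L[ℝ] ℝ) x (χ x))) :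
    ∃ R₀ : ℝ, ∀ R, R₀ ≤ R → ∀ z ∈ K, range (𝓡∂ n) ∈ 𝓝 z →
      GeometryBound R (metricForm c) (christoffelForm c) (tensorForm c χ) z := by
  have hs := (𝓡∂ n).uniqueDiffOn
  have hts := extChartAt_target_subset_range (I := 𝓡∂ n) c
  obtain ⟨C₁, hC₁, h₁⟩ := exists_fderiv_bound_of_contDiffWithinAt
    (V := EuclideanSpace ℝ (Fin n) →L[ℝ] EuclideanSpace ℝ (Fin n) →L[ℝ] ℝ) hs hts hK hKt
    fun z hz => contDiffWithinAt_metricForm c hz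
  obtain ⟨C₂, hC₂, h₂⟩ := exists_fderiv_bound_of_contDiffWithinAt
    (V := EuclideanSpace ℝ (Fin n) →L[ℝ] EuclideanSpace ℝ (Fin n) →L[ℝ]
      EuclideanSpace ℝ (Fin n)) hs hts hK hKt
    fun z hz => contDiffWithinAt_christoffelForm c hz
  obtain ⟨C₃, hC₃, h₃⟩ := exists_fderiv_bound_of_contDiffWithinAt
    (V := EuclideanSpace ℝ (Fin n) →L[ℝ] EuclideanSpace ℝ (Fin n) →L[ℝ] ℝ) hs hts hK hKt
    fun z hz => contDiffWithinAt_tensorForm c hz hχ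
  obtain ⟨C₄, h₄⟩ := exists_norm_sq_le_metricForm c hK hKt
  refine ⟨max 1 (max (max C₁ C₂) (max C₃ C₄)), fun R hR z hz hrz => ?_⟩
  simp only [max_le_iff] at hR
  obtain ⟨hR1, ⟨hR₁, hR₂⟩, hR₃, hR₄⟩ := hR
  obtain ⟨a1, a2, a3, a4⟩ := h₁ z hz hrz
  obtain ⟨b1, b2, b3, -⟩ := h₂ z hz hrz
  obtain ⟨c1, c2, c3, -⟩ := h₃ z hz hrz
  have hop : ∀ (F : EuclideanSpace ℝ (Fin n) →L[ℝ] EuclideanSpace ℝ (Fin n) →L[ℝ] ℝ)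
      (r : ℝ) (_ : ‖F‖ ≤ r) (v w), |F v w| ≤ r * ‖v‖ * ‖w‖ := fun F r hr v w =>
    (ContinuousLinearMap.le_opNorm₂ F v w).trans (by gcongr)
  exact
    { one_le := hR1
      contDiffAt_metric := a1
      differentiableAt_christoffel := b1.differentiableAt (by norm_num)
      differentiableAt_tensor := c1.differentiableAt (by norm_num)
      metric_nonneg := metricForm_nonneg c
      metric_symm := metricForm_symm c z
      christoffel_symm := christoffelForm_symm c z
      compatible := fderiv_metricForm c (hKt hz) hrz
      coercive := fun v => (h₄ z hz v).trans (by gcongr; exact metricForm_nonneg c z v)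
      metric_le := hop _ R (by linarith)
      fderiv_metric_le := fun l => hop _ (R * ‖l‖) ((a3 l).trans (by gcongr))
      fderiv_fderiv_metric_le := fun l => hop _ (R * ‖l‖ * ‖l‖) ((a4 l).trans (by gcongr))
      christoffel_le := fun v w => (ContinuousLinearMap.le_opNorm₂ _ v w).trans
        (by gcongr; linarith)
      fderiv_christoffel_le := fun l v w => (ContinuousLinearMap.le_opNorm₂ _ v w).trans
        (by gcongr; exact (b3 l).trans (by gcongr))
      tensor_le := hop _ R (by linarith)
      fderiv_tensor_le := fun l => hop _ (R * ‖l‖) ((c3 l).trans (by gcongr)) }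

end Smooth

end CoordinateForms

/-! ### The Hessian and the gradient in a chart -/

theorem DifferentiableAt.clm_apply₂_const {E V : Type*} [NormedAddCommGroup E] [NormedSpace ℝ E]
    [NormedAddCommGroup V] [NormedSpace ℝ V] {F : E → E →L[ℝ] E →L[ℝ] V} {z : E}
    (hF : DifferentiableAt ℝ F z) (v w : E) : DifferentiableAt ℝ (fun y => F y v w) z :=
  (hF.clm_apply (differentiableAt_const v)).clm_apply (differentiableAt_const w)

theorem norm_eq_of_forall_norm_apply_eq {F F' : Type*} [NormedAddCommGroup F]
    [InnerProductSpace ℝ F] [NormedAddCommGroup F'] [NormedSpace ℝ F'] {L : F →L[ℝ] F'} {V : F}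
    (h : ∀ W, ‖L W‖ = ‖inner ℝ V W‖) : ‖L‖ = ‖V‖ := by
  rw [← innerSL_apply_norm (𝕜 := ℝ) V]
  refine le_antisymm ?_ ?_
  · refine ContinuousLinearMap.opNorm_le_bound _ (norm_nonneg _) fun W => ?_
    rw [h]
    exact ContinuousLinearMap.le_opNorm (innerSL ℝ V) W
  · refine ContinuousLinearMap.opNorm_le_bound _ (norm_nonneg _) fun W => ?_
    rw [innerSL_apply_apply, ← h]
    exact L.le_opNorm W

section Bridge

variable {n : ℕ}

theorem bilinOfCoeff_single {V : Type*} [NormedAddCommGroup V] [NormedSpace ℝ V]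
    (F : EuclideanSpace ℝ (Fin n) →L[ℝ] EuclideanSpace ℝ (Fin n) →L[ℝ] V)
    (v w : EuclideanSpace ℝ (Fin n)) :
    ∑ i, ∑ j, v i • w j • F (EuclideanSpace.single i 1) (EuclideanSpace.single j 1) = F v w := by
  rw [ContinuousLinearMap.apply_eq_sum_single F v, sum_apply]
  refine Finset.sum_congr rfl fun i _ => ?_
  rw [smul_apply, ContinuousLinearMap.apply_eq_sum_single _ w, Finset.smul_sum]

/-- The bilinear form `D²u - Du ∘ Ch + X`: with `Ch` the Christoffel symbols, the Hessian of `u`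
plus the tensor `X`. -/
def hessianAddForm (u : EuclideanSpace ℝ (Fin n) → ℝ)
    (Ch : EuclideanSpace ℝ (Fin n) → EuclideanSpace ℝ (Fin n) →L[ℝ]
      EuclideanSpace ℝ (Fin n) →L[ℝ] EuclideanSpace ℝ (Fin n))
    (X : EuclideanSpace ℝ (Fin n) → EuclideanSpace ℝ (Fin n) →L[ℝ]
      EuclideanSpace ℝ (Fin n) →L[ℝ] ℝ) (z : EuclideanSpace ℝ (Fin n)) :
    EuclideanSpace ℝ (Fin n) →L[ℝ] EuclideanSpace ℝ (Fin n) →L[ℝ] ℝ :=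
  bilinOfCoeff fun i j =>
    fderiv ℝ (fderiv ℝ u) z (EuclideanSpace.single i 1) (EuclideanSpace.single j 1)
    - fderiv ℝ u z (Ch z (EuclideanSpace.single i 1) (EuclideanSpace.single j 1))
    + X z (EuclideanSpace.single i 1) (EuclideanSpace.single j 1)

variable {u : EuclideanSpace ℝ (Fin n) → ℝ}
    {Ch : EuclideanSpace ℝ (Fin n) → EuclideanSpace ℝ (Fin n) →L[ℝ]
      EuclideanSpace ℝ (Fin n) →L[ℝ] EuclideanSpace ℝ (Fin n)}
    {X : EuclideanSpace ℝ (Fin n) → EuclideanSpace ℝ (Fin n) →L[ℝ]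
      EuclideanSpace ℝ (Fin n) →L[ℝ] ℝ}

theorem hessianAddForm_apply (z v w : EuclideanSpace ℝ (Fin n)) :
    hessianAddForm u Ch X z v w
      = fderiv ℝ (fderiv ℝ u) z v w - fderiv ℝ u z (Ch z v w) + X z v w := by
  rw [hessianAddForm, bilinOfCoeff_apply]
  simp only [smul_add, smul_sub, Finset.sum_add_distrib, Finset.sum_sub_distrib]
  rw [bilinOfCoeff_single, bilinOfCoeff_single (X z), ← bilinOfCoeff_single (Ch z)]
  simp only [map_sum, map_smul]

set_option synthInstance.maxHeartbeats 400000 in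
theorem differentiableAt_hessianAddForm {z : EuclideanSpace ℝ (Fin n)} (hu : ContDiffAt ℝ 3 u z)
    (hCh : DifferentiableAt ℝ Ch z) (hX : DifferentiableAt ℝ X z) :
    DifferentiableAt ℝ (hessianAddForm u Ch X) z := by
  have hu1 : ContDiffAt ℝ 2 (fderiv ℝ u) z := hu.fderiv_right (by norm_num)
  have hu2 : ContDiffAt ℝ 1 (fderiv ℝ (fderiv ℝ u)) z :=
    ContDiffAt.fderiv_right (F := EuclideanSpace ℝ (Fin n) →L[ℝ] ℝ) (m := 1) hu1 (by norm_num)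
  refine differentiableAt_bilinOfCoeff fun i j => ?_
  exact (((hu2.differentiableAt (by norm_num)).clm_apply₂_const _ _).sub
    ((hu1.differentiableAt (by norm_num)).clm_apply (hCh.clm_apply₂_const _ _))).add
    (hX.clm_apply₂_const _ _)

variable [NeZero n] {M : Type*} [TopologicalSpace M]
  [ChartedSpace (EuclideanHalfSpace n) M]

theorem coordDeriv_eq_fderiv {h : EuclideanSpace ℝ (Fin n) → ℝ} {z : EuclideanSpace ℝ (Fin n)}
    (hz : range (𝓡∂ n) ∈ 𝓝 z) (i : Fin n) :
    coordDeriv i h z = fderiv ℝ h z (EuclideanSpace.single i 1) := by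
  rw [coordDeriv, fderivWithin_of_mem_nhds hz]

theorem coordDeriv_coordDeriv {h : EuclideanSpace ℝ (Fin n) → ℝ} {z : EuclideanSpace ℝ (Fin n)}
    (hz : range (𝓡∂ n) ∈ 𝓝 z) (hh : ContDiffAt ℝ 2 h z) (i j : Fin n) :
    coordDeriv i (coordDeriv j h) z
      = fderiv ℝ (fderiv ℝ h) z (EuclideanSpace.single i 1) (EuclideanSpace.single j 1) := by
  have e : coordDeriv j h =ᶠ[𝓝 z] fun y => fderiv ℝ h y (EuclideanSpace.single j 1) := by
    filter_upwards [eventually_mem_nhds_iff.2 hz] with y hy using coordDeriv_eq_fderiv hy j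
  have hd : DifferentiableAt ℝ (fderiv ℝ h) z :=
    (hh.fderiv_right (m := 1) (by norm_num)).differentiableAt (by norm_num)
  rw [coordDeriv_eq_fderiv hz, e.fderiv_eq,
    (hd.hasFDerivAt.clm_apply (hasFDerivAt_const (EuclideanSpace.single j (1 : ℝ)) z)).fderiv]
  simp

theorem mfderiv_sum_smul_coordVector [IsManifold (𝓡∂ n) 1 M] {c : M} {h : M → ℝ}
    {z : EuclideanSpace ℝ (Fin n)}
    (hzt : z ∈ (extChartAt (𝓡∂ n) c).target)
    (hh : MDifferentiableAt (𝓡∂ n) 𝓘(ℝ, ℝ) h ((extChartAt (𝓡∂ n) c).symm z))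
    (w : EuclideanSpace ℝ (Fin n)) :
    mfderiv (𝓡∂ n) 𝓘(ℝ, ℝ) h ((extChartAt (𝓡∂ n) c).symm z) (∑ i, w i • coordVector c i z)
      = ∑ j, w j * coordDeriv j (inChart c h) z := by
  have h1 := hh.hasMFDerivAt.comp_hasMFDerivWithinAt z
    (mdifferentiableWithinAt_extChartAt_symm hzt).hasMFDerivWithinAt
  have hr := extChartAt_target_subset_range c hzt
  have h2 := h1.mfderivWithin ((𝓡∂ n).uniqueMDiffOn z hr)
  rw [mfderivWithin_eq_fderivWithin] at h2
  have h3 := congrArg (fun L : EuclideanSpace ℝ (Fin n) →L[ℝ] ℝ => L w) h2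
  rw [← mfderivWithin_symm_apply]
  refine h3.symm.trans ?_
  exact ContinuousLinearMap.apply_eq_sum_single _ w

theorem tensorForm_apply (c : M)
    (χ : (x : M) → TangentSpace (𝓡∂ n) x →L[ℝ] TangentSpace (𝓡∂ n) x →L[ℝ] ℝ)
    (z v w : EuclideanSpace ℝ (Fin n)) :
    tensorForm c χ z v w = χ ((extChartAt (𝓡∂ n) c).symm z)
      (∑ i, v i • coordVector c i z) (∑ i, w i • coordVector c i z) := by
  simp only [tensorForm, bilinOfCoeff_apply, map_sum, map_smul, sum_apply, smul_apply]
  rw [Finset.sum_comm]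
  refine Finset.sum_congr rfl fun i _ => ?_
  rw [Finset.smul_sum]
  exact Finset.sum_congr rfl fun j _ => smul_comm _ _ _

variable [RiemannianBundle (fun x : M => TangentSpace (𝓡∂ n) x)]

theorem hessianMatrix_eq {c : M} {h : M → ℝ} {z : EuclideanSpace ℝ (Fin n)}
    (hz : range (𝓡∂ n) ∈ 𝓝 z) (hh : ContDiffAt ℝ 2 (inChart c h) z) (i j : Fin n) :
    hessianMatrix c h z i j
      = fderiv ℝ (fderiv ℝ (inChart c h)) z (EuclideanSpace.single i 1) (EuclideanSpace.single j 1)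
        - fderiv ℝ (inChart c h) z
          (christoffelForm c z (EuclideanSpace.single i 1) (EuclideanSpace.single j 1)) := by
  rw [hessianMatrix, Matrix.of_apply, coordDeriv_coordDeriv hz hh, fderiv_eq_sum_coordDeriv hz]
  congr 1
  refine Finset.sum_congr rfl fun k _ => ?_
  rw [christoffelForm_apply]
  simp [PiLp.single_apply]

variable [IsManifold (𝓡∂ n) 1 M]

/-- Eigenvalues of `∇²h + χ` with respect to the metric, read in coordinates. -/
theorem IsEigenvalueTuple.exists_isEigenbasis {c : M} {h : M → ℝ} {z : EuclideanSpace ℝ (Fin n)}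
    (hzt : z ∈ (extChartAt (𝓡∂ n) c).target)
    (hz : range (𝓡∂ n) ∈ 𝓝 z) (hh : ContDiffAt ℝ 2 (inChart c h) z)
    {χ : (x : M) → TangentSpace (𝓡∂ n) x →L[ℝ] TangentSpace (𝓡∂ n) x →L[ℝ] ℝ}
    {lam : Fin n → ℝ} {x : M} (hx : x = (extChartAt (𝓡∂ n) c).symm z)
    (hlam : IsEigenvalueTuple x (fun v w => hessian c h x v w + χ x v w) lam) :
    ∃ ε, IsEigenbasis (metricForm c z)
      (hessianAddForm (inChart c h) (christoffelForm c) (tensorForm c χ) z) ε lam := by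
  subst hx
  set x := (extChartAt (𝓡∂ n) c).symm z with hx
  obtain ⟨e, he⟩ := hlam
  have hxz : extChartAt (𝓡∂ n) c x = z := (extChartAt (𝓡∂ n) c).right_inv hzt
  let ε : Fin n → EuclideanSpace ℝ (Fin n) := fun a =>
    WithLp.toLp 2 fun i => coordComponent c x i (e a)
  have hε : ∀ a, ∑ i, ε a i • coordVector c i z = e a := fun a =>
    sum_coordComponent_smul_coordVector c hzt (e a)
  refine ⟨ε, ⟨fun a b => ?_, fun v => ?_, fun a b => ?_⟩⟩
  · rw [metricForm_apply, hε, hε]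
    exact orthonormal_iff_ite.1 e.orthonormal a b
  · have h1 : ∑ i, (∑ a, metricForm c z v (ε a) • ε a) i • coordVector c i z
        = ∑ i, v i • coordVector c i z := by
      rw [← e.sum_repr' (∑ i, v i • coordVector c i z)]
      have h2 : ∀ i, (∑ a, metricForm c z v (ε a) • ε a) i
          = ∑ a, metricForm c z v (ε a) * ε a i := fun i => by simp
      simp only [h2, Finset.sum_smul, mul_smul]
      rw [Finset.sum_comm]
      simp only [← Finset.smul_sum, hε, metricForm_apply]
      exact Finset.sum_congr rfl fun a _ => by rw [real_inner_comm]
    ext i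
    rw [← coordComponent_sum_smul_coordVector c hzt v i, ← h1,
      coordComponent_sum_smul_coordVector c hzt]
  · have h1 : hessian c h x (e a) (e b) + χ x (e a) (e b) = if a = b then lam a else 0 := he a b
    rw [← h1, hessianAddForm_apply]
    congr 1
    · rw [← bilinOfCoeff_single (fderiv ℝ (fderiv ℝ (inChart c h)) z),
        ← bilinOfCoeff_single (christoffelForm c z)]
      simp only [hessian, hxz, hessianMatrix_eq hz hh, map_sum, map_smul,
        ← Finset.sum_sub_distrib, ← smul_sub]
      exact Finset.sum_congr rfl fun i _ => Finset.sum_congr rfl fun j _ => by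
        simp only [smul_eq_mul, ε]; ring
    · rw [tensorForm_apply]
      exact congrArg₂ (fun v w => χ x v w) (hε a) (hε b)

/-- The gradient of `h`, in coordinates. -/
def coordGradient (c : M) (h : M → ℝ) (z : EuclideanSpace ℝ (Fin n)) : EuclideanSpace ℝ (Fin n) :=
  WithLp.toLp 2 ((metricMatrix c z)⁻¹.mulVec fun j => coordDeriv j (inChart c h) z)

theorem metricForm_coordGradient {c : M} {h : M → ℝ} {z : EuclideanSpace ℝ (Fin n)}
    (hzt : z ∈ (extChartAt (𝓡∂ n) c).target) (w : EuclideanSpace ℝ (Fin n)) :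
    metricForm c z (coordGradient c h z) w = ∑ j, w j * coordDeriv j (inChart c h) z := by
  have hinv : metricMatrix c z * (metricMatrix c z)⁻¹ = 1 :=
    Matrix.mul_nonsing_inv _ (det_metricMatrix_ne_zero c hzt).isUnit
  have h1 : (metricMatrix c z).mulVec (coordGradient c h z)
      = fun j => coordDeriv j (inChart c h) z := by
    simp [coordGradient, Matrix.mulVec_mulVec, hinv]
  rw [metricForm_symm, metricForm, bilinOfCoeff_apply]
  refine Finset.sum_congr rfl fun i _ => ?_
  rw [← congrFun h1 i, Matrix.mulVec, dotProduct, Finset.mul_sum]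
  exact Finset.sum_congr rfl fun j _ => by simp only [smul_eq_mul]; ring

/-- The operator norm of `dh` is the length of the gradient, since `dh` is the inner product with
the gradient. -/
theorem norm_mfderiv_eq {c : M} {h : M → ℝ} {z : EuclideanSpace ℝ (Fin n)}
    (hzt : z ∈ (extChartAt (𝓡∂ n) c).target)
    (hh : MDifferentiableAt (𝓡∂ n) 𝓘(ℝ, ℝ) h ((extChartAt (𝓡∂ n) c).symm z)) :
    ‖mfderiv (𝓡∂ n) 𝓘(ℝ, ℝ) h ((extChartAt (𝓡∂ n) c).symm z)‖ =
      √(metricForm c z (coordGradient c h z) (coordGradient c h z)) := by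
  set V : TangentSpace (𝓡∂ n) ((extChartAt (𝓡∂ n) c).symm z) :=
    ∑ i, coordGradient c h z i • coordVector c i z with hV
  have hVW : ∀ W, mfderiv (𝓡∂ n) 𝓘(ℝ, ℝ) h ((extChartAt (𝓡∂ n) c).symm z) W = inner ℝ V W := by
    intro W
    have hW := sum_coordComponent_smul_coordVector c hzt W
    have := mfderiv_sum_smul_coordVector hzt hh (WithLp.toLp 2 fun j => coordComponent c _ j W)
    rw [← metricForm_coordGradient hzt, metricForm_apply] at this
    simpa only [hW] using this
  have hn : ‖mfderiv (𝓡∂ n) 𝓘(ℝ, ℝ) h ((extChartAt (𝓡∂ n) c).symm z)‖ = ‖V‖ :=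
    norm_eq_of_forall_norm_apply_eq fun W => by
      rw [norm_tangentSpace_vectorSpace]
      exact congrArg norm (hVW W)
  rw [hn, metricForm_apply, ← hV, real_inner_self_eq_norm_sq, Real.sqrt_sq (norm_nonneg _)]

end Bridge

/-! ### Time derivatives and parabolic regularity -/

section MixedDerivative

/-- Interchange of the time derivative and a space derivative at the right end of a time interval:
if `∂_s U = W` and `∂_σ W = D` with `D` continuous at `(0, t₀)`, then `s ↦ ∂_σ U (0, s)` has the
derivative `D (0, t₀)` at `t₀`. -/
theorem hasDerivWithinAt_of_mixed {U W D : ℝ → ℝ → ℝ} {d : ℝ → ℝ} {a t₀ : ℝ} (hat : a ≤ t₀)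
    (hUt : ∀ᶠ σ in 𝓝 (0 : ℝ), ∀ s ∈ Icc a t₀, HasDerivWithinAt (U σ) (W σ s) (Icc a t₀) s)
    (hWσ : ∀ᶠ σ in 𝓝 (0 : ℝ), ∀ s ∈ Icc a t₀, HasDerivAt (fun τ => W τ s) (D σ s) σ)
    (hD : ContinuousWithinAt (fun p : ℝ × ℝ => D p.1 p.2) (univ ×ˢ Icc a t₀) (0, t₀))
    (hUσ : ∀ s ∈ Icc a t₀, HasDerivAt (fun τ => U τ s) (d s) 0) :
    HasDerivWithinAt d (D 0 t₀) (Icc a t₀) t₀ := by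
  set L := D 0 t₀ with hL
  rw [hasDerivWithinAt_iff_isLittleO, Asymptotics.isLittleO_iff]
  intro ε hε
  have h1 : ∀ᶠ p : ℝ × ℝ in 𝓝[univ ×ˢ Icc a t₀] (0, t₀), ‖D p.1 p.2 - L‖ ≤ ε := by
    have := (tendsto_iff_norm_sub_tendsto_zero.1 hD).eventually (gt_mem_nhds hε)
    exact this.mono fun p hp => hp.le
  rw [nhdsWithin_prod_eq, nhdsWithin_univ, Filter.eventually_prod_iff] at h1
  obtain ⟨pa, hpa, pb, hpb, h1⟩ := h1
  obtain ⟨δ, hδ, hball⟩ := Metric.eventually_nhds_iff_ball.1 ((hpa.and hUt).and hWσ)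
  obtain ⟨η, hη, hηball⟩ := Metric.mem_nhdsWithin_iff.1 hpb
  have hnear : ∀ᶠ s in 𝓝[Icc a t₀] t₀, s ∈ Metric.ball t₀ η ∩ Icc a t₀ :=
    Filter.inter_mem (mem_nhdsWithin_of_mem_nhds (Metric.ball_mem_nhds _ hη)) self_mem_nhdsWithin
  filter_upwards [hnear] with s hs
  have hsub : ∀ r ∈ Icc s t₀, r ∈ Icc a t₀ ∧ pb r := fun r hr => by
    have hr' : r ∈ Icc a t₀ := ⟨hs.2.1.trans hr.1, hr.2⟩
    refine ⟨hr', hηball ⟨?_, hr'⟩⟩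
    have := hs.1
    rw [Metric.mem_ball, Real.dist_eq, abs_lt] at this ⊢
    constructor <;> linarith [hr.1, hr.2]
  -- the increments of `W` in the space variable
  have hW : ∀ σ ∈ Metric.ball (0 : ℝ) δ, ∀ r ∈ Icc s t₀, ‖W σ r - W 0 r - σ * L‖ ≤ ε * ‖σ‖ := by
    intro σ hσ r hr
    have := (convex_ball (0 : ℝ) δ).norm_image_sub_le_of_norm_hasDerivWithin_le
      (f := fun τ => W τ r - τ * L) (f' := fun τ => D τ r - 1 * L) (C := ε)
      (fun τ hτ => (((hball τ hτ).2 r (hsub r hr).1).sub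
        ((hasDerivAt_id τ).mul_const L)).hasDerivWithinAt)
      (fun τ hτ => by simpa using h1 (hball τ hτ).1.1 (hsub r hr).2)
      (Metric.mem_ball_self hδ) hσ
    simp only [zero_mul, sub_zero] at this
    rwa [sub_right_comm] at this
  -- the mixed second differences of `U`
  have hU : ∀ σ ∈ Metric.ball (0 : ℝ) δ,
      ‖(U σ s - U σ t₀) - (U 0 s - U 0 t₀) - σ * ((s - t₀) * L)‖ ≤ (ε * ‖s - t₀‖) * ‖σ‖ := by
    intro σ hσ
    have hst : Icc s t₀ ⊆ Icc a t₀ := fun r hr => (hsub r hr).1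
    have := (convex_Icc s t₀).norm_image_sub_le_of_norm_hasDerivWithin_le
      (f := fun r => U σ r - U 0 r - r * (σ * L))
      (f' := fun r => W σ r - W 0 r - 1 * (σ * L)) (C := ε * ‖σ‖)
      (fun r hr => ((((hball σ hσ).1.2 r (hst hr)).sub
        ((hball 0 (Metric.mem_ball_self hδ)).1.2 r (hst hr))).sub
        ((hasDerivWithinAt_id r _).mul_const (σ * L))).mono hst)
      (fun r hr => by simpa using hW σ hσ r hr)
      (right_mem_Icc.2 hs.2.2) (left_mem_Icc.2 hs.2.2)
    refine le_trans (le_of_eq ?_) (this.trans (le_of_eq ?_))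
    · congr 1
      ring
    · ring
  have hlip := HasDerivAt.le_of_lip' (C := ε * ‖s - t₀‖)
    (((hUσ s hs.2).sub (hUσ t₀ (right_mem_Icc.2 hat))).sub
      ((hasDerivAt_id (0 : ℝ)).mul_const ((s - t₀) * L))) (by positivity) (by
      filter_upwards [Metric.ball_mem_nhds (0 : ℝ) hδ] with σ hσ
      have := hU σ hσ
      simp only [Pi.sub_apply, id, sub_zero, zero_mul]
      refine le_trans (le_of_eq ?_) this
      congr 1
      ring)
  simpa using hlip

/-- A differentiable function on `[a, t₀]` with its maximum at `t₀` has a nonnegative derivative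
there. -/
theorem deriv_nonneg_of_isMaxOn_right {q : ℝ → ℝ} {q' a t₀ : ℝ} (hat : a < t₀)
    (hq : HasDerivWithinAt q q' (Icc a t₀) t₀) (hmax : ∀ t ∈ Icc a t₀, q t ≤ q t₀) : 0 ≤ q' := by
  have h1 : IsLocalMaxOn q (Icc a t₀) t₀ :=
    Filter.eventually_of_mem self_mem_nhdsWithin hmax
  have h2 := h1.hasFDerivWithinAt_nonpos hq.hasFDerivWithinAt
    (mem_posTangentConeAt_of_segment_subset (y := a - t₀)
      (by rw [add_sub_cancel]; exact (convex_Icc a t₀).segment_subset (right_mem_Icc.2 hat.le)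
            (left_mem_Icc.2 hat.le)))
  simp only [ContinuousLinearMap.toSpanSingleton_apply, smul_eq_mul] at h2
  nlinarith

end MixedDerivative

section Regularity

theorem timeDeriv_zero {M : Type*} (T : EReal) (u : M → ℝ → ℝ) (x : M) (t : ℝ) :
    timeDeriv T 0 u x t = u x t := by
  simp [timeDeriv]

theorem Icc_subset_timeSet {T : EReal} {t : ℝ} (ht : t ∈ timeSet T) : Icc 0 t ⊆ timeSet T :=
  fun _ hs => ⟨hs.1, (EReal.coe_le_coe_iff.2 hs.2).trans ht.2⟩

variable {n : ℕ} [NeZero n] {M : Type*} [TopologicalSpace M]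
  [ChartedSpace (EuclideanHalfSpace n) M]

theorem ParabolicContDiff.contMDiff {k : ℕ} {T : EReal} {u : M → ℝ → ℝ}
    (hu : ParabolicContDiff n k T u) {t : ℝ} (ht : t ∈ timeSet T) :
    ContMDiff (𝓡∂ n) 𝓘(ℝ, ℝ) (k : WithTop ℕ∞) (fun x => u x t) := by
  have := (hu 0 (by simp)).2.1 t ht
  simpa only [timeDeriv_zero, mul_zero, Nat.sub_zero] using this

theorem ParabolicContDiff.hasDerivWithinAt {k : ℕ} {T : EReal} {u : M → ℝ → ℝ}
    (hu : ParabolicContDiff n k T u) (hk : 2 ≤ k) {t : ℝ} (ht : t ∈ timeSet T) (x : M) :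
    HasDerivWithinAt (u x) (timeDeriv T 1 u x t) (timeSet T) t := by
  have h := (hu 1 (by omega)).1 x t ht
  have h1 := (h.differentiableWithinAt (by simp)).hasDerivWithinAt
  rwa [← iteratedDerivWithin_one] at h1

theorem ParabolicContDiff.continuousOn_inChart {k : ℕ} {T : EReal} {u : M → ℝ → ℝ}
    (hu : ParabolicContDiff n k T u) {r : ℕ} (hr : 2 * r ≤ k) (c : M) :
    ContinuousOn (fun p : EuclideanSpace ℝ (Fin n) × ℝ =>
      inChart c (fun x => timeDeriv T r u x p.2) p.1)
      ((extChartAt (𝓡∂ n) c).target ×ˢ timeSet T) := by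
  have h := (hu r hr).2.2 c 0 (by omega)
  have h2 : Continuous fun m : EuclideanSpace ℝ (Fin n) [×0]→L[ℝ] ℝ => m 0 :=
    continuous_eval_const _
  exact h2.comp_continuousOn h

theorem ParabolicContDiff.continuousOn_coordDeriv {k : ℕ} {T : EReal} {u : M → ℝ → ℝ}
    (hu : ParabolicContDiff n k T u) {r : ℕ} (hr : 1 + 2 * r ≤ k) (c : M) (i : Fin n) :
    ContinuousOn (fun p : EuclideanSpace ℝ (Fin n) × ℝ =>
      coordDeriv i (inChart c (fun x => timeDeriv T r u x p.2)) p.1)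
      ((extChartAt (𝓡∂ n) c).target ×ˢ timeSet T) := by
  have h := (hu r (by omega)).2.2 c 1 hr
  have h2 : Continuous fun m : EuclideanSpace ℝ (Fin n) [×1]→L[ℝ] ℝ =>
      m fun _ => EuclideanSpace.single i 1 := continuous_eval_const _
  refine (h2.comp_continuousOn h).congr fun p hp => ?_
  simp only [Function.comp]
  rw [iteratedFDerivWithin_one_apply
    ((𝓡∂ n).uniqueDiffOn _ (extChartAt_target_subset_range c hp.1))]
  rfl

theorem ContMDiff.contDiffAt_inChart [IsManifold (𝓡∂ n) ∞ M] {h : M → ℝ} {k : ℕ}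
    (hh : ContMDiff (𝓡∂ n) 𝓘(ℝ, ℝ) (k : WithTop ℕ∞) h) {c : M} {z : EuclideanSpace ℝ (Fin n)}
    (hzt : z ∈ (extChartAt (𝓡∂ n) c).target) (hz : range (𝓡∂ n) ∈ 𝓝 z) :
    ContDiffAt ℝ k (inChart c h) z := by
  have : IsManifold (𝓡∂ n) k M := IsManifold.of_le (n := ∞) ENat.LEInfty.out
  have h1 : ContMDiffWithinAt 𝓘(ℝ, EuclideanSpace ℝ (Fin n)) (𝓡∂ n) k
      (extChartAt (𝓡∂ n) c).symm (range (𝓡∂ n)) z :=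
    contMDiffWithinAt_extChartAt_symm_range c hzt
  exact ((hh _).comp_contMDiffWithinAt z h1).contDiffWithinAt.contDiffAt hz

end Regularity

/-! ### The length of the gradient and the time derivative at a maximum -/

section GradLength

variable {n : ℕ} [NeZero n] {M : Type*} [TopologicalSpace M]
  [ChartedSpace (EuclideanHalfSpace n) M]

theorem ParabolicContDiff.continuousOn {k : ℕ} {T : EReal} {u : M → ℝ → ℝ}
    (hu : ParabolicContDiff n k T u) :
    ContinuousOn (fun p : M × ℝ => u p.1 p.2) (univ ×ˢ timeSet T) := by
  rintro ⟨x₀, t₀⟩ ⟨-, ht₀⟩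
  have hF := hu.continuousOn_inChart (r := 0) (by omega) x₀
  simp only [timeDeriv_zero] at hF
  have hmap : ContinuousOn (fun p : M × ℝ => (extChartAt (𝓡∂ n) x₀ p.1, p.2))
      ((extChartAt (𝓡∂ n) x₀).source ×ˢ timeSet T) :=
    ((continuousOn_extChartAt x₀).comp continuousOn_fst fun p hp => hp.1).prodMk continuousOn_snd
  have hall : ContinuousOn (fun p : M × ℝ => u p.1 p.2)
      ((extChartAt (𝓡∂ n) x₀).source ×ˢ timeSet T) :=
    (hF.comp hmap fun p hp => ⟨(extChartAt (𝓡∂ n) x₀).map_source hp.1, hp.2⟩).congr fun p hp => by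
      simp only [Function.comp, inChart, (extChartAt (𝓡∂ n) x₀).left_inv hp.1]
  refine (hall (x₀, t₀) ⟨mem_extChartAt_source x₀, ht₀⟩).mono_of_mem_nhdsWithin ?_
  rw [nhdsWithin_prod_eq, nhdsWithin_univ]
  exact Filter.prod_mem_prod (extChartAt_source_mem_nhds x₀) self_mem_nhdsWithin

variable [RiemannianBundle (fun x : M => TangentSpace (𝓡∂ n) x)]

variable (n) in
/-- The norm of the gradient as a real number. -/
def gradLength (h : M → ℝ) (x : M) : ℝ :=
  ‖mfderiv (𝓡∂ n) 𝓘(ℝ, ℝ) h x‖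

theorem gradLength_nonneg (h : M → ℝ) (x : M) : 0 ≤ gradLength n h x :=
  norm_nonneg (mfderiv (𝓡∂ n) 𝓘(ℝ, ℝ) h x)

theorem gradNorm_eq_ofReal (h : M → ℝ) (x : M) :
    gradNorm (n := n) h x = ENNReal.ofReal (gradLength n h x) :=
  (ofReal_norm (mfderiv (𝓡∂ n) 𝓘(ℝ, ℝ) h x)).symm

section OneSmooth

variable [IsManifold (𝓡∂ n) 1 M] {c : M} {h : M → ℝ} {z : EuclideanSpace ℝ (Fin n)}

theorem gradLength_symm_eq (hzt : z ∈ (extChartAt (𝓡∂ n) c).target)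
    (hh : MDifferentiableAt (𝓡∂ n) 𝓘(ℝ, ℝ) h ((extChartAt (𝓡∂ n) c).symm z)) :
    gradLength n h ((extChartAt (𝓡∂ n) c).symm z)
      = √(metricForm c z (coordGradient c h z) (coordGradient c h z)) :=
  norm_mfderiv_eq hzt hh

theorem sq_gradLength_symm (hzt : z ∈ (extChartAt (𝓡∂ n) c).target)
    (hh : MDifferentiableAt (𝓡∂ n) 𝓘(ℝ, ℝ) h ((extChartAt (𝓡∂ n) c).symm z)) :
    gradLength n h ((extChartAt (𝓡∂ n) c).symm z) ^ 2
      = metricForm c z (coordGradient c h z) (coordGradient c h z) := by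
  rw [gradLength_symm_eq hzt hh, Real.sq_sqrt (metricForm_nonneg c z _)]

theorem fderiv_inChart_eq (hzt : z ∈ (extChartAt (𝓡∂ n) c).target) (hz : range (𝓡∂ n) ∈ 𝓝 z)
    (w : EuclideanSpace ℝ (Fin n)) :
    fderiv ℝ (inChart c h) z w = metricForm c z (coordGradient c h z) w := by
  rw [metricForm_coordGradient hzt, fderiv_eq_sum_coordDeriv hz]

theorem abs_fderiv_inChart_le (hzt : z ∈ (extChartAt (𝓡∂ n) c).target) (hz : range (𝓡∂ n) ∈ 𝓝 z)
    (hh : MDifferentiableAt (𝓡∂ n) 𝓘(ℝ, ℝ) h ((extChartAt (𝓡∂ n) c).symm z))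
    (w : EuclideanSpace ℝ (Fin n)) :
    |fderiv ℝ (inChart c h) z w|
      ≤ gradLength n h ((extChartAt (𝓡∂ n) c).symm z) * √(metricForm c z w w) := by
  rw [fderiv_inChart_eq hzt hz, gradLength_symm_eq hzt hh, metricForm_apply, metricForm_apply,
    metricForm_apply, ← norm_eq_sqrt_real_inner, ← norm_eq_sqrt_real_inner]
  exact abs_real_inner_le_norm _ _

end OneSmooth

variable [IsManifold (𝓡∂ n) ∞ M]
  [IsContMDiffRiemannianBundle (𝓡∂ n) ∞ (EuclideanSpace ℝ (Fin n))
      (fun x : M => TangentSpace (𝓡∂ n) x)]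

theorem ParabolicContDiff.continuousOn_gradLength {k : ℕ} {T : EReal} {u : M → ℝ → ℝ}
    (hu : ParabolicContDiff n k T u) (hk : 1 ≤ k) :
    ContinuousOn (fun p : M × ℝ => gradLength n (fun x => u x p.2) p.1) (univ ×ˢ timeSet T) := by
  have h1M : IsManifold (𝓡∂ n) 1 M := IsManifold.of_le (n := ∞) ENat.LEInfty.out
  rintro ⟨x₀, t₀⟩ ⟨-, ht₀⟩
  set c := x₀
  have hgrad : ContinuousOn (fun p : EuclideanSpace ℝ (Fin n) × ℝ =>
      coordGradient c (fun x => u x p.2) p.1) ((extChartAt (𝓡∂ n) c).target ×ˢ timeSet T) := by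
    refine (PiLp.continuous_toLp 2 _).comp_continuousOn (continuousOn_pi.2 fun i => ?_)
    have hsum : ContinuousOn (fun p : EuclideanSpace ℝ (Fin n) × ℝ => ∑ j,
        (metricMatrix c p.1)⁻¹ i j * coordDeriv j (inChart c fun x => u x p.2) p.1)
        ((extChartAt (𝓡∂ n) c).target ×ˢ timeSet T) := by
      refine continuousOn_finsetSum _ fun j _ => ContinuousOn.mul ?_ ?_
      · have : ContinuousOn (fun z => (metricMatrix c z)⁻¹ i j) (extChartAt (𝓡∂ n) c).target :=
          fun z hz => (contDiffWithinAt_matrix_inv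
            (fun i j => contDiffWithinAt_metricMatrix c i j hz)
            (det_metricMatrix_ne_zero c hz) i j).continuousWithinAt.mono
            (extChartAt_target_subset_range c)
        exact this.comp continuousOn_fst fun p hp => hp.1
      · have := hu.continuousOn_coordDeriv (r := 0) (by omega) c j
        simpa only [timeDeriv_zero] using this
    exact hsum
  have hmet : ContinuousOn (metricForm c) (extChartAt (𝓡∂ n) c).target := fun z hz =>
    (contDiffWithinAt_metricForm c hz).continuousWithinAt.mono (extChartAt_target_subset_range c)
  have hF : ContinuousOn (fun p : EuclideanSpace ℝ (Fin n) × ℝ =>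
      √(metricForm c p.1 (coordGradient c (fun x => u x p.2) p.1)
        (coordGradient c (fun x => u x p.2) p.1)))
      ((extChartAt (𝓡∂ n) c).target ×ˢ timeSet T) :=
    ((((hmet.comp continuousOn_fst fun p hp => hp.1).clm_apply hgrad).clm_apply hgrad)).sqrt
  have hmap : ContinuousOn (fun p : M × ℝ => (extChartAt (𝓡∂ n) c p.1, p.2))
      ((extChartAt (𝓡∂ n) c).source ×ˢ timeSet T) :=
    ((continuousOn_extChartAt c).comp continuousOn_fst fun p hp => hp.1).prodMk continuousOn_snd
  have hcomp := hF.comp hmap fun p hp => ⟨(extChartAt (𝓡∂ n) c).map_source hp.1, hp.2⟩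
  have hall : ContinuousOn (fun p : M × ℝ => gradLength n (fun x => u x p.2) p.1)
      ((extChartAt (𝓡∂ n) c).source ×ˢ timeSet T) := by
    refine hcomp.congr fun p hp => ?_
    have hd := ((hu.contMDiff hp.2).mdifferentiable (by
      simpa using (Nat.one_le_iff_ne_zero.1 hk))) p.1
    have := gradLength_symm_eq (c := c) (h := fun x => u x p.2)
      ((extChartAt (𝓡∂ n) c).map_source hp.1) (by rwa [(extChartAt (𝓡∂ n) c).left_inv hp.1])
    rwa [(extChartAt (𝓡∂ n) c).left_inv hp.1] at this
  refine (hall (x₀, t₀) ⟨mem_extChartAt_source x₀, ht₀⟩).mono_of_mem_nhdsWithin ?_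
  rw [nhdsWithin_prod_eq, nhdsWithin_univ]
  exact Filter.prod_mem_prod (extChartAt_source_mem_nhds x₀) self_mem_nhdsWithin

end GradLength

section InteriorMaximum

variable {n : ℕ} [NeZero n] {M : Type*} [TopologicalSpace M]
  [ChartedSpace (EuclideanHalfSpace n) M] [IsManifold (𝓡∂ n) ∞ M]

theorem isInteriorPoint_symm_iff {c : M} {z : EuclideanSpace ℝ (Fin n)}
    (hzt : z ∈ (extChartAt (𝓡∂ n) c).target) :
    (extChartAt (𝓡∂ n) c).symm z ∈ (𝓡∂ n).interior M ↔ (extChartAt (𝓡∂ n) c).target ∈ 𝓝 z := by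
  have hs := (extChartAt (𝓡∂ n) c).map_target hzt
  have h := ModelWithCorners.isInteriorPoint_iff_of_mem_atlas (I := 𝓡∂ n) (n := ∞) (by simp)
    (chart_mem_atlas (EuclideanHalfSpace n) c) (x := (extChartAt (𝓡∂ n) c).symm z)
    (by simpa using hs)
  refine h.trans ?_
  rw [mem_interior_iff_mem_nhds]
  have : (chartAt (EuclideanHalfSpace n) c).extend (𝓡∂ n) ((extChartAt (𝓡∂ n) c).symm z) = z :=
    (extChartAt (𝓡∂ n) c).right_inv hzt
  rw [this]
  rfl

/-- The first order condition in time for a function `u` whose derivative in the direction `y` is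
bounded by the barrier up to the time `t₀`, with equality at `t₀`. -/
theorem ParabolicContDiff.time_condition {T : EReal} {u : M → ℝ → ℝ}
    (hu : ParabolicContDiff n 3 T u) {c : M} {z y : EuclideanSpace ℝ (Fin n)}
    (hzt : (extChartAt (𝓡∂ n) c).target ∈ 𝓝 z) {t₀ : ℝ} (ht₀ : t₀ ∈ timeSet T) (hpos : 0 < t₀) {m B : ℝ}
    (hle : ∀ t ∈ Icc 0 t₀, fderiv ℝ (inChart c fun x => u x t) z y
      ≤ m * barrier B (inChart c (fun x => u x t) z))
    (heq : fderiv ℝ (inChart c fun x => u x t₀) z y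
      = m * barrier B (inChart c (fun x => u x t₀) z)) :
    m * (-2 * (inChart c (fun x => u x t₀) z + B + 1)) * inChart c (fun x => timeDeriv T 1 u x t₀) z
      ≤ fderiv ℝ (inChart c fun x => timeDeriv T 1 u x t₀) z y := by
  have hsub : Icc 0 t₀ ⊆ timeSet T := Icc_subset_timeSet ht₀
  have hrange : ∀ {x : EuclideanSpace ℝ (Fin n)}, (extChartAt (𝓡∂ n) c).target ∈ 𝓝 x →
      range (𝓡∂ n) ∈ 𝓝 x := fun h => Filter.mem_of_superset h (extChartAt_target_subset_range c)
  have hline : Filter.Tendsto (fun σ : ℝ => z + σ • y) (𝓝 0) (𝓝 z) := by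
    have := (hasDerivAt_line z y 0).continuousAt.tendsto
    rwa [zero_smul, add_zero] at this
  have hnear : ∀ᶠ σ : ℝ in 𝓝 0, (extChartAt (𝓡∂ n) c).target ∈ 𝓝 (z + σ • y) :=
    hline.eventually (eventually_mem_nhds_iff.2 hzt)
  have hdu : ∀ t ∈ Icc 0 t₀, HasDerivWithinAt (fun s => inChart c (fun x => u x s) z)
      (inChart c (fun x => timeDeriv T 1 u x t) z) (Icc 0 t₀) t := fun t ht =>
    (hu.hasDerivWithinAt (by norm_num) (hsub ht) _).mono hsub
  have hmixed := hasDerivWithinAt_of_mixed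
    (U := fun σ s => inChart c (fun x => u x s) (z + σ • y))
    (W := fun σ s => inChart c (fun x => timeDeriv T 1 u x s) (z + σ • y))
    (D := fun σ s => fderiv ℝ (inChart c fun x => timeDeriv T 1 u x s) (z + σ • y) y)
    (d := fun s => fderiv ℝ (inChart c fun x => u x s) z y) hpos.le
    (Filter.Eventually.of_forall fun σ s hs =>
      (hu.hasDerivWithinAt (by norm_num) (hsub hs) _).mono hsub)
    (by
      filter_upwards [hnear] with σ hσ s hs
      have h1 := (hu 1 (by norm_num)).2.1 s (hsub hs)
      exact (((h1.contDiffAt_inChart (mem_of_mem_nhds hσ) (hrange hσ))).differentiableAt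
        (by norm_num)).hasDerivAt_line)
    (by
      have h1 : ContinuousOn (fun p : EuclideanSpace ℝ (Fin n) × ℝ =>
          ∑ i, y i * coordDeriv i (inChart c fun x => timeDeriv T 1 u x p.2) p.1)
          ((extChartAt (𝓡∂ n) c).target ×ˢ timeSet T) :=
        continuousOn_finsetSum _ fun i _ => continuousOn_const.mul
          (hu.continuousOn_coordDeriv (r := 1) (by norm_num) c i)
      have hmap : Continuous fun p : ℝ × ℝ => (z + p.1 • y, p.2) := by fun_prop
      have h2 := (h1 (z + (0 : ℝ) • y, t₀) ⟨by simpa using mem_of_mem_nhds hzt, ht₀⟩).comp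
        (f := fun p : ℝ × ℝ => (z + p.1 • y, p.2)) (x := ((0 : ℝ), t₀))
        (s := {σ | (extChartAt (𝓡∂ n) c).target ∈ 𝓝 (z + σ • y)} ×ˢ Icc 0 t₀)
        hmap.continuousWithinAt fun p hp => ⟨mem_of_mem_nhds hp.1, hsub hp.2⟩
      have h3 : ContinuousWithinAt (fun p : ℝ × ℝ =>
          fderiv ℝ (inChart c fun x => timeDeriv T 1 u x p.2) (z + p.1 • y) y)
          ({σ | (extChartAt (𝓡∂ n) c).target ∈ 𝓝 (z + σ • y)} ×ˢ Icc 0 t₀) (0, t₀) :=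
        h2.congr_of_mem (fun p hp => fderiv_eq_sum_coordDeriv (hrange hp.1) y)
          ⟨by simpa using hzt, right_mem_Icc.2 hpos.le⟩
      refine h3.mono_of_mem_nhdsWithin ?_
      rw [nhdsWithin_prod_eq, nhdsWithin_univ]
      exact Filter.prod_mem_prod hnear self_mem_nhdsWithin)
    (fun s hs => by
      have h1 := (hu.contMDiff (hsub hs)).contDiffAt_inChart (mem_of_mem_nhds hzt) (hrange hzt)
      exact DifferentiableAt.hasDerivAt_line_zero (h1.differentiableAt (by norm_num)) y)
  have hbar : HasDerivWithinAt (fun s => m * barrier B (inChart c (fun x => u x s) z))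
      (m * (-2 * (inChart c (fun x => u x t₀) z + B + 1)
        * inChart c (fun x => timeDeriv T 1 u x t₀) z)) (Icc 0 t₀) t₀ :=
    ((hasDerivAt_barrier B _).comp_hasDerivWithinAt t₀
      (hdu t₀ (right_mem_Icc.2 hpos.le))).const_mul m
  have := deriv_nonneg_of_isMaxOn_right hpos (hmixed.sub hbar) fun t ht => by
    simp only [Pi.sub_apply, heq, sub_self]
    linarith [hle t ht]
  simp only [zero_smul, add_zero] at this
  linarith

end InteriorMaximum

/-! ### The estimate on the manifold -/

section Interior

variable {n : ℕ} [NeZero n] {M : Type*} [TopologicalSpace M]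
  [ChartedSpace (EuclideanHalfSpace n) M]
  [RiemannianBundle (fun x : M => TangentSpace (𝓡∂ n) x)] [IsManifold (𝓡∂ n) ∞ M]

/-- The bound for `|∇u|` at an interior point, at a positive time, at which `|∇u|` divided by the
barrier attains its maximum over all earlier times. -/
theorem IsAdmissibleSolution.gradLength_le_of_interior_max {f : (Fin (n + 1) → ℝ) → ℝ}
    {Γ : Set (Fin (n + 1) → ℝ)} (hΓ : IsSymmetricCone Γ) (hf : IsSmoothSymmetricOn f Γ)
    (hf_incr : ∀ lam ∈ Γ, ∀ i, 0 < partialDeriv f i lam)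
    (hf_conc : ConcaveOn ℝ Γ f) {ν₀ : ℝ} (hν₀ : 0 < ν₀)
    (hf_neg : ∀ lam ∈ Γ, ∀ j, lam j < 0 →
      ν₀ * (1 + ∑ i, partialDeriv f i lam) ≤ partialDeriv f j lam)
    {K₀ : ℝ} (hK₀ : 0 ≤ K₀)
    (hf_euler : ∀ lam ∈ Γ,
      -K₀ * (1 + ∑ i, partialDeriv f i lam) ≤ ∑ i, partialDeriv f i lam * lam i)
    {χ : (x : M) → TangentSpace (𝓡∂ n) x →L[ℝ] TangentSpace (𝓡∂ n) x →L[ℝ] ℝ}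
    {T : EReal} {ψ u : M → ℝ → ℝ} (hψ : ParabolicContDiff n 1 T ψ)
    (hu : ParabolicContDiff n 3 T u) (hsol : IsAdmissibleSolution f Γ χ ψ T u)
    {R A B m t₀ : ℝ} {c x₀ : M} (hc : x₀ ∈ (extChartAt (𝓡∂ n) c).source)
    (hx₀ : x₀ ∈ (𝓡∂ n).interior M) (ht₀ : t₀ ∈ timeSet T) (hpos : 0 < t₀)
    (hg : GeometryBound R (metricForm c) (christoffelForm c) (tensorForm c χ)
      (extChartAt (𝓡∂ n) c x₀))
    (hψA : gradLength n (fun x => ψ x t₀) x₀ ≤ A) (huB : |u x₀ t₀| ≤ B)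
    (hm : 0 ≤ m) (hle : ∀ x, ∀ t ∈ Icc 0 t₀,
      gradLength n (fun x => u x t) x ≤ m * barrier B (u x t))
    (heq : gradLength n (fun x => u x t₀) x₀ = m * barrier B (u x₀ t₀)) :
    gradLength n (fun x => u x t₀) x₀ ≤ √(interiorBound n R A B ν₀ K₀) := by
  have h1M : IsManifold (𝓡∂ n) 1 M := IsManifold.of_le (n := ∞) ENat.LEInfty.out
  set z := extChartAt (𝓡∂ n) c x₀ with hz
  have hzt : z ∈ (extChartAt (𝓡∂ n) c).target := (extChartAt (𝓡∂ n) c).map_source hc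
  have hxz : (extChartAt (𝓡∂ n) c).symm z = x₀ := (extChartAt (𝓡∂ n) c).left_inv hc
  have htn : (extChartAt (𝓡∂ n) c).target ∈ 𝓝 z :=
    (isInteriorPoint_symm_iff hzt).1 (by rwa [hxz])
  have hrange : ∀ {x : EuclideanSpace ℝ (Fin n)}, (extChartAt (𝓡∂ n) c).target ∈ 𝓝 x →
      range (𝓡∂ n) ∈ 𝓝 x := fun h => Filter.mem_of_superset h (extChartAt_target_subset_range c)
  have huz : ∀ t, inChart c (fun x => u x t) z = u x₀ t := fun t => by rw [inChart, hxz]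
  have hdu : ∀ {t : ℝ}, t ∈ timeSet T → ∀ x, MDifferentiableAt (𝓡∂ n) 𝓘(ℝ, ℝ)
      (fun x => u x t) x := fun ht => (hu.contMDiff ht).mdifferentiable (by norm_num)
  have hdψ : MDifferentiableAt (𝓡∂ n) 𝓘(ℝ, ℝ) (fun x => ψ x t₀) x₀ :=
    (hψ.contMDiff ht₀).mdifferentiable (by norm_num) x₀
  set P := gradLength n (fun x => u x t₀) x₀ with hP
  have hP0 : 0 ≤ P := gradLength_nonneg _ _
  rcases hP0.eq_or_lt with hP0' | hPpos
  · rw [← hP0']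
    exact Real.sqrt_nonneg _
  refine Real.le_sqrt_of_sq_le ?_
  have hA : 0 ≤ A := (gradLength_nonneg _ _).trans hψA
  -- the unit vector in the direction of the gradient
  set V := coordGradient c (fun x => u x t₀) z with hV
  have hVP : metricForm c z V V = P ^ 2 := by
    have := sq_gradLength_symm (h := fun x => u x t₀) hzt (by rw [hxz]; exact hdu ht₀ x₀)
    rw [hxz] at this
    exact this.symm
  have hy : metricForm c z (P⁻¹ • V) (P⁻¹ • V) = 1 := by
    simp only [map_smul, smul_apply, smul_eq_mul, hVP]
    field_simp
  have hDu : ∀ v, fderiv ℝ (inChart c fun x => u x t₀) z v = P * metricForm c z (P⁻¹ • V) v := by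
    intro v
    rw [fderiv_inChart_eq hzt (hrange htn), map_smul, smul_apply, smul_eq_mul,
      mul_inv_cancel_left₀ hPpos.ne']
  have hbound : ∀ t ∈ Icc 0 t₀, ∀ x, (extChartAt (𝓡∂ n) c).target ∈ 𝓝 x → ∀ Y,
      fderiv ℝ (inChart c fun x => u x t) x Y
        ≤ m * barrier B (inChart c (fun x => u x t) x) * √(metricForm c x Y Y) := by
    intro t ht x hx Y
    refine (le_abs_self _).trans ((abs_fderiv_inChart_le (mem_of_mem_nhds hx) (hrange hx)
      (hdu (Icc_subset_timeSet ht₀ ht) _) Y).trans ?_)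
    exact mul_le_mul_of_nonneg_right (hle _ t ht) (Real.sqrt_nonneg _)
  have hcu : ContDiffAt ℝ 3 (inChart c fun x => u x t₀) z :=
    (hu.contMDiff ht₀).contDiffAt_inChart hzt (hrange htn)
  have hcw : ContDiffAt ℝ 1 (inChart c fun x => timeDeriv T 1 u x t₀) z :=
    ((hu 1 (by norm_num)).2.1 t₀ ht₀).contDiffAt_inChart hzt (hrange htn)
  have hcψ : ContDiffAt ℝ 1 (inChart c fun x => ψ x t₀) z :=
    (hψ.contMDiff ht₀).contDiffAt_inChart hzt (hrange htn)
  refine sq_le_interiorBound (G := metricForm c) (Ch := christoffelForm c) (X := tensorForm c χ)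
    (U := hessianAddForm (inChart c fun x => u x t₀) (christoffelForm c) (tensorForm c χ))
    (u := inChart c fun x => u x t₀) (w := inChart c fun x => timeDeriv T 1 u x t₀)
    (ψ := inChart c fun x => ψ x t₀) (z := z) (y := P⁻¹ • V) (m := m)
    hf_conc hΓ.perm_mem hf.symm
    (fun lam hlam => (hf.smooth.contDiffAt (hΓ.isOpen.mem_nhds hlam)).differentiableAt (by simp))
    hf_incr hν₀ hf_neg hK₀ hf_euler hA hg hcu (by rwa [huz])
    (hcw.differentiableAt (by norm_num)) (hcψ.differentiableAt (by norm_num))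
    (differentiableAt_hessianAddForm hcu hg.differentiableAt_christoffel hg.differentiableAt_tensor)
    (Filter.Eventually.of_forall fun x v v' => hessianAddForm_apply x v v') ?_ hP0 hm
    (by rw [huz]; exact heq) hy hDu ?_ ?_ ?_
  · filter_upwards [eventually_mem_nhds_iff.2 htn] with x hx
    have hxt := mem_of_mem_nhds hx
    obtain ⟨lam, h1, h2, h3⟩ := hsol ((extChartAt (𝓡∂ n) c).symm x)
      ((isInteriorPoint_symm_iff hxt).2 hx) t₀ ht₀ hpos c
      (by simpa using (extChartAt (𝓡∂ n) c).map_target hxt)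
    have hcx : ContDiffAt ℝ 3 (inChart c fun x => u x t₀) x :=
      (hu.contMDiff ht₀).contDiffAt_inChart hxt (hrange hx)
    obtain ⟨ε, hε⟩ := h1.exists_isEigenbasis hxt (hrange hx) (hcx.of_le (by norm_num)) rfl
    exact ⟨ε, lam, hε, h2, h3⟩
  · have h1 := abs_fderiv_inChart_le (h := fun x => ψ x t₀) hzt (hrange htn)
      (by rw [hxz]; exact hdψ) (P⁻¹ • V)
    rw [hy, Real.sqrt_one, mul_one, hxz] at h1
    exact (abs_le.1 (h1.trans hψA)).1
  · filter_upwards [eventually_mem_nhds_iff.2 htn] with x hx Y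
    exact hbound t₀ (right_mem_Icc.2 hpos.le) x hx Y
  · refine hu.time_condition htn ht₀ hpos (fun t ht => ?_) ?_
    · have := hbound t ht z htn (P⁻¹ • V)
      rwa [hy, Real.sqrt_one, mul_one] at this
    · rw [hDu, hy, mul_one, huz, heq]

end Interior

section UniformGeometry

variable {n : ℕ} [NeZero n] {M : Type*} [TopologicalSpace M] [CompactSpace M]
  [ChartedSpace (EuclideanHalfSpace n) M] [IsManifold (𝓡∂ n) ∞ M]
  [RiemannianBundle (fun x : M => TangentSpace (𝓡∂ n) x)]
  [IsContMDiffRiemannianBundle (𝓡∂ n) ∞ (EuclideanSpace ℝ (Fin n))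
      (fun x : M => TangentSpace (𝓡∂ n) x)]

/-- On a compact manifold, finitely many charts, each over a compact part of its domain, give one
bound for the geometry at every interior point. -/
theorem exists_uniform_geometryBound
    {χ : (x : M) → TangentSpace (𝓡∂ n) x →L[ℝ] TangentSpace (𝓡∂ n) x →L[ℝ] ℝ}
    (hχ : ContMDiff (𝓡∂ n)
      ((𝓡∂ n).prod 𝓘(ℝ, EuclideanSpace ℝ (Fin n) →L[ℝ] EuclideanSpace ℝ (Fin n) →L[ℝ] ℝ)) ∞
      (fun x => TotalSpace.mk'
        (EuclideanSpace ℝ (Fin n) →L[ℝ] EuclideanSpace ℝ (Fin n) →L[ℝ] ℝ) x (χ x))) :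
    ∃ R : ℝ, ∀ x ∈ (𝓡∂ n).interior M, ∃ c : M, x ∈ (extChartAt (𝓡∂ n) c).source ∧
      GeometryBound R (metricForm c) (christoffelForm c) (tensorForm c χ)
        (extChartAt (𝓡∂ n) c x) := by
  have h : ∀ c : M, ∃ N ∈ 𝓝 c, N ⊆ (extChartAt (𝓡∂ n) c).source ∧ ∃ R₀ : ℝ, ∀ R, R₀ ≤ R →
      ∀ x ∈ N, x ∈ (𝓡∂ n).interior M → GeometryBound R (metricForm c) (christoffelForm c)
        (tensorForm c χ) (extChartAt (𝓡∂ n) c x) := by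
    intro c
    obtain ⟨r, hr, hball⟩ := (nhdsWithin_hasBasis Metric.nhds_basis_closedBall _).mem_iff.1
      (extChartAt_target_mem_nhdsWithin (I := 𝓡∂ n) c)
    have hK : IsCompact (Metric.closedBall (extChartAt (𝓡∂ n) c c) r ∩ range (𝓡∂ n)) :=
      (isCompact_closedBall _ _).inter_right (𝓡∂ n).isClosed_range
    obtain ⟨R₀, hR₀⟩ := exists_geometryBound c hK hball hχ
    refine ⟨(extChartAt (𝓡∂ n) c).source ∩
      extChartAt (𝓡∂ n) c ⁻¹' Metric.closedBall (extChartAt (𝓡∂ n) c c) r,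
      Filter.inter_mem (extChartAt_source_mem_nhds c)
        ((continuousAt_extChartAt c).preimage_mem_nhds (Metric.closedBall_mem_nhds _ hr)),
      inter_subset_left, R₀, fun R hR x hx hint => ?_⟩
    have hzt := (extChartAt (𝓡∂ n) c).map_source hx.1
    refine hR₀ R hR _ ⟨hx.2, extChartAt_target_subset_range c hzt⟩
      (Filter.mem_of_superset ((isInteriorPoint_symm_iff hzt).1 ?_)
        (extChartAt_target_subset_range c))
    rwa [(extChartAt (𝓡∂ n) c).left_inv hx.1]
  choose N hN hsrc R₀ hR₀ using h
  obtain ⟨s, hs⟩ := CompactSpace.elim_nhds_subcover N hN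
  obtain ⟨R, hR⟩ := (s.image R₀).exists_le
  refine ⟨R, fun x hx => ?_⟩
  have hxs : x ∈ ⋃ c ∈ s, N c := by rw [hs]; trivial
  obtain ⟨c, hc, hxc⟩ := mem_iUnion₂.1 hxs
  exact ⟨c, hsrc c hxc, hR₀ c R (hR _ (Finset.mem_image_of_mem _ hc)) x hxc hx⟩

end UniformGeometry

section Final

theorem abs_le_of_c0Norm_le {M : Type*} {T : EReal} {u : M → ℝ → ℝ} {B : ℝ≥0} (h : c0Norm T u ≤ B)
    (x : M) {t : ℝ} (ht : t ∈ timeSet T) : |u x t| ≤ B := by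
  have h1 : ‖u x t‖ₑ ≤ B :=
    (le_iSup_of_le x (le_iSup₂_of_le t ht le_rfl) : ‖u x t‖ₑ ≤ c0Norm T u).trans h
  rw [enorm_le_coe] at h1
  exact_mod_cast h1

variable {n : ℕ} [NeZero n] {M : Type*} [TopologicalSpace M]
  [ChartedSpace (EuclideanHalfSpace n) M]
variable [RiemannianBundle (fun x : M => TangentSpace (𝓡∂ n) x)]

theorem gradLength_le_of_c1Norm_le {T : EReal} {ψ : M → ℝ → ℝ} {A : ℝ≥0} (h : c1Norm n T ψ ≤ A)
    (x : M) {t : ℝ} (ht : t ∈ timeSet T) : gradLength n (fun y => ψ y t) x ≤ A := by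
  have h1 : gradNorm (n := n) (fun y => ψ y t) x ≤ gradSup n T ψ :=
    le_iSup_of_le x (le_iSup₂_of_le t ht le_rfl)
  have h2 := (h1.trans le_add_self).trans h
  rw [gradNorm_eq_ofReal, ENNReal.ofReal_le_iff_le_toReal ENNReal.coe_ne_top] at h2
  simpa using h2

end Final

end

theorem theorem3p1 {n : ℕ} [NeZero n] (hn : 2 ≤ n)
    -- a compact smooth Riemannian manifold with (possibly empty) smooth boundary
    {M : Type*} [TopologicalSpace M] [T2Space M] [CompactSpace M]
    [ChartedSpace (EuclideanHalfSpace n) M] [IsManifold (𝓡∂ n) ∞ M]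
    [RiemannianBundle (fun x : M => TangentSpace (𝓡∂ n) x)]
    [IsContMDiffRiemannianBundle (𝓡∂ n) ∞ (EuclideanSpace ℝ (Fin n))
      (fun x : M => TangentSpace (𝓡∂ n) x)]
    -- a smooth symmetric (0, 2) tensor
    (χ : (x : M) → TangentSpace (𝓡∂ n) x →L[ℝ] TangentSpace (𝓡∂ n) x →L[ℝ] ℝ)
    (hχ : ContMDiff (𝓡∂ n)
      ((𝓡∂ n).prod 𝓘(ℝ, EuclideanSpace ℝ (Fin n) →L[ℝ] EuclideanSpace ℝ (Fin n) →L[ℝ] ℝ)) ∞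
      (fun x => TotalSpace.mk'
        (EuclideanSpace ℝ (Fin n) →L[ℝ] EuclideanSpace ℝ (Fin n) →L[ℝ] ℝ) x (χ x)))
    (hχ_symm : ∀ (x : M) (v w : TangentSpace (𝓡∂ n) x), χ x v w = χ x w v)
    -- the function `f` on the cone `Γ`
    (Γ : Set (Fin (n + 1) → ℝ)) (hΓ : IsSymmetricCone Γ)
    (f : (Fin (n + 1) → ℝ) → ℝ) (hf : IsSmoothSymmetricOn f Γ)
    (hf_incr : ∀ lam ∈ Γ, ∀ i, 0 < partialDeriv f i lam)
    (hf_conc : ConcaveOn ℝ Γ f)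
    (ν₀ : ℝ) (hν₀ : 0 < ν₀)
    (hf_neg : ∀ lam ∈ Γ, ∀ j, lam j < 0 →
      ν₀ * (1 + ∑ i, partialDeriv f i lam) ≤ partialDeriv f j lam)
    (K₀ : ℝ) (hK₀ : 0 ≤ K₀)
    (hf_euler : ∀ lam ∈ Γ,
      -K₀ * (1 + ∑ i, partialDeriv f i lam) ≤ ∑ i, partialDeriv f i lam * lam i)
    -- bounds for the norms of `ψ` and `u`
    (A B : ℝ≥0) :
    ∃ C : ℝ≥0, ∀ (T : EReal), 0 < T → ∀ ψ u : M → ℝ → ℝ,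
      ParabolicContDiff n 1 T ψ → c1Norm n T ψ ≤ A →
      ParabolicContDiff n 3 T u → c0Norm T u ≤ B →
      IsAdmissibleSolution f Γ χ ψ T u →
      gradSup n T u ≤ C * (1 + gradSupBoundary n T u) := by
  obtain ⟨R, hR⟩ := exists_uniform_geometryBound hχ
  set ib : ℝ := √(interiorBound n R A B ν₀ K₀) with hib
  set N : ℝ := (2 * B + 1) ^ 2 + 1 with hN
  have hib0 : 0 ≤ ib := Real.sqrt_nonneg _
  have hN0 : 0 ≤ N := by positivity
  refine ⟨(N * (1 + ib)).toNNReal, fun T hT ψ u hψ hψA hu huB hsol => ?_⟩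
  refine iSup_le fun x₁ => iSup₂_le fun t₁ ht₁ => ?_
  have hsub := Icc_subset_timeSet ht₁
  have hB : ∀ x, ∀ t ∈ Icc 0 t₁, |u x t| ≤ B := fun x t ht => abs_le_of_c0Norm_le huB x (hsub ht)
  have hζ : ∀ x, ∀ t ∈ Icc 0 t₁, 0 < barrier B (u x t) := fun x t ht =>
    one_pos.trans_le (one_le_barrier (hB x t ht))
  have hzc : Continuous (barrier B) := by unfold barrier; fun_prop
  -- the maximum of `|∇u|` divided by the barrier up to the time `t₁`
  obtain ⟨⟨x₀, t₀⟩, ⟨-, ht₀⟩, hmax⟩ :=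
    (isCompact_univ.prod (isCompact_Icc (a := (0 : ℝ)) (b := t₁))).exists_isMaxOn
      (f := fun p : M × ℝ => gradLength n (fun x => u x p.2) p.1 / barrier B (u p.1 p.2))
      ⟨(x₁, t₁), trivial, ht₁.1, le_rfl⟩
      (((hu.continuousOn_gradLength (by norm_num)).mono (prod_mono_right hsub)).div
        (hzc.comp_continuousOn (hu.continuousOn.mono (prod_mono_right hsub)))
        fun p hp => (hζ p.1 p.2 hp.2).ne')
  set P := gradLength n (fun x => u x t₀) x₀ with hP
  set m := P / barrier B (u x₀ t₀) with hm
  have hm0 : 0 ≤ m := div_nonneg (gradLength_nonneg _ _) (hζ x₀ t₀ ht₀).le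
  have hle : ∀ x, ∀ t ∈ Icc 0 t₁, gradLength n (fun x => u x t) x ≤ m * barrier B (u x t) :=
    fun x t ht => (div_le_iff₀ (hζ x t ht)).1 (hmax (a := (x, t)) ⟨trivial, ht⟩)
  have heq : P = m * barrier B (u x₀ t₀) := (div_mul_cancel₀ P (hζ x₀ t₀ ht₀).ne').symm
  have hmP : m ≤ P := div_le_self (gradLength_nonneg _ _) (one_le_barrier (hB x₀ t₀ ht₀))
  have hP₁ : gradLength n (fun x => u x t₁) x₁ ≤ N * P := by
    refine (hle x₁ t₁ ⟨ht₁.1, le_rfl⟩).trans ?_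
    rw [mul_comm]
    exact mul_le_mul (barrier_le B _) hmP hm0 hN0
  rw [gradNorm_eq_ofReal]
  have hC : (((N * (1 + ib)).toNNReal : ℝ≥0) : ℝ≥0∞) = ENNReal.ofReal (N * (1 + ib)) := rfl
  rw [hC]
  by_cases hb : t₀ = 0 ∨ x₀ ∈ (𝓡∂ n).boundary M
  · -- a maximum on the parabolic boundary
    have h1 : ENNReal.ofReal P ≤ gradSupBoundary n T u := by
      rw [hP, ← gradNorm_eq_ofReal]
      exact le_iSup₂_of_le (f := fun (p : M × ℝ) (_ : p ∈ parabolicBoundary n M T) =>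
        gradNorm (n := n) (fun y => u y p.2) p.1) (x₀, t₀) ⟨hsub ht₀, hb⟩ le_rfl
    calc ENNReal.ofReal (gradLength n (fun x => u x t₁) x₁) ≤ ENNReal.ofReal (N * P) :=
          ENNReal.ofReal_le_ofReal hP₁
      _ = ENNReal.ofReal N * ENNReal.ofReal P := ENNReal.ofReal_mul hN0
      _ ≤ ENNReal.ofReal (N * (1 + ib)) * (1 + gradSupBoundary n T u) := by
          gcongr
          · nlinarith
          · exact h1.trans le_add_self
  · -- a maximum in the interior at a positive time, to which the local estimate applies
    push Not at hb
    have hpos : 0 < t₀ := lt_of_le_of_ne ht₀.1 hb.1.symm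
    have hint : x₀ ∈ (𝓡∂ n).interior M := by
      rw [← ModelWithCorners.compl_boundary]
      exact hb.2
    obtain ⟨c, hc, hg⟩ := hR x₀ hint
    have hPib : P ≤ ib := hsol.gradLength_le_of_interior_max hΓ hf hf_incr hf_conc hν₀ hf_neg hK₀
      hf_euler hψ hu hc hint (hsub ht₀) hpos hg (gradLength_le_of_c1Norm_le hψA x₀ (hsub ht₀))
      (hB x₀ t₀ ht₀) hm0 (fun x t ht => hle x t ⟨ht.1, ht.2.trans ht₀.2⟩) heq
    calc ENNReal.ofReal (gradLength n (fun x => u x t₁) x₁)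
        ≤ ENNReal.ofReal (N * (1 + ib)) := ENNReal.ofReal_le_ofReal (by nlinarith)
      _ ≤ ENNReal.ofReal (N * (1 + ib)) * (1 + gradSupBoundary n T u) :=
          le_mul_of_one_le_right' le_self_add
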